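/- Let $M\ge 1$, $\vec N=(N_1,\dots,N_M)$ with integers $N_k\ge 1$, $q>0$ with $q\ne 1$, $\lambda,\rho\in\mathbb R$, and $X=\prod_{k=1}^M\{0,\dots,N_k\}$; write $|\eta|=\sum_k\eta_k$. Notation: $[a]_q=\frac{q^a-q^{-a}}{q-q^{-1}}$; $(a;q)_n=\prod_{j=0}^{n-1}(1-aq^j)$; $\binom{N}{n}_{q}=\frac{(q;q)_N}{(q;q)_n(q;q)_{N-n}}$; ${}_{r+1}\varphi_r\big(a_1,\dots,a_{r+1};b_1,\dots,b_r;q,z\big)=\sum_{n\ge0}\frac{(a_1;q)_n\cdots(a_{r+1};q)_n}{(b_1;q)_n\cdots(b_r;q)_n}\frac{z^n}{(q;q)_n}$, which stops after the term $n=K$ if some $a_i=q^{-K}$, $K\in\mathbb Z_{\ge0}$. Put $$h^+_k(\xi)=\rho+\sum_{j=k}^M(2\xi_j-N_j),\qquad h^-_k(\zeta)=\lambda+\sum_{j=1}^k(2\zeta_j-N_j).$$ **Processes.** Let $c^+_k(\eta)=q^{-(\eta_{k+1}+N_k-\eta_k+1)}[\eta_k]_q[N_{k+1}-\eta_{k+1}]_q$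 and $c^-_k(\eta)=q^{\eta_{k-1}+N_k-\eta_k+1}[\eta_k]_q[N_{k-1}-\eta_{k-1}]_q$. $\mathrm{ASEP}_{\mathsf R}(q,\vec N,\rho)$ and $\mathrm{ASEP}_{\mathsf L}(q,\vec N,\lambda)$ are the Markov jump processes on $X$ with generators $$L^{\mathsf A}f(\xi)=\sum_{k=1}^{M-1}C^{\mathsf A,+}_k(\xi)\,[f(\xi^{k,k+1})-f(\xi)]+C^{\mathsf A,-}_{k+1}(\xi)\,[f(\xi^{k+1,k})-f(\xi)],\qquad \mathsf A\in\{\mathsf R,\mathsf L\},$$ where $\xi^{i,j}$ is $\xi$ with one particle moved from site $i$ to site $j$, and, with $h^+_k=h^+_k(\xi)$ and $h^-_k=h^-_k(\zeta)$, $$C^{\mathsf R,+}_k(\xi)=c^+_k(\xi)\frac{(1+q^{2\xi_k-2h^+_k})(1+q^{2\xi_{k+1}-2h^+_{k+1}})}{(1+q^{-2h^+_{k+1}})(1+q^{-2h^+_{k+1}-2})},\qquad C^{\mathsf R,-}_k(\xi)=c^-_k(\xi)\frac{(1+q^{-2\xi_{k-1}-2h^+_k})(1+q^{-2\xi_k-2h^+_{k+1}})}{(1+q^{-2h^+_k})(1+q^{-2h^+_k+2})},$$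 $$C^{\mathsf L,+}_k(\zeta)=c^+_k(\zeta)\frac{(1+q^{2(h^-_{k-1}+\zeta_k)})(1+q^{2(h^-_k+\zeta_{k+1})})}{(1+q^{2h^-_k})(1+q^{2(h^-_k-1)})},\qquad C^{\mathsf L,-}_k(\zeta)=c^-_k(\zeta)\frac{(1+q^{2(h^-_{k-1}-\zeta_{k-1})})(1+q^{2(h^-_k-\zeta_k)})}{(1+q^{2h^-_{k-1}})(1+q^{2(h^-_{k-1}+1)})}.$$ **Krawtchouk functions.** Let $K_n(x;c,N;q)={}_3\varphi_2(q^{-n},q^{-x},-cq^{x-N};q^{-N},0;q,q)$ and $k(n,x;\rho;N;q)=(-1)^nq^{-n\rho}q^{\frac12n(N-1)}K_n(x;q^{2\rho},N;q^2)$. For $\eta,\zeta,\xi\in X$ let $u(\eta)=\sum_{k=1}^M\big(\eta_kN_k-2\eta_k\sum_{j=1}^kN_j\big)$, $$K_{\mathsf R}(\eta,\xi)=q^{-\frac12u(\eta)}\prod_{k=1}^Mk(\eta_k,\xi_k;h^+_{k+1}(\xi);N_k;q),\qquad K_{\mathsf L}(\eta,\zeta)=q^{-\frac12u(\eta)}\prod_{k=1}^Mk(\eta_k,\zeta_k;h^-_{k-1}(\zeta);N_k;q^{-1}),$$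 $w(\eta)=q^{u(\eta)}\prod_{k=1}^Mq^{\eta_k(\eta_k-N_k)}\binom{N_k}{\eta_k}_{q^2}$, and for $v\in\mathbb R\setminus\{0\}$ $$R^v(\zeta,\xi)=\sum_{\eta\in X}K_{\mathsf L}(\eta,\zeta)K_{\mathsf R}(\eta,\xi)\,w(\eta)\,(-v)^{|\eta|}.$$ **Racah functions.** Let $R_n(x;\alpha,\beta,\gamma,\delta;q)={}_4\varphi_3(q^{-n},\alpha\beta q^{n+1},q^{-x},\gamma\delta q^{x+1};\alpha q,\beta\delta q,\gamma q;q,q)$ and $$r(y,x;\lambda,\rho,v,N;q)=v^y\,\frac{(-vq^{\rho+\lambda-N+1};q^2)_x\,(-v^{-1}q^{\rho+\lambda-N+1};q^2)_y\,(vq^{2y-\rho+\lambda-N+1};q^2)_N}{q^{y(y+\rho+\lambda-N)}\,(vq^{-2x-\rho+\lambda+N+1};q^2)_{x+y}}\;R_x(y;\alpha,\beta,\gamma,\delta;q^2),$$ $$(\alpha,\beta,\gamma,\delta)=\big(-v^{-1}q^{\rho+\lambda-N-1},\;vq^{\rho-\lambda-N-1},\;q^{-2N-2},\;-q^{2\lambda}\big).$$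 **Theorem.** For every $v\in\mathbb R\setminus\{0\}$: 1. $R^v$ is a duality function between $\mathrm{ASEP}_{\mathsf L}(q,\vec N,\lambda)$ and $\mathrm{ASEP}_{\mathsf R}(q,\vec N,\rho)$: $[L^{\mathsf L}R^v(\cdot,\xi)](\zeta)=[L^{\mathsf R}R^v(\zeta,\cdot)](\xi)$ for all $\zeta,\xi\in X$. 2. For all $\zeta,\xi\in X$, $$R^v(\zeta,\xi)=\prod_{k=1}^Mr\big(\zeta_k,\xi_k;h^-_{k-1}(\zeta),h^+_{k+1}(\xi),v,N_k;q\big),$$ whenever no denominator on the right-hand side vanishes. For fixed $\zeta,\xi$ this condition holds for all $v'\neq v$ in some neighbourhood of $v$, and if it fails at $v$ itself, the identity still holds with the right-hand side replaced by its limit as $v'\to v$, $v'\ne v$. -/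

import Mathlib

open Filter Topology

noncomputable section

namespace DynASEP

/-! ### Markov duality -/

/-- Duality of two Markov generators `L`, `L'` (acting on all real functions on the finite state
spaces `X`, `Y`) with respect to `D : X → Y → ℝ`: `[L D(·, y)](x) = [L' D(x, ·)](y)`. -/
def IsDualityFunction {X Y : Type*} (L : (X → ℝ) → X → ℝ) (L' : (Y → ℝ) → Y → ℝ)
    (D : X → Y → ℝ) : Prop :=
  ∀ x y, L (fun x' => D x' y) x = L' (fun y' => D x y') y

/-! ### `q`-notation -/

/-- `[a]_q`. -/
def qNum (q a : ℝ) : ℝ := if q = 1 then a else (q ^ a - q ^ (-a)) / (q - q⁻¹)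

/-- The `q`-shifted factorial `(a;q)_n`. -/
def qPoch (a q : ℝ) (n : ℕ) : ℝ := ∏ j ∈ Finset.range n, (1 - a * q ^ j)

/-- The `q`-binomial coefficient, used for `k ≤ n`. -/
def qBinom (q : ℝ) (n k : ℕ) : ℝ := qPoch q q n / (qPoch q q k * qPoch q q (n - k))

/-- The `q`-hypergeometric series with upper parameters `as`, lower parameters `bs`, base `q` and
argument `z` (for one more upper than lower parameter). If an upper parameter is `q ^ (-n)` with
`n : ℕ`, all terms beyond the `n`-th are zero, also those whose denominator vanishes. -/
def qHyp (as bs : List ℝ) (q z : ℝ) : ℝ :=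
  ∑' n : ℕ, (as.map fun a => qPoch a q n).prod / (bs.map fun b => qPoch b q n).prod
    * (z ^ n / qPoch q q n)

/-- The (dual) `q`-Krawtchouk polynomial `K_n(x;c,N;q)`. -/
def qKrawtchouk (n x : ℕ) (c : ℝ) (N : ℕ) (q : ℝ) : ℝ :=
  qHyp [q ^ (-(n : ℝ)), q ^ (-(x : ℝ)), -c * q ^ ((x : ℝ) - N)] [q ^ (-(N : ℝ)), 0] q q

/-- The `q`-Racah polynomial `R_n(x;α,β,γ,δ;q)`. -/
def qRacah (n x : ℕ) (α β γ δ q : ℝ) : ℝ :=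
  qHyp [q ^ (-(n : ℝ)), α * β * q ^ ((n : ℝ) + 1), q ^ (-(x : ℝ)), γ * δ * q ^ ((x : ℝ) + 1)]
    [α * q, β * δ * q, γ * q] q q

/-! ### State space and height functions

There are `M = m + 1` sites. The site `k ∈ {1, …, M}` is the element `i : Fin (m + 1)` with
`k = i + 1`. The bond `b : Fin m` joins the neighbouring sites `b.castSucc` and `b.succ`. -/

/-- The state space `{0,…,N_1} × ⋯ × {0,…,N_M}`. -/
abbrev Config {m : ℕ} (N : Fin (m + 1) → ℕ) : Type := (i : Fin (m + 1)) → Fin (N i + 1)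

/-- The total number of particles `|η|`. -/
def total {m : ℕ} {N : Fin (m + 1) → ℕ} (η : Config N) : ℕ := ∑ i, (η i : ℕ)

/-- The state `η^{i,j}` after one particle has moved from site `i` to site `j ≠ i`. If this move is
impossible (no particle at `i`, or `j` full), the state is left unchanged; the rates below vanish
in that case. -/
def jump {m : ℕ} {N : Fin (m + 1) → ℕ} (η : Config N) (i j : Fin (m + 1)) : Config N :=
  if h : 0 < (η i : ℕ) ∧ (η j : ℕ) < N j then
    Function.update
      (Function.update η i ⟨(η i : ℕ) - 1, lt_of_le_of_lt (Nat.sub_le _ _) (η i).isLt⟩)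
      j ⟨(η j : ℕ) + 1, Nat.succ_lt_succ h.2⟩
  else η

/-- `h⁺_k(ξ) = ρ + ∑_{j=k}^M (2 ξ_j - N_j)`, for `k = 1, …, M + 1`. -/
def hPlus {m : ℕ} {N : Fin (m + 1) → ℕ} (ρ : ℝ) (ξ : Config N) (k : ℕ) : ℝ :=
  ρ + ∑ j : Fin (m + 1), if k ≤ (j : ℕ) + 1 then 2 * ((ξ j : ℕ) : ℝ) - N j else 0

/-- `h⁻_k(ζ) = lam + ∑_{j=1}^k (2 ζ_j - N_j)`, for `k = 0, …, M`. -/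
def hMinus {m : ℕ} {N : Fin (m + 1) → ℕ} (lam : ℝ) (ζ : Config N) (k : ℕ) : ℝ :=
  lam + ∑ j : Fin (m + 1), if (j : ℕ) + 1 ≤ k then 2 * ((ζ j : ℕ) : ℝ) - N j else 0

/-! ### Jump rates and generators -/

/-- ASEP rate `c⁺` for a jump from site `i` to its right neighbour `j`. -/
def cPlus {m : ℕ} {N : Fin (m + 1) → ℕ} (q : ℝ) (η : Config N) (i j : Fin (m + 1)) : ℝ :=
  q ^ (-(((η j : ℕ) : ℝ) + N i - ((η i : ℕ) : ℝ) + 1))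
    * qNum q ((η i : ℕ) : ℝ) * qNum q (N j - ((η j : ℕ) : ℝ))

/-- ASEP rate `c⁻` for a jump from site `i` to its left neighbour `j`. -/
def cMinus {m : ℕ} {N : Fin (m + 1) → ℕ} (q : ℝ) (η : Config N) (i j : Fin (m + 1)) : ℝ :=
  q ^ (((η j : ℕ) : ℝ) + N i - ((η i : ℕ) : ℝ) + 1)
    * qNum q ((η i : ℕ) : ℝ) * qNum q (N j - ((η j : ℕ) : ℝ))

/-- Rate `C^{R,+}_k` of ASEP_R for a jump from site `i` (with `k = i + 1`) to its right
neighbour `j`. -/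
def CRPlus {m : ℕ} {N : Fin (m + 1) → ℕ} (q ρ : ℝ) (ξ : Config N) (i j : Fin (m + 1)) : ℝ :=
  let k : ℕ := i + 1
  cPlus q ξ i j *
    (((1 + q ^ (2 * ((ξ i : ℕ) : ℝ) - 2 * hPlus ρ ξ k))
        * (1 + q ^ (2 * ((ξ j : ℕ) : ℝ) - 2 * hPlus ρ ξ (k + 1))))
      / ((1 + q ^ (-2 * hPlus ρ ξ (k + 1))) * (1 + q ^ (-2 * hPlus ρ ξ (k + 1) - 2))))

/-- Rate `C^{R,-}_k` of ASEP_R for a jump from site `i` (with `k = i + 1`) to its left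
neighbour `j`. -/
def CRMinus {m : ℕ} {N : Fin (m + 1) → ℕ} (q ρ : ℝ) (ξ : Config N) (i j : Fin (m + 1)) : ℝ :=
  let k : ℕ := i + 1
  cMinus q ξ i j *
    (((1 + q ^ (-2 * ((ξ j : ℕ) : ℝ) - 2 * hPlus ρ ξ k))
        * (1 + q ^ (-2 * ((ξ i : ℕ) : ℝ) - 2 * hPlus ρ ξ (k + 1))))
      / ((1 + q ^ (-2 * hPlus ρ ξ k)) * (1 + q ^ (-2 * hPlus ρ ξ k + 2))))

/-- Rate `C^{L,+}_k` of ASEP_L for a jump from site `i` (with `k = i + 1`) to its right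
neighbour `j`. -/
def CLPlus {m : ℕ} {N : Fin (m + 1) → ℕ} (q lam : ℝ) (ζ : Config N) (i j : Fin (m + 1)) : ℝ :=
  let k : ℕ := i + 1
  cPlus q ζ i j *
    (((1 + q ^ (2 * (hMinus lam ζ (k - 1) + ((ζ i : ℕ) : ℝ))))
        * (1 + q ^ (2 * (hMinus lam ζ k + ((ζ j : ℕ) : ℝ)))))
      / ((1 + q ^ (2 * hMinus lam ζ k)) * (1 + q ^ (2 * (hMinus lam ζ k - 1)))))

/-- Rate `C^{L,-}_k` of ASEP_L for a jump from site `i` (with `k = i + 1`) to its left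
neighbour `j`. -/
def CLMinus {m : ℕ} {N : Fin (m + 1) → ℕ} (q lam : ℝ) (ζ : Config N) (i j : Fin (m + 1)) : ℝ :=
  let k : ℕ := i + 1
  cMinus q ζ i j *
    (((1 + q ^ (2 * (hMinus lam ζ (k - 1) - ((ζ j : ℕ) : ℝ))))
        * (1 + q ^ (2 * (hMinus lam ζ k - ((ζ i : ℕ) : ℝ)))))
      / ((1 + q ^ (2 * hMinus lam ζ (k - 1))) * (1 + q ^ (2 * (hMinus lam ζ (k - 1) + 1)))))

/-- The generator of ASEP_R(q, N, ρ). -/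
def genR {m : ℕ} (q : ℝ) (N : Fin (m + 1) → ℕ) (ρ : ℝ) (f : Config N → ℝ) (ξ : Config N) : ℝ :=
  ∑ b : Fin m,
    (CRPlus q ρ ξ b.castSucc b.succ * (f (jump ξ b.castSucc b.succ) - f ξ)
      + CRMinus q ρ ξ b.succ b.castSucc * (f (jump ξ b.succ b.castSucc) - f ξ))

/-- The generator of ASEP_L(q, N, lam). -/
def genL {m : ℕ} (q : ℝ) (N : Fin (m + 1) → ℕ) (lam : ℝ) (f : Config N → ℝ) (ζ : Config N) : ℝ :=
  ∑ b : Fin m,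
    (CLPlus q lam ζ b.castSucc b.succ * (f (jump ζ b.castSucc b.succ) - f ζ)
      + CLMinus q lam ζ b.succ b.castSucc * (f (jump ζ b.succ b.castSucc) - f ζ))

/-! ### Krawtchouk duality functions with ASEP -/

/-- `k(n,x;ρ,N;q) = (-1)^n q^{-nρ} q^{n(N-1)/2} K_n(x;q^{2ρ},N;q²)`. -/
def kSite (n x : ℕ) (ρ : ℝ) (N : ℕ) (q : ℝ) : ℝ :=
  (-1) ^ n * q ^ (-((n : ℝ) * ρ)) * q ^ ((n : ℝ) * ((N : ℝ) - 1) / 2)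
    * qKrawtchouk n x (q ^ (2 * ρ)) N (q ^ 2)

/-- `u(η) = ∑_k (η_k N_k - 2 η_k ∑_{j ≤ k} N_j)`. -/
def uExp {m : ℕ} {N : Fin (m + 1) → ℕ} (η : Config N) : ℝ :=
  ∑ i : Fin (m + 1), (((η i : ℕ) : ℝ) * N i
    - 2 * ((η i : ℕ) : ℝ) * ∑ j : Fin (m + 1), if j ≤ i then (N j : ℝ) else 0)

/-- `K_R(η,ξ)`; the `k`-th factor has parameter `h⁺_{k+1}(ξ)`, `k = i + 1`. -/
def KR {m : ℕ} {N : Fin (m + 1) → ℕ} (q ρ : ℝ) (η ξ : Config N) : ℝ :=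
  q ^ (-(1 / 2) * uExp η)
    * ∏ i : Fin (m + 1), kSite (η i) (ξ i) (hPlus ρ ξ ((i : ℕ) + 2)) (N i) q

/-- `K_L(η,ζ)`; the `k`-th factor has parameter `h⁻_{k-1}(ζ)`, `k = i + 1`, and base `q⁻¹`. -/
def KL {m : ℕ} {N : Fin (m + 1) → ℕ} (q lam : ℝ) (η ζ : Config N) : ℝ :=
  q ^ (-(1 / 2) * uExp η)
    * ∏ i : Fin (m + 1), kSite (η i) (ζ i) (hMinus lam ζ (i : ℕ)) (N i) q⁻¹

/-- The one-site weight `w(n;N;q) = q^{n(n-N)} [N choose n]_{q²}`. -/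
def wSite (n N : ℕ) (q : ℝ) : ℝ := q ^ ((n : ℝ) * ((n : ℝ) - N)) * qBinom (q ^ 2) N n

/-- The weight `w(η) = q^{u(η)} ∏_k w(η_k;N_k;q)` on the state space. -/
def wConfig {m : ℕ} {N : Fin (m + 1) → ℕ} (q : ℝ) (η : Config N) : ℝ :=
  q ^ uExp η * ∏ i : Fin (m + 1), wSite (η i) (N i) q

/-- `R^v(ζ,ξ) = ∑_η K_L(η,ζ) K_R(η,ξ) w(η) (-v)^{|η|}`. -/
def Rv {m : ℕ} {N : Fin (m + 1) → ℕ} (q lam ρ v : ℝ) (ζ ξ : Config N) : ℝ :=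
  ∑ η : Config N, KL q lam η ζ * KR q ρ η ξ * wConfig q η * (-v) ^ total η

/-! ### One-site `q`-Racah duality functions -/

/-- The coefficient `c_r(y,x;lam,ρ,v,N;q)`. -/
def cr (y x : ℕ) (lam ρ v : ℝ) (N : ℕ) (q : ℝ) : ℝ :=
  v ^ y *
    ((qPoch (-v * q ^ (ρ + lam - N + 1)) (q ^ 2) x
        * qPoch (-v⁻¹ * q ^ (ρ + lam - N + 1)) (q ^ 2) y
        * qPoch (v * q ^ (2 * (y : ℝ) - ρ + lam - N + 1)) (q ^ 2) N)
      / (q ^ ((y : ℝ) * ((y : ℝ) + ρ + lam - N))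
        * qPoch (v * q ^ (-2 * (x : ℝ) - ρ + lam + N + 1)) (q ^ 2) (x + y)))

/-- The one-site duality function
`r(y,x;lam,ρ,v,N;q) = c_r(y,x;lam,ρ,v,N;q) R_x(y;α,β,γ,δ;q²)` with
`(α,β,γ,δ) = (-v⁻¹ q^{ρ+lam-N-1}, v q^{ρ-lam-N-1}, q^{-2N-2}, -q^{2 lam})`. -/
def rSite (y x : ℕ) (lam ρ v : ℝ) (N : ℕ) (q : ℝ) : ℝ :=
  cr y x lam ρ v N q *
    qRacah x y (-v⁻¹ * q ^ (ρ + lam - N - 1)) (v * q ^ (ρ - lam - N - 1))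
      (q ^ (-2 * (N : ℝ) - 2)) (-q ^ (2 * lam)) (q ^ 2)

/-- No denominator in the definition of `r(y,x;lam,ρ,v,N;q)` vanishes: neither the one in `c_r`, nor
one in the `min x y + 1` terms of the terminating `₄φ₃`. (The third lower parameter `q^{-2N}` and
the base never give a zero denominator there if `x, y ≤ N`.) -/
def RegularSite (y x : ℕ) (lam ρ v : ℝ) (N : ℕ) (q : ℝ) : Prop :=
  qPoch (v * q ^ (-2 * (x : ℝ) - ρ + lam + N + 1)) (q ^ 2) (x + y) ≠ 0 ∧
  qPoch (-v⁻¹ * q ^ (ρ + lam - N + 1)) (q ^ 2) (min x y) ≠ 0 ∧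
  qPoch (-v * q ^ (ρ + lam - N + 1)) (q ^ 2) (min x y) ≠ 0

/-- The doubly nested product `∏_k r(ζ_k,ξ_k;h⁻_{k-1}(ζ),h⁺_{k+1}(ξ),v,N_k;q)`, `k = i + 1`. -/
def racahProduct {m : ℕ} {N : Fin (m + 1) → ℕ} (q lam ρ v : ℝ) (ζ ξ : Config N) : ℝ :=
  ∏ i : Fin (m + 1),
    rSite (ζ i) (ξ i) (hMinus lam ζ (i : ℕ)) (hPlus ρ ξ ((i : ℕ) + 2)) v (N i) q

/-- All factors of the doubly nested product are free of zero denominators. -/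
def Regular {m : ℕ} {N : Fin (m + 1) → ℕ} (q lam ρ v : ℝ) (ζ ξ : Config N) : Prop :=
  ∀ i : Fin (m + 1),
    RegularSite (ζ i) (ξ i) (hMinus lam ζ (i : ℕ)) (hPlus ρ ξ ((i : ℕ) + 2)) v (N i) q

end DynASEP

end

open DynASEP

noncomputable section

namespace DynASEP

/-! ### `q`-shifted factorials -/

/-! The argument rests on one generating function. Summed against the one-site weight, the functions
k(n, x; ρ) give a product of two q-shifted factorials of lengths x and N - x (`sum_wSite_kSite`).
Multiplication by q^(2n) dilates the variable of this product, and the quotient of consecutive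
weights turns shifts of n into dilations as well. Changing x by one, with or without a change of ρ
by 2, multiplies the product by a rational function. Operators in n can thus be matched with
operators in x by checking a rational identity and comparing coefficients.

Duality. On one bond this comparison shows that the ASEP generator acting on η in K_R equals the
ASEP_R generator acting on ξ (`two_site_rational`, `two_site_duality`, `KR_duality`). K_L follows by
inverting q and reversing the order of the sites (`KL_duality`). The weight w(η)(-v)^|η| satisfies
detailed balance, so each bond generator is symmetric for the corresponding bilinear form
(`aspBond_symm`). Since R^v is this form evaluated at K_L and K_R, the generator passes from ζ to η,
across the form, and from η to ξ.

Product formula. The powers of q^u cancel and R^v factors into one-site sums (`Rv_eq_prod_siteSum`).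
The q-difference equation of the base-q⁻¹ generating function remains true when t^n is replaced by
arbitrary numbers (`kSite_functional`). With numbers taken from k(n, x; ρ), y enters only through a
scalar, and the remaining operator in n is tridiagonal in x (`kSite_tridiagonal`). So the one-site
sum obeys a three-term recurrence in x. The q-Racah polynomial times the x-dependent part of its
prefactor obeys the same one (`crRatio_racahSum_recurrence`), and at x = 0 the sum is again a
generating function. This identifies the two for generic v. Since R^v is polynomial in v, all
remaining cases follow by a limit. -/

@[simp] lemma qPoch_zero (a p : ℝ) : qPoch a p 0 = 1 := by simp [qPoch]

lemma qPoch_succ (a p : ℝ) (n : ℕ) : qPoch a p (n + 1) = qPoch a p n * (1 - a * p ^ n) := by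
  simp [qPoch, Finset.prod_range_succ]

lemma qPoch_succ_left (a p : ℝ) (n : ℕ) : qPoch a p (n + 1) = (1 - a) * qPoch (a * p) p n := by
  simp only [qPoch, Finset.prod_range_succ', pow_zero, mul_one]
  rw [mul_comm]
  congr 1
  exact Finset.prod_congr rfl fun j _ => by ring

lemma pow_eq_one_imp {p : ℝ} (hp : 0 < p) (hp1 : p ≠ 1) {n : ℕ} (h : p ^ n = 1) : n = 0 := by
  by_contra hn
  exact hp1 ((pow_eq_one_iff_of_nonneg hp.le hn).1 h)

lemma one_sub_pow_ne_zero {p : ℝ} (hp : 0 < p) (hp1 : p ≠ 1) (n : ℕ) : 1 - p ^ (n + 1) ≠ 0 :=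
  fun h => by simpa using pow_eq_one_imp hp hp1 (n := n + 1) (by linarith)

lemma qPoch_self_ne_zero {p : ℝ} (hp : 0 < p) (hp1 : p ≠ 1) (n : ℕ) : qPoch p p n ≠ 0 := by
  rw [qPoch, Finset.prod_ne_zero_iff]
  intro j _
  rw [← pow_succ']
  exact one_sub_pow_ne_zero hp hp1 j

lemma qPoch_inv_pow_eq_zero {p : ℝ} (hp : 0 < p) {n j : ℕ} (h : n < j) :
    qPoch (p ^ n)⁻¹ p j = 0 := by
  rw [qPoch, Finset.prod_eq_zero_iff]
  exact ⟨n, by simpa using h, by rw [inv_mul_cancel₀ (by positivity), sub_self]⟩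

lemma qPoch_inv_pow_ne_zero {p : ℝ} (hp : 0 < p) (hp1 : p ≠ 1) {n j : ℕ} (h : j ≤ n) :
    qPoch (p ^ n)⁻¹ p j ≠ 0 := by
  rw [qPoch, Finset.prod_ne_zero_iff]
  intro i hi h0
  rw [Finset.mem_range] at hi
  obtain ⟨k, rfl⟩ : ∃ k, n = i + (k + 1) := ⟨n - i - 1, by omega⟩
  have h1 : p ^ (i + (k + 1)) = p ^ i := by
    have := pow_pos hp (i + (k + 1))
    field_simp at h0
    linarith
  rw [pow_add] at h1
  have h2 : p ^ i * (1 - p ^ (k + 1)) = 0 := by linarith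
  rcases mul_eq_zero.1 h2 with h3 | h3
  · exact (pow_pos hp i).ne' h3
  · exact one_sub_pow_ne_zero hp hp1 k h3

/-- Shifting the argument of a `q`-shifted factorial by one power of the base. -/
lemma qPoch_mul_base (a p : ℝ) (n : ℕ) :
    (1 - a) * qPoch (a * p) p n = qPoch a p n * (1 - a * p ^ n) := by
  rw [← qPoch_succ_left, qPoch_succ]

/-! ### The `q`-binomial theorem -/

/-- Gaussian binomial coefficients, by Pascal's rule. -/
def gaussBinom (p : ℝ) : ℕ → ℕ → ℝ
  | _, 0 => 1
  | 0, _ + 1 => 0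
  | n + 1, k + 1 => gaussBinom p n k + p ^ (k + 1) * gaussBinom p n (k + 1)

@[simp] lemma gaussBinom_zero_right (p : ℝ) (n : ℕ) : gaussBinom p n 0 = 1 := by
  cases n <;> rfl

lemma gaussBinom_succ_succ (p : ℝ) (n k : ℕ) : gaussBinom p (n + 1) (k + 1) =
    gaussBinom p n k + p ^ (k + 1) * gaussBinom p n (k + 1) := rfl

lemma gaussBinom_eq_zero (p : ℝ) : ∀ {n k : ℕ}, n < k → gaussBinom p n k = 0
  | 0, k + 1, _ => rfl
  | n + 1, k + 1, h => by
    rw [gaussBinom_succ_succ, gaussBinom_eq_zero p (by omega), gaussBinom_eq_zero p (by omega)]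
    simp

/-- Pascal's rule matches the factorial quotient because 1 - p^(k+m+2) = (1 - p^(k+1)) + p^(k+1) (1
- p^(m+1)). Written without division, this needs no condition on p. -/
lemma gaussBinom_mul (p : ℝ) : ∀ k m : ℕ,
    gaussBinom p (k + m) k * (qPoch p p k * qPoch p p m) = qPoch p p (k + m)
  | 0, m => by simp
  | k + 1, 0 => by
    have h := gaussBinom_mul p k 0
    simp only [add_zero, qPoch_zero, mul_one] at h ⊢
    rw [gaussBinom_succ_succ, gaussBinom_eq_zero p (Nat.lt_succ_self k), qPoch_succ]
    linear_combination (1 - p * p ^ k) * h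
  | k + 1, m + 1 => by
    have h1 := gaussBinom_mul p k (m + 1)
    have h2 := gaussBinom_mul p (k + 1) m
    rw [show k + 1 + (m + 1) = (k + m + 1) + 1 by ring, gaussBinom_succ_succ]
    rw [show k + (m + 1) = k + m + 1 by ring] at h1
    rw [show k + 1 + m = k + m + 1 by ring] at h2
    rw [qPoch_succ p p k, qPoch_succ p p m, qPoch_succ p p (k + m + 1)] at *
    linear_combination (1 - p * p ^ k) * h1 + p ^ (k + 1) * (1 - p * p ^ m) * h2

lemma qBinom_eq_gaussBinom {p : ℝ} (hp : 0 < p) (hp1 : p ≠ 1) {n k : ℕ} (h : k ≤ n) :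
    qBinom p n k = gaussBinom p n k := by
  obtain ⟨m, rfl⟩ := Nat.exists_eq_add_of_le h
  have h1 := qPoch_self_ne_zero hp hp1 k
  have h2 := qPoch_self_ne_zero hp hp1 m
  rw [qBinom, Nat.add_sub_cancel_left, ← gaussBinom_mul]
  field_simp

/-- Pascal's rule does to the coefficients what (T;p)_(n+1) = (1 - T) (Tp;p)_n does to the product.
-/
lemma sum_gaussBinom (p : ℝ) (n : ℕ) (T : ℝ) :
    ∑ k ∈ Finset.range (n + 1), (-1) ^ k * p ^ k.choose 2 * gaussBinom p n k * T ^ k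
      = qPoch T p n := by
  induction n generalizing T with
  | zero => simp
  | succ n ih =>
    have key : ∀ k, (-1) ^ (k + 1) * p ^ (k + 1).choose 2 * gaussBinom p (n + 1) (k + 1)
        * T ^ (k + 1) = (-1) ^ (k + 1) * p ^ (k + 1).choose 2 * gaussBinom p n (k + 1)
          * (T * p) ^ (k + 1)
        - T * ((-1) ^ k * p ^ k.choose 2 * gaussBinom p n k * (T * p) ^ k) := by
      intro k
      rw [gaussBinom_succ_succ, Nat.choose_succ_succ' k 1, Nat.choose_one_right]
      ring
    rw [Finset.sum_range_succ', Finset.sum_congr rfl fun k _ => key k, Finset.sum_sub_distrib,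
      ← Finset.mul_sum, ih, qPoch_succ_left]
    -- The added top term is zero, so the sum for n without its constant term is known too.
    have h2 := Finset.sum_range_succ' (fun k => (-1) ^ k * p ^ k.choose 2 * gaussBinom p n k
      * (T * p) ^ k) (n + 1)
    rw [Finset.sum_range_succ, ih, gaussBinom_eq_zero p (Nat.lt_succ_self n)] at h2
    simp only [gaussBinom_zero_right] at h2 ⊢
    simp at h2 ⊢
    linarith

lemma qBinom_succ_succ {p : ℝ} (hp : 0 < p) (hp1 : p ≠ 1) (n k : ℕ) :
    qBinom p (n + 1) (k + 1) * (1 - p ^ (k + 1)) = (1 - p ^ (n + 1)) * qBinom p n k := by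
  have h1 := qPoch_self_ne_zero hp hp1 k
  have h2 := qPoch_self_ne_zero hp hp1 (n - k)
  have h3 := one_sub_pow_ne_zero hp hp1 k
  rw [qBinom, qBinom, qPoch_succ, qPoch_succ, Nat.add_sub_add_right, ← pow_succ', ← pow_succ']
  field_simp

lemma qBinom_succ_right {p : ℝ} (hp : 0 < p) (hp1 : p ≠ 1) {n k : ℕ} (h : k < n) :
    qBinom p n (k + 1) * (1 - p ^ (k + 1)) = (1 - p ^ (n - k)) * qBinom p n k := by
  obtain ⟨m, rfl⟩ : ∃ m, n = k + (m + 1) := ⟨n - k - 1, by omega⟩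
  have h1 := qPoch_self_ne_zero hp hp1 k
  have h2 := qPoch_self_ne_zero hp hp1 m
  have h3 := one_sub_pow_ne_zero hp hp1 k
  have h4 := one_sub_pow_ne_zero hp hp1 m
  rw [qBinom, qBinom, show k + (m + 1) - (k + 1) = m by omega, Nat.add_sub_cancel_left,
    qPoch_succ p p k, qPoch_succ p p m, ← pow_succ', ← pow_succ']
  field_simp

/-- Pascal's rule has positive coefficients for every p > 0, whereas the q-factorials in the
quotient may be negative when p > 1. -/
lemma qBinom_pos {p : ℝ} (hp : 0 < p) (hp1 : p ≠ 1) {n k : ℕ} (h : k ≤ n) :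
    0 < qBinom p n k := by
  rw [qBinom_eq_gaussBinom hp hp1 h]
  clear hp1
  induction n generalizing k with
  | zero => obtain rfl : k = 0 := by omega
            simp
  | succ n ih =>
    cases k with
    | zero => simp
    | succ k =>
      rw [gaussBinom_succ_succ]
      have h1 := ih (k := k) (by omega)
      rcases Nat.lt_or_ge n (k + 1) with h2 | h2
      · rw [gaussBinom_eq_zero p h2]; linarith
      · have := ih h2
        positivity

/-! ### `q`-Krawtchouk polynomials and their generating function -/

/-- The `j`-th term of the series of `qKrawtchouk n x c N p`. -/
def krawTerm (n x : ℕ) (c : ℝ) (N : ℕ) (p : ℝ) (j : ℕ) : ℝ :=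
  qPoch (p ^ n)⁻¹ p j * qPoch (p ^ x)⁻¹ p j * qPoch (-c * p ^ x / p ^ N) p j
    / qPoch (p ^ N)⁻¹ p j * (p ^ j / qPoch p p j)

/-- The cut-off is N rather than n, so that sums with different n can be combined term by term. -/
lemma qKrawtchouk_eq_sum {p : ℝ} (hp : 0 < p) {n N : ℕ} (hn : n ≤ N) (x : ℕ) (c : ℝ) :
    qKrawtchouk n x c N p = ∑ j ∈ Finset.range (N + 1), krawTerm n x c N p j := by
  have e1 : ∀ k : ℕ, p ^ (-(k : ℝ)) = (p ^ k)⁻¹ := fun k => by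
    rw [Real.rpow_neg hp.le, Real.rpow_natCast]
  have e2 : -c * p ^ ((x : ℝ) - N) = -c * p ^ x / p ^ N := by
    rw [Real.rpow_sub hp, Real.rpow_natCast, Real.rpow_natCast]; ring
  have e3 : ∀ j, qPoch 0 p j = 1 := fun j => by simp [qPoch]
  rw [qKrawtchouk, qHyp, tsum_eq_sum (s := Finset.range (N + 1))]
  · refine Finset.sum_congr rfl fun j _ => ?_
    simp only [List.map_cons, List.map_nil, List.prod_cons, List.prod_nil, e1, e2, e3, krawTerm]
    ring
  · intro j hj
    simp only [Finset.mem_range, not_lt] at hj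
    simp only [List.map_cons, List.map_nil, List.prod_cons, List.prod_nil, e1]
    rw [qPoch_inv_pow_eq_zero hp (by omega : n < j)]
    simp

/-- The number a = -c p^(x-N) is unchanged when x and N grow together, so the two terms share
(p^(-x);p)_j (a;p)_j. What is left to subtract is divisible by 1 - p^(j+1), which cancels the last
factor of (p;p)_(j+1) and leaves a term of index j. -/
lemma krawTerm_succ {p : ℝ} (hp : 0 < p) (hp1 : p ≠ 1) (n x : ℕ) (c : ℝ) {N j : ℕ} (hj : j ≤ N) :
    krawTerm (n + 1) (x + 1) c (N + 1) p (j + 1) - krawTerm (n + 1) x c (N + 1) p (j + 1)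
      = -(c * p ^ x / p ^ N + (p ^ x)⁻¹) * ((1 - (p ^ (n + 1))⁻¹) / (1 - (p ^ (N + 1))⁻¹))
        * krawTerm n x c N p j := by
  have e : ∀ k : ℕ, (p ^ (k + 1))⁻¹ * p = (p ^ k)⁻¹ := fun k => by
    rw [pow_succ]; field_simp
  have h1 := qPoch_self_ne_zero hp hp1 j
  have h2 := qPoch_inv_pow_ne_zero hp hp1 hj
  have h3 := one_sub_pow_ne_zero hp hp1 j
  have h4 : 1 - (p ^ (N + 1))⁻¹ ≠ 0 := by
    have := one_sub_pow_ne_zero hp hp1 N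
    have := pow_pos hp (N + 1)
    intro h
    field_simp at h
    apply one_sub_pow_ne_zero hp hp1 N
    linarith
  have e2 : -c * p ^ (x + 1) / p ^ (N + 1) = -c * p ^ x / p ^ N := by
    rw [pow_succ, pow_succ]; field_simp
  have e3 : -c * p ^ x / p ^ (N + 1) * p = -c * p ^ x / p ^ N := by
    rw [pow_succ]; field_simp
  have hx := pow_pos hp x
  have hN := pow_pos hp N
  rw [krawTerm, krawTerm, krawTerm, qPoch_succ_left (p ^ (n + 1))⁻¹, qPoch_succ_left (p ^ (N + 1))⁻¹,
    qPoch_succ_left (p ^ (x + 1))⁻¹, qPoch_succ (p ^ x)⁻¹, e2, qPoch_succ (-c * p ^ x / p ^ N),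
    qPoch_succ_left (-c * p ^ x / p ^ (N + 1)), e3, e, e, e, qPoch_succ p, ← pow_succ']
  generalize qPoch (p ^ n)⁻¹ p j = A
  generalize qPoch (p ^ x)⁻¹ p j = B
  generalize qPoch (-c * p ^ x / p ^ N) p j = C
  generalize qPoch (p ^ N)⁻¹ p j = D at *
  generalize qPoch p p j = E at *
  generalize (1 - (p ^ (N + 1))⁻¹) = F at *
  generalize (1 - (p ^ (n + 1))⁻¹) = G
  generalize hJ : (1 - p ^ (j + 1)) = H at *
  have : p ^ (j + 1) = 1 - H := by linarith
  have h5 : p ^ j = (1 - H) / p := by rw [← this, pow_succ]; field_simp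
  rw [this, h5, pow_succ p x, pow_succ p N]
  field_simp
  ring

lemma sum_krawTerm_zero_left {p : ℝ} (hp : 0 < p) (x : ℕ) (c : ℝ) (N : ℕ) :
    ∑ j ∈ Finset.range (N + 1), krawTerm 0 x c N p j = 1 := by
  rw [Finset.sum_range_succ', Finset.sum_eq_zero]
  · simp [krawTerm]
  · intro j _
    rw [krawTerm, qPoch_inv_pow_eq_zero hp (Nat.succ_pos j)]
    simp

lemma sum_krawTerm_zero_right {p : ℝ} (hp : 0 < p) (n : ℕ) (c : ℝ) (N : ℕ) :
    ∑ j ∈ Finset.range (N + 1), krawTerm n 0 c N p j = 1 := by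
  rw [Finset.sum_range_succ', Finset.sum_eq_zero]
  · simp [krawTerm]
  · intro j _
    rw [krawTerm, qPoch_inv_pow_eq_zero (n := 0) hp (Nat.succ_pos j)]
    simp

lemma sum_krawTerm_succ {p : ℝ} (hp : 0 < p) (hp1 : p ≠ 1) (n x : ℕ) (c : ℝ) (N : ℕ) :
    ∑ j ∈ Finset.range (N + 1 + 1), krawTerm (n + 1) (x + 1) c (N + 1) p j
        - ∑ j ∈ Finset.range (N + 1 + 1), krawTerm (n + 1) x c (N + 1) p j
      = -(c * p ^ x / p ^ N + (p ^ x)⁻¹) * ((1 - (p ^ (n + 1))⁻¹) / (1 - (p ^ (N + 1))⁻¹))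
        * ∑ j ∈ Finset.range (N + 1), krawTerm n x c N p j := by
  rw [← Finset.sum_sub_distrib, Finset.sum_range_succ', Finset.mul_sum]
  have h0 : krawTerm (n + 1) (x + 1) c (N + 1) p 0 - krawTerm (n + 1) x c (N + 1) p 0 = 0 := by
    simp [krawTerm]
  rw [h0, add_zero]
  refine Finset.sum_congr rfl fun j hj => krawTerm_succ hp hp1 n x c ?_
  simp only [Finset.mem_range] at hj; omega

/-- Generating function of the `q`-Krawtchouk polynomials. -/
lemma sum_qBinom_krawTerm {p : ℝ} (hp : 0 < p) (hp1 : p ≠ 1) (c T : ℝ) (x : ℕ) :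
    ∀ N, x ≤ N →
    ∑ n ∈ Finset.range (N + 1), (-1) ^ n * p ^ n.choose 2 * qBinom p N n
        * (∑ j ∈ Finset.range (N + 1), krawTerm n x c N p j) * T ^ n
      = qPoch (-c * T) p x * qPoch T p (N - x) := by
  induction x with
  | zero =>
    intro N _
    simp only [sum_krawTerm_zero_right hp, mul_one, qPoch_zero, one_mul, Nat.sub_zero]
    rw [← sum_gaussBinom]
    refine Finset.sum_congr rfl fun n hn => ?_
    rw [qBinom_eq_gaussBinom hp hp1 (by simp at hn; omega)]
  | succ x ih =>
    intro N hN
    obtain ⟨N, rfl⟩ : ∃ N', N = N' + 1 := ⟨N - 1, by omega⟩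
    have h1 := ih (N + 1) (by omega)
    have h2 := ih N (by omega)
    obtain ⟨d, rfl⟩ : ∃ d, N = x + d := ⟨N - x, by omega⟩
    rw [show x + d + 1 - x = d + 1 by omega] at h1
    rw [Nat.add_sub_cancel_left] at h2
    rw [show x + d + 1 - (x + 1) = d by omega]
    -- With G(x, N) for the generating function, this gives G(x+1, N+1) = G(x, N+1) + T (c p^x +
    -- p^d) G(x, N) for N = x + d. The products satisfy it because 1 + c T p^x = (1 - T p^d) + T (c
    -- p^x + p^d).
    have key : ∀ n ∈ Finset.range (x + d + 1),
        (-1) ^ (n + 1) * p ^ (n + 1).choose 2 * qBinom p (x + d + 1) (n + 1)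
          * (∑ j ∈ Finset.range (x + d + 1 + 1), krawTerm (n + 1) (x + 1) c (x + d + 1) p j)
          * T ^ (n + 1)
        = (-1) ^ (n + 1) * p ^ (n + 1).choose 2 * qBinom p (x + d + 1) (n + 1)
          * (∑ j ∈ Finset.range (x + d + 1 + 1), krawTerm (n + 1) x c (x + d + 1) p j)
          * T ^ (n + 1) + T * (c * p ^ x + p ^ d) * ((-1) ^ n * p ^ n.choose 2 * qBinom p (x + d) n
          * (∑ j ∈ Finset.range (x + d + 1), krawTerm n x c (x + d) p j) * T ^ n) := by
      intro n hn
      rw [Finset.mem_range] at hn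
      obtain ⟨e, he⟩ : ∃ e, x + d = n + e := ⟨x + d - n, by omega⟩
      have h3 := sum_krawTerm_succ hp hp1 n x c (x + d)
      have h4 := qBinom_succ_succ hp hp1 (x + d) n
      have h5 := one_sub_pow_ne_zero hp hp1 n
      have h6 := one_sub_pow_ne_zero hp hp1 (x + d)
      have h7 : (1 - (p ^ (n + 1))⁻¹) / (1 - (p ^ (x + d + 1))⁻¹)
          = p ^ e * (1 - p ^ (n + 1)) / (1 - p ^ (x + d + 1)) := by
        have h8 : 1 - (p ^ (x + d + 1))⁻¹ ≠ 0 := by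
          intro h
          apply h6
          have := pow_pos hp (x + d + 1)
          field_simp at h
          linarith
        rw [div_eq_div_iff h8 h6]
        have : p ^ (x + d + 1) = p ^ e * p ^ (n + 1) := by rw [he]; ring
        rw [this]
        field_simp
        ring
      rw [h7] at h3
      have h9 : qBinom p (x + d + 1) (n + 1)
          = (1 - p ^ (x + d + 1)) * qBinom p (x + d) n / (1 - p ^ (n + 1)) := by
        rw [eq_div_iff h5, h4]
      rw [sub_eq_iff_eq_add] at h3
      rw [h3, mul_add, add_mul, add_comm]
      congr 1
      rw [h9, Nat.choose_succ_succ' n 1, Nat.choose_one_right]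
      have h10 : c * p ^ x / p ^ (x + d) + (p ^ x)⁻¹ = (c * p ^ x + p ^ d) / (p ^ n * p ^ e) := by
        rw [← pow_add, ← he, pow_add]
        field_simp
      rw [h10]
      have := pow_pos hp n
      have := pow_pos hp e
      generalize p ^ d = D
      generalize p ^ x = X
      field_simp
      rw [pow_add]
      ring
    rw [Finset.sum_range_succ'] at h1 ⊢
    rw [Finset.sum_congr rfl key, Finset.sum_add_distrib, ← Finset.mul_sum, h2]
    rw [sum_krawTerm_zero_left hp] at h1 ⊢
    rw [qPoch_succ] at h1
    rw [qPoch_succ]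
    linear_combination h1

/-- Inverting the base multiplies (q²;q²)_n by (-1)^n q^(-n(n+1)), and the power left over in the
binomial is absorbed by q^(n(n-N)). Hence the base-q⁻¹ functions in K_L share the weight of K_R. -/
lemma wSite_inv {q : ℝ} (hq : 0 < q) {n N : ℕ} (h : n ≤ N) : wSite n N q⁻¹ = wSite n N q := by
  have key : ∀ n : ℕ, qPoch (q⁻¹ ^ 2) (q⁻¹ ^ 2) n = (-1) ^ n * (q ^ (n * (n + 1)))⁻¹ * qPoch (q ^ 2) (q ^ 2) n := by
    intro n
    induction n with
    | zero => simp
    | succ n ih =>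
      have e : q ^ ((n + 1) * (n + 1 + 1)) = q ^ (n * (n + 1)) * (q ^ 2) ^ n * q ^ 2 := by ring
      rw [qPoch_succ, ih, qPoch_succ, e, pow_succ (-1 : ℝ), inv_pow, inv_pow]
      have := pow_pos hq (n * (n + 1))
      have := pow_pos (pow_pos hq 2) n
      field_simp
      ring
  obtain ⟨m, rfl⟩ := Nat.exists_eq_add_of_le h
  rw [wSite, wSite, qBinom, qBinom, Nat.add_sub_cancel_left, key, key, key]
  have e : ((n : ℝ) * ((n : ℝ) - ((n + m : ℕ) : ℝ))) = -((n * m : ℕ) : ℝ) := by push_cast; ring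
  rw [e, Real.rpow_neg hq.le, Real.rpow_neg (inv_pos.2 hq).le, Real.rpow_natCast,
    Real.rpow_natCast, show (n + m) * (n + m + 1) = n * (n + 1) + m * (m + 1) + n * m + n * m by ring]
  simp only [pow_add]
  have := pow_pos hq (n * m)
  have := pow_pos hq (n * (n + 1))
  have := pow_pos hq (m * (m + 1))
  have h1 : ((-1 : ℝ) ^ n) ≠ 0 := by simp
  have h2 : ((-1 : ℝ) ^ m) ≠ 0 := by simp
  simp only [inv_pow]
  by_cases h3 : qPoch (q ^ 2) (q ^ 2) n = 0
  · simp [h3]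
  by_cases h4 : qPoch (q ^ 2) (q ^ 2) m = 0
  · simp [h4]
  field_simp

lemma wSite_pos {q : ℝ} (hq : 0 < q) (hq1 : q ≠ 1) {n N : ℕ} (h : n ≤ N) : 0 < wSite n N q := by
  have : q ^ 2 ≠ 1 := by
    intro h; exact hq1 ((pow_eq_one_iff_of_nonneg hq.le two_ne_zero).1 h)
  have := qBinom_pos (p := q ^ 2) (by positivity) this h
  rw [wSite]
  positivity

/-- Generating function of the one-site functions `k(n,x;ρ,N;q)`. -/
lemma sum_wSite_kSite {q : ℝ} (hq : 0 < q) (hq1 : q ≠ 1) {x N : ℕ} (hx : x ≤ N) (ρ t : ℝ) :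
    ∑ n ∈ Finset.range (N + 1), wSite n N q * kSite n x ρ N q * t ^ n
      = qPoch (-(q ^ (ρ + (1 - N) / 2) * t)) (q ^ 2) x
        * qPoch (q ^ (-ρ + (1 - N) / 2) * t) (q ^ 2) (N - x) := by
  have hp1 : q ^ 2 ≠ 1 := by
    intro h; exact hq1 ((pow_eq_one_iff_of_nonneg hq.le two_ne_zero).1 h)
  have h := sum_qBinom_krawTerm (p := q ^ 2) (by positivity) hp1 (q ^ (2 * ρ))
    (q ^ (-ρ + (1 - N) / 2) * t) x N hx
  have e : -q ^ (2 * ρ) * (q ^ (-ρ + (1 - N) / 2) * t) = -(q ^ (ρ + (1 - (N : ℝ)) / 2) * t) := by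
    rw [neg_mul, ← mul_assoc, ← Real.rpow_add hq]
    congr 3; ring
  rw [← e, ← h]
  refine Finset.sum_congr rfl fun n hn => ?_
  rw [wSite, kSite, qKrawtchouk_eq_sum (by positivity) (by simp at hn; omega)]
  have e2 : ((q ^ 2) ^ n.choose 2 : ℝ) = q ^ ((n : ℝ) * (n - 1)) := by
    rw [← pow_mul, ← Real.rpow_natCast]
    congr 1
    push_cast
    rw [Nat.cast_choose_two]; ring
  -- The normalisation of k and the power in the weight combine to the exponent n(n-1) of the
  -- q-binomial theorem and a pure n-th power, which rescales t.
  have e3 : q ^ ((n : ℝ) * ((n : ℝ) - N)) * (q ^ (-((n : ℝ) * ρ)) * q ^ ((n : ℝ) * ((N : ℝ) - 1) / 2))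
      = (q ^ 2) ^ n.choose 2 * (q ^ (-ρ + (1 - (N : ℝ)) / 2)) ^ n := by
    rw [e2, ← Real.rpow_add hq, ← Real.rpow_add hq, ← Real.rpow_mul_natCast hq.le, ← Real.rpow_add hq]
    congr 1; ring
  rw [mul_pow]
  linear_combination ((-1) ^ n * qBinom (q ^ 2) N n
    * (∑ j ∈ Finset.range (N + 1), krawTerm n x (q ^ (2 * ρ)) N (q ^ 2) j) * t ^ n) * e3

/-! ### The rational identity behind the two-site duality -/

/-- What remains of `two_site_rational` after the common denominator and the common factor T - s are
removed. -/
lemma two_site_core (q M1 M2 a1 a2 R s T : ℝ) (hq : 0 < q) (hM1 : 0 < M1) (hM2 : 0 < M2) (h1 : 0 < a1)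
    (h2 : 0 < a2) (hR : 0 < R) :
  -(q * M2) * ((M1 - M1⁻¹) + s * (R * (M1 - a1 / M1) - (M1 - M1 / a1) / R))
      * (R / q ^ 2 * (1 - a2⁻¹) - (1 - a2 / M2 ^ 2) / (R * q ^ 2) - T / q ^ 4 * (1 - (M2 ^ 2)⁻¹))
    + (q * M1)⁻¹ * ((R * (a1 - 1) - (M1 ^ 2 / a1 - 1) / R) + s * (1 - M1 ^ 2))
      * ((M2 - M2⁻¹) + T * (R / q ^ 2 * (M2 / a2 - M2⁻¹) - (a2 / M2 - M2⁻¹) / (R * q ^ 2)))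
  = (q * M1)⁻¹ * (a1 - 1) * (M2 / a2 - M2⁻¹) * ((1 + M1 ^ 2 / (R ^ 2 * a1)) * (1 + a2 / R ^ 2))
      * (R / (1 + (R ^ 2)⁻¹)) * ((1 - s / R) * (1 + R * T / q ^ 2))
    - q * M2 * (1 - a2⁻¹) * (M1 - M1⁻¹ * a1)
      * ((1 + (a1 * R ^ 2)⁻¹) * (1 + a2 / (R ^ 2 * M2 ^ 2))) * (R / q ^ 2 / (1 + (R ^ 2)⁻¹))
      * ((1 + R * s) * (1 - T / R / q ^ 2)) := by
  have p1 : 0 < R ^ 2 + 1 := by positivity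
  field_simp
  ring

/-- Here r1 and r2 stand for the quotients of the one-site generating functions under dilation by q²
and q⁻², and jp and jm for their quotients under a jump to the right and to the left. The left side
is the ASEP bond generator, the right side the dynamic one with R = q^h. -/
lemma two_site_rational {q M1 M2 a1 a2 R s T d1 d2 d3 d4 r1 r2 jp jm : ℝ}
    (hq : 0 < q) (hM1 : 0 < M1) (hM2 : 0 < M2) (h1 : 0 < a1)
    (h2 : 0 < a2) (hR : 0 < R) (hs : s ≠ 0) (hT : T ≠ 0)
    (e1 : d1 = 1 + R * s) (e2 : d2 = 1 - s / R) (e3 : d3 = 1 - T / R / q ^ 2)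
    (e4 : d4 = 1 + R * T / q ^ 2) (n1 : d1 ≠ 0) (n2 : d2 ≠ 0) (n3 : d3 ≠ 0) (n4 : d4 ≠ 0)
    (f1 : (d1 * d2) * r1 = (1 + R * s * a1) * (1 - s / R * (M1 ^ 2 / a1)))
    (f2 : (d4 * d3) * r2 = (1 + R * T / a2 / q ^ 2) * (1 - T * a2 / (R * M2 ^ 2) / q ^ 2))
    (f3 : (d1 * d3) * jp = (1 - s / R / q ^ 2) * (1 + R * T))
    (f4 : (d2 * d4) * jm = (1 + R * s / q ^ 2) * (1 - T / R)) :
  (s / T - 1) * (q * M2) * (M1 - M1⁻¹ * r1) * (1 - r2)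
    + (T / s - 1) * (q * M1)⁻¹ * (r1 - 1) * (M2 * r2 - M2⁻¹) =
   (q * M1)⁻¹ * (a1 - 1) * (M2 / a2 - M2⁻¹)
      * ((1 + M1 ^ 2 / (R ^ 2 * a1)) * (1 + a2 / R ^ 2)
        / ((1 + (R ^ 2)⁻¹) * (1 + (R ^ 2)⁻¹ / q ^ 2))) * (jp - 1)
  + q * M2 * (1 - a2⁻¹) * (M1 - M1⁻¹ * a1)
      * ((1 + (a1 * R ^ 2)⁻¹) * (1 + a2 / (R ^ 2 * M2 ^ 2))
        / ((1 + (R ^ 2)⁻¹) * (1 + (R ^ 2)⁻¹ * q ^ 2))) * (jm - 1) := by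
  -- Both sides carry T - s. On the left it comes from s/T - 1 and T/s - 1, whose denominators
  -- cancel against the factor T of 1 - r2 and the factor s of r1 - 1.
  have J1 : jp - 1 = (R + 1 / (R * q ^ 2)) * (T - s) / (d1 * d3) := by
    rw [eq_div_iff (mul_ne_zero n1 n3), sub_mul, mul_comm jp, f3, e1, e3]; field_simp; ring
  have J2 : jm - 1 = - (R / q ^ 2 + 1 / R) * (T - s) / (d2 * d4) := by
    rw [eq_div_iff (mul_ne_zero n2 n4), sub_mul, mul_comm jm, f4, e2, e4]; field_simp; ring
  have R1 : r1 - 1 = s * ((R * (a1 - 1) - (M1 ^ 2 / a1 - 1) / R) + s * (1 - M1 ^ 2)) / (d1 * d2) := by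
    rw [eq_div_iff (mul_ne_zero n1 n2), sub_mul, mul_comm r1, f1, e1, e2]; field_simp; ring
  have R2 : 1 - r2 = T * (R / q ^ 2 * (1 - a2⁻¹) - (1 - a2 / M2 ^ 2) / (R * q ^ 2)
      - T / q ^ 4 * (1 - (M2 ^ 2)⁻¹)) / (d4 * d3) := by
    rw [eq_div_iff (mul_ne_zero n4 n3), sub_mul, mul_comm r2, f2, e4, e3]; field_simp; ring
  have R3 : M1 - M1⁻¹ * r1 = ((M1 - M1⁻¹) + s * (R * (M1 - a1 / M1) - (M1 - M1 / a1) / R))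
      / (d1 * d2) := by
    rw [eq_div_iff (mul_ne_zero n1 n2), sub_mul, mul_assoc, mul_comm r1, f1, e1, e2]
    field_simp; ring
  have R4 : M2 * r2 - M2⁻¹ = ((M2 - M2⁻¹) + T * (R / q ^ 2 * (M2 / a2 - M2⁻¹)
      - (a2 / M2 - M2⁻¹) / (R * q ^ 2))) / (d4 * d3) := by
    rw [eq_div_iff (mul_ne_zero n4 n3), sub_mul, mul_assoc, mul_comm r2, f2, e4, e3]
    field_simp; ring
  have core := two_site_core q M1 M2 a1 a2 R s T hq hM1 hM2 h1 h2 hR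
  rw [← e1, ← e2, ← e3, ← e4] at core
  have g1 : (R + 1 / (R * q ^ 2)) / ((1 + (R ^ 2)⁻¹) * (1 + (R ^ 2)⁻¹ / q ^ 2))
      = R / (1 + (R ^ 2)⁻¹) := by
    field_simp
  have g2 : (R / q ^ 2 + 1 / R) / ((1 + (R ^ 2)⁻¹) * (1 + (R ^ 2)⁻¹ * q ^ 2))
      = R / q ^ 2 / (1 + (R ^ 2)⁻¹) := by
    field_simp
  rw [← g1, ← g2] at core
  rw [R1, R2, R3, R4, J1, J2]
  have hD : d1 * d2 * d3 * d4 ≠ 0 := by positivity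
  generalize ((M1 - M1⁻¹) + s * (R * (M1 - a1 / M1) - (M1 - M1 / a1) / R)) = A1 at *
  generalize (R / q ^ 2 * (1 - a2⁻¹) - (1 - a2 / M2 ^ 2) / (R * q ^ 2)
      - T / q ^ 4 * (1 - (M2 ^ 2)⁻¹)) = A2 at *
  generalize ((R * (a1 - 1) - (M1 ^ 2 / a1 - 1) / R) + s * (1 - M1 ^ 2)) = A3 at *
  generalize ((M2 - M2⁻¹) + T * (R / q ^ 2 * (M2 / a2 - M2⁻¹)
      - (a2 / M2 - M2⁻¹) / (R * q ^ 2))) = A4 at *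
  generalize ((1 + (R ^ 2)⁻¹) * (1 + (R ^ 2)⁻¹ / q ^ 2)) = B1 at *
  generalize ((1 + (R ^ 2)⁻¹) * (1 + (R ^ 2)⁻¹ * q ^ 2)) = B2 at *
  generalize (R + 1 / (R * q ^ 2)) = B3 at *
  generalize (R / q ^ 2 + 1 / R) = B4 at *
  generalize ((1 + M1 ^ 2 / (R ^ 2 * a1)) * (1 + a2 / R ^ 2)) = C1 at *
  generalize ((1 + (a1 * R ^ 2)⁻¹) * (1 + a2 / (R ^ 2 * M2 ^ 2))) = C2 at *
  generalize q * M2 = u at *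
  generalize (q * M1)⁻¹ = u' at *
  generalize (1 - a2⁻¹) = D1 at *
  generalize (M1 - M1⁻¹ * a1) = D2 at *
  generalize (a1 - 1) = D3 at *
  generalize (M2 / a2 - M2⁻¹) = D4 at *
  clear f1 f2 f3 f4 e1 e2 e3 e4 g1 g2 J1 J2 R1 R2 R3 R4
  have key : (s / T - 1) * u * (A1 / (d1 * d2)) * (T * A2 / (d4 * d3))
    + (T / s - 1) * u' * (s * A3 / (d1 * d2)) * (A4 / (d4 * d3))
    = (T - s) * (-u * A1 * A2 + u' * A3 * A4) / (d1 * d2 * d3 * d4) := by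
    field_simp; ring
  rw [key, core, div_eq_iff hD]
  have k1 : B3 * (T - s) / (d1 * d3) * (d1 * d2 * d3 * d4) = B3 * (T - s) * (d2 * d4) := by
    field_simp
  have k2 : -B4 * (T - s) / (d2 * d4) * (d1 * d2 * d3 * d4) = -B4 * (T - s) * (d1 * d3) := by
    field_simp
  simp only [div_eq_mul_inv] at *
  linear_combination (-(u' * D3 * D4 * (C1 * B1⁻¹))) * k1 - (u * D1 * D2 * (C2 * B2⁻¹)) * k2

/-! ### Rates and weights on two neighbouring sites -/

/-- ASEP rate for a jump from the left to the right of two neighbouring sites. -/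
def rateRight (q : ℝ) (N₁ N₂ a b : ℕ) : ℝ :=
  q ^ (-((b : ℝ) + N₁ - a + 1)) * qNum q a * qNum q ((N₂ : ℝ) - b)

/-- ASEP rate for a jump from the right to the left of two neighbouring sites. -/
def rateLeft (q : ℝ) (N₁ N₂ a b : ℕ) : ℝ :=
  q ^ ((a : ℝ) + N₂ - b + 1) * qNum q b * qNum q ((N₁ : ℝ) - a)

lemma sub_inv_ne_zero {q : ℝ} (hq : 0 < q) (hq1 : q ≠ 1) : q - q⁻¹ ≠ 0 := by
  intro h
  have h1 : q ^ 2 = 1 := by field_simp at h; linarith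
  exact hq1 ((pow_eq_one_iff_of_nonneg hq.le two_ne_zero).1 h1)

lemma sq_ne_one {q : ℝ} (hq : 0 < q) (hq1 : q ≠ 1) : q ^ 2 ≠ 1 := fun h =>
  hq1 ((pow_eq_one_iff_of_nonneg hq.le two_ne_zero).1 h)

/-- The occupation numbers enter only through q^(2a) and q^(-2b), so on generating functions the
rate acts by dilations of s and t. `rateLeft_eq` has the same purpose. -/
lemma rateRight_eq {q : ℝ} (hq : 0 < q) (hq1 : q ≠ 1) (N₁ N₂ a b : ℕ) :
    rateRight q N₁ N₂ a b = (q * q ^ N₁)⁻¹ * ((q ^ 2) ^ a - 1)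
      * (q ^ N₂ / (q ^ 2) ^ b - (q ^ N₂)⁻¹) / (q - q⁻¹) ^ 2 := by
  have := sub_inv_ne_zero hq hq1
  have e : q ^ (-((b : ℝ) + N₁ - a + 1)) = q ^ a / (q ^ b * q ^ N₁ * q) := by
    rw [show (-((b : ℝ) + N₁ - a + 1)) = (a : ℝ) - (b + N₁ + 1) by ring, Real.rpow_sub hq,
      Real.rpow_add hq, Real.rpow_add hq, Real.rpow_one]
    simp only [Real.rpow_natCast]
  rw [rateRight, qNum, qNum, if_neg hq1, if_neg hq1, e, Real.rpow_neg hq.le, Real.rpow_neg hq.le,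
    Real.rpow_sub hq]
  simp only [Real.rpow_natCast]
  rw [← pow_mul, ← pow_mul, mul_comm 2 a, mul_comm 2 b, pow_mul, pow_mul]
  have := pow_pos hq a
  have := pow_pos hq b
  have := pow_pos hq N₁
  have := pow_pos hq N₂
  field_simp

lemma rateLeft_eq {q : ℝ} (hq : 0 < q) (hq1 : q ≠ 1) (N₁ N₂ a b : ℕ) :
    rateLeft q N₁ N₂ a b = q * q ^ N₂ * (1 - ((q ^ 2) ^ b)⁻¹)
      * (q ^ N₁ - (q ^ N₁)⁻¹ * (q ^ 2) ^ a) / (q - q⁻¹) ^ 2 := by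
  have := sub_inv_ne_zero hq hq1
  have e : q ^ ((a : ℝ) + N₂ - b + 1) = q ^ a * q ^ N₂ / q ^ b * q := by
    rw [Real.rpow_add hq, Real.rpow_sub hq, Real.rpow_add hq, Real.rpow_one]
    simp only [Real.rpow_natCast]
  rw [rateLeft, qNum, qNum, if_neg hq1, if_neg hq1, e, Real.rpow_neg hq.le, Real.rpow_neg hq.le,
    Real.rpow_sub hq]
  simp only [Real.rpow_natCast]
  rw [← pow_mul, ← pow_mul, mul_comm 2 a, mul_comm 2 b, pow_mul, pow_mul]
  have := pow_pos hq a
  have := pow_pos hq b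
  have := pow_pos hq N₁
  have := pow_pos hq N₂
  field_simp

lemma rateRight_zero_left (q : ℝ) (N₁ N₂ b : ℕ) : rateRight q N₁ N₂ 0 b = 0 := by
  simp [rateRight, qNum]

lemma rateRight_full_right (q : ℝ) (N₁ N₂ a : ℕ) : rateRight q N₁ N₂ a N₂ = 0 := by
  simp [rateRight, qNum]

lemma rateLeft_zero_right (q : ℝ) (N₁ N₂ a : ℕ) : rateLeft q N₁ N₂ a 0 = 0 := by
  simp [rateLeft, qNum]

lemma rateLeft_full_left (q : ℝ) (N₁ N₂ b : ℕ) : rateLeft q N₁ N₂ N₁ b = 0 := by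
  simp [rateLeft, qNum]

/-- This quotient of weights is what converts shifts of n into dilations, in detailed balance as
well as in the one-site recurrence. -/
lemma wSite_succ {q : ℝ} (hq : 0 < q) (hq1 : q ≠ 1) {n N : ℕ} (h : n < N) :
    wSite (n + 1) N q * ((q ^ 2) ^ (n + 1) - 1)
      = wSite n N q * (q * (q ^ N - (q ^ N)⁻¹ * (q ^ 2) ^ n)) := by
  have h1 := qBinom_succ_right (p := q ^ 2) (by positivity) (sq_ne_one hq hq1) h
  obtain ⟨m, rfl⟩ := Nat.exists_eq_add_of_le h.le
  rw [Nat.add_sub_cancel_left] at h1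
  have e : q ^ (((n + 1 : ℕ) : ℝ) * (((n + 1 : ℕ) : ℝ) - ((n + m : ℕ) : ℝ)))
      = q ^ ((n : ℝ) * ((n : ℝ) - ((n + m : ℕ) : ℝ))) * (q * q ^ n / q ^ m) := by
    rw [← Real.rpow_natCast q n, ← Real.rpow_natCast q m]
    nth_rewrite 3 [← Real.rpow_one q]
    rw [← Real.rpow_add hq, ← Real.rpow_sub hq, ← Real.rpow_add hq]
    congr 1
    push_cast
    ring
  rw [wSite, wSite, e]
  generalize q ^ ((n : ℝ) * ((n : ℝ) - ((n + m : ℕ) : ℝ))) = A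
  have e2 : q ^ (n + m) - (q ^ (n + m))⁻¹ * (q ^ 2) ^ n
      = -(1 - (q ^ 2) ^ m) * q ^ n / q ^ m := by
    have := pow_pos hq m
    have := pow_pos hq n
    rw [pow_add, ← pow_mul, ← pow_mul, mul_comm 2 n, mul_comm 2 m, pow_mul, pow_mul]
    field_simp
    ring
  rw [e2]
  linear_combination (-A * (q * q ^ n / q ^ m)) * h1

/-- Detailed balance for a single bond. -/
lemma rate_balance {q : ℝ} (hq : 0 < q) (hq1 : q ≠ 1) {N₁ N₂ a b : ℕ} (ha : a < N₁) (hb : b < N₂) :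
    q ^ N₁ * q ^ N₂ * (wSite (a + 1) N₁ q * wSite b N₂ q * rateRight q N₁ N₂ (a + 1) b)
      = wSite a N₁ q * wSite (b + 1) N₂ q * rateLeft q N₁ N₂ a (b + 1) := by
  have h1 := wSite_succ hq hq1 ha
  have h2 := wSite_succ hq hq1 hb
  have := sub_inv_ne_zero hq hq1
  rw [rateRight_eq hq hq1, rateLeft_eq hq hq1]
  have := pow_pos hq N₁
  have := pow_pos hq N₂
  have hB := pow_pos (pow_pos hq 2) b
  have e : 1 - ((q ^ 2) ^ (b + 1))⁻¹ = ((q ^ 2) ^ (b + 1) - 1) / ((q ^ 2) ^ b * q ^ 2) := by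
    rw [pow_succ]; field_simp
  have e3 : q ^ N₂ / (q ^ 2) ^ b - (q ^ N₂)⁻¹ = (q ^ N₂ - (q ^ N₂)⁻¹ * (q ^ 2) ^ b) / (q ^ 2) ^ b := by
    field_simp
  rw [e, e3]
  generalize (q ^ 2) ^ (b + 1) - 1 = B at *
  generalize (q ^ 2) ^ (a + 1) - 1 = A at *
  generalize (q ^ N₂ - (q ^ N₂)⁻¹ * (q ^ 2) ^ b) = B' at *
  generalize (q ^ N₁ - (q ^ N₁)⁻¹ * (q ^ 2) ^ a) = A' at *
  have l : q ^ N₁ * q ^ N₂ * (wSite (a + 1) N₁ q * wSite b N₂ q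
      * ((q * q ^ N₁)⁻¹ * A * (B' / (q ^ 2) ^ b) / (q - q⁻¹) ^ 2))
      = (wSite (a + 1) N₁ q * A) * wSite b N₂ q * q⁻¹ * q ^ N₂ * (B' / (q ^ 2) ^ b) / (q - q⁻¹) ^ 2 := by
    generalize q - q⁻¹ = κ at *
    field_simp
  have r : wSite a N₁ q * wSite (b + 1) N₂ q
      * (q * q ^ N₂ * (B / ((q ^ 2) ^ b * q ^ 2)) * A' / (q - q⁻¹) ^ 2)
      = wSite a N₁ q * (wSite (b + 1) N₂ q * B) * q * q ^ N₂ * (1 / ((q ^ 2) ^ b * q ^ 2)) * A'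
        / (q - q⁻¹) ^ 2 := by
    generalize q - q⁻¹ = κ at *
    field_simp
  rw [l, r, h1, h2]
  generalize q - q⁻¹ = κ at *
  field_simp

/-! ### Generating function of a bond generator -/

lemma sum_range_sum_range_shift_left (N₁ N₂ : ℕ) (h : ℕ → ℕ → ℝ) (h0 : ∀ b, h 0 b = 0)
    (h1 : ∀ a, h a N₂ = 0) :
    ∑ a ∈ Finset.range (N₁ + 1), ∑ b ∈ Finset.range (N₂ + 1), h a b
      = ∑ a ∈ Finset.range N₁, ∑ b ∈ Finset.range N₂, h (a + 1) b := by
  rw [Finset.sum_range_succ']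
  simp [h0, Finset.sum_range_succ, h1]

lemma sum_range_sum_range_shift_right (N₁ N₂ : ℕ) (h : ℕ → ℕ → ℝ) (h0 : ∀ a, h a 0 = 0)
    (h1 : ∀ b, h N₁ b = 0) :
    ∑ a ∈ Finset.range (N₁ + 1), ∑ b ∈ Finset.range (N₂ + 1), h a b
      = ∑ a ∈ Finset.range N₁, ∑ b ∈ Finset.range N₂, h a (b + 1) := by
  rw [Finset.sum_range_succ]
  simp [h0, Finset.sum_range_succ', h1]

/-- The generator of a bond acting on `D ^ b * f a * g b`, divided by `D ^ b`. -/
def bondOp (q : ℝ) (N₁ N₂ : ℕ) (D : ℝ) (f g : ℕ → ℝ) (a b : ℕ) : ℝ :=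
  rateRight q N₁ N₂ a b * (D * (f (a - 1) * g (b + 1)) - f a * g b)
    + rateLeft q N₁ N₂ a b * (D⁻¹ * (f (a + 1) * g (b - 1)) - f a * g b)

/-- Weighted generating function of a sequence on one site. -/
def siteGF (q : ℝ) (N : ℕ) (f : ℕ → ℝ) (t : ℝ) : ℝ :=
  ∑ n ∈ Finset.range (N + 1), wSite n N q * f n * t ^ n

lemma sum_rateLeft {q : ℝ} (hq : 0 < q) (hq1 : q ≠ 1) (N₁ N₂ : ℕ) (f g : ℕ → ℝ) (s t : ℝ) :
    ∑ a ∈ Finset.range (N₁ + 1), ∑ b ∈ Finset.range (N₂ + 1),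
      wSite a N₁ q * wSite b N₂ q * (rateLeft q N₁ N₂ a b * (f a * g b)) * (s ^ a * t ^ b)
    = (q * q ^ N₂) * (q ^ N₁ * siteGF q N₁ f s - (q ^ N₁)⁻¹ * siteGF q N₁ f (q ^ 2 * s))
      * (siteGF q N₂ g t - siteGF q N₂ g (t / q ^ 2)) / (q - q⁻¹) ^ 2 := by
  rw [mul_assoc]
  simp only [siteGF]
  rw [Finset.mul_sum, Finset.mul_sum, ← Finset.sum_sub_distrib, ← Finset.sum_sub_distrib,
    Finset.sum_mul_sum, Finset.mul_sum, Finset.sum_div]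
  refine Finset.sum_congr rfl fun a _ => ?_
  rw [Finset.mul_sum, Finset.sum_div]
  refine Finset.sum_congr rfl fun b _ => ?_
  rw [rateLeft_eq hq hq1, mul_pow, div_pow]
  ring

lemma sum_rateRight {q : ℝ} (hq : 0 < q) (hq1 : q ≠ 1) (N₁ N₂ : ℕ) (f g : ℕ → ℝ) (s t : ℝ) :
    ∑ a ∈ Finset.range (N₁ + 1), ∑ b ∈ Finset.range (N₂ + 1),
      wSite a N₁ q * wSite b N₂ q * (rateRight q N₁ N₂ a b * (f a * g b)) * (s ^ a * t ^ b)
    = (q * q ^ N₁)⁻¹ * (siteGF q N₁ f (q ^ 2 * s) - siteGF q N₁ f s)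
      * (q ^ N₂ * siteGF q N₂ g (t / q ^ 2) - (q ^ N₂)⁻¹ * siteGF q N₂ g t) / (q - q⁻¹) ^ 2 := by
  rw [mul_assoc]
  simp only [siteGF]
  rw [Finset.mul_sum, Finset.mul_sum, ← Finset.sum_sub_distrib, ← Finset.sum_sub_distrib,
    Finset.sum_mul_sum, Finset.mul_sum, Finset.sum_div]
  refine Finset.sum_congr rfl fun a _ => ?_
  rw [Finset.mul_sum, Finset.sum_div]
  refine Finset.sum_congr rfl fun b _ => ?_
  rw [rateRight_eq hq hq1, mul_pow, div_pow]
  ring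

lemma sum_bondOp {q : ℝ} (hq : 0 < q) (hq1 : q ≠ 1) (N₁ N₂ : ℕ) {D : ℝ}
    (hD : D ^ 2 = q ^ N₁ * q ^ N₂) (f g : ℕ → ℝ) {s t : ℝ} (hs : s ≠ 0) (ht : t ≠ 0) :
    ∑ a ∈ Finset.range (N₁ + 1), ∑ b ∈ Finset.range (N₂ + 1),
      wSite a N₁ q * wSite b N₂ q * bondOp q N₁ N₂ D f g a b * (s ^ a * t ^ b)
    = (D⁻¹ * (s / t) - 1)
        * ((q * q ^ N₂) * (q ^ N₁ * siteGF q N₁ f s - (q ^ N₁)⁻¹ * siteGF q N₁ f (q ^ 2 * s))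
          * (siteGF q N₂ g t - siteGF q N₂ g (t / q ^ 2)) / (q - q⁻¹) ^ 2)
      + (D * (t / s) - 1) * ((q * q ^ N₁)⁻¹ * (siteGF q N₁ f (q ^ 2 * s) - siteGF q N₁ f s)
          * (q ^ N₂ * siteGF q N₂ g (t / q ^ 2) - (q ^ N₂)⁻¹ * siteGF q N₂ g t)
          / (q - q⁻¹) ^ 2) := by
  have hD0 : D ≠ 0 := by
    rintro rfl
    have := pow_pos hq N₁
    have := pow_pos hq N₂
    have : 0 < q ^ N₁ * q ^ N₂ := by positivity
    rw [← hD] at this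
    norm_num at this
  rw [← sum_rateLeft hq hq1, ← sum_rateRight hq hq1]
  -- After reindexing, detailed balance replaces the rate by that of the reverse jump, whose indices
  -- match those of f and g. The factor D² = q^(N₁+N₂) of `rate_balance` turns D into D⁻¹.
  have e1 : ∑ a ∈ Finset.range (N₁ + 1), ∑ b ∈ Finset.range (N₂ + 1), wSite a N₁ q * wSite b N₂ q
        * (rateRight q N₁ N₂ a b * (D * (f (a - 1) * g (b + 1)))) * (s ^ a * t ^ b)
      = (D⁻¹ * (s / t)) * ∑ a ∈ Finset.range (N₁ + 1), ∑ b ∈ Finset.range (N₂ + 1),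
        wSite a N₁ q * wSite b N₂ q * (rateLeft q N₁ N₂ a b * (f a * g b)) * (s ^ a * t ^ b) := by
    rw [sum_range_sum_range_shift_left, sum_range_sum_range_shift_right, Finset.mul_sum]
    · refine Finset.sum_congr rfl fun a ha => ?_
      rw [Finset.mul_sum]
      refine Finset.sum_congr rfl fun b hb => ?_
      rw [Finset.mem_range] at ha hb
      have h := rate_balance hq hq1 ha hb
      rw [← hD] at h
      rw [Nat.add_sub_cancel]
      have : wSite (a + 1) N₁ q * wSite b N₂ q * (rateRight q N₁ N₂ (a + 1) b * (D * (f a * g (b + 1))))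
          = D⁻¹ * (D ^ 2 * (wSite (a + 1) N₁ q * wSite b N₂ q * rateRight q N₁ N₂ (a + 1) b))
            * (f a * g (b + 1)) := by field_simp
      rw [this, h, pow_succ, pow_succ]
      field_simp
    · simp [rateLeft_zero_right]
    · simp [rateLeft_full_left]
    · simp [rateRight_zero_left]
    · simp [rateRight_full_right]
  have e2 : ∑ a ∈ Finset.range (N₁ + 1), ∑ b ∈ Finset.range (N₂ + 1), wSite a N₁ q * wSite b N₂ q
        * (rateLeft q N₁ N₂ a b * (D⁻¹ * (f (a + 1) * g (b - 1)))) * (s ^ a * t ^ b)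
      = (D * (t / s)) * ∑ a ∈ Finset.range (N₁ + 1), ∑ b ∈ Finset.range (N₂ + 1),
        wSite a N₁ q * wSite b N₂ q * (rateRight q N₁ N₂ a b * (f a * g b)) * (s ^ a * t ^ b) := by
    rw [sum_range_sum_range_shift_right, sum_range_sum_range_shift_left, Finset.mul_sum]
    · refine Finset.sum_congr rfl fun a ha => ?_
      rw [Finset.mul_sum]
      refine Finset.sum_congr rfl fun b hb => ?_
      rw [Finset.mem_range] at ha hb
      have h := rate_balance hq hq1 ha hb
      rw [← hD] at h
      rw [Nat.add_sub_cancel]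
      have : wSite a N₁ q * wSite (b + 1) N₂ q
          * (rateLeft q N₁ N₂ a (b + 1) * (D⁻¹ * (f (a + 1) * g b)))
          = (wSite a N₁ q * wSite (b + 1) N₂ q * rateLeft q N₁ N₂ a (b + 1)) * D⁻¹
            * (f (a + 1) * g b) := by ring
      rw [this, ← h]
      field_simp
      ring
    · simp [rateRight_zero_left]
    · simp [rateRight_full_right]
    · simp [rateLeft_zero_right]
    · simp [rateLeft_full_left]
  rw [sub_mul, sub_mul, ← e1, ← e2, one_mul, one_mul]
  simp only [bondOp, ← Finset.sum_sub_distrib, ← Finset.sum_add_distrib]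
  refine Finset.sum_congr rfl fun a _ => Finset.sum_congr rfl fun b _ => ?_
  ring

/-! ### Comparing coefficients -/

/-- A nonzero polynomial has finitely many roots, so small positive t suffice. The one-sided filter
allows division by t and by factors that vanish only away from 0. -/
lemma coeff_eq_zero_of_sum_pow {N : ℕ} {d : ℕ → ℝ}
    (h : ∀ᶠ t in 𝓝[>] (0 : ℝ), ∑ n ∈ Finset.range (N + 1), d n * t ^ n = 0) {n : ℕ} (hn : n ≤ N) :
    d n = 0 := by
  set P : Polynomial ℝ := ∑ n ∈ Finset.range (N + 1), Polynomial.monomial n (d n) with hP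
  have hev : ∀ t, P.eval t = ∑ n ∈ Finset.range (N + 1), d n * t ^ n := fun t => by
    simp [hP, Polynomial.eval_finsetSum]
  have h0 : P = 0 := by
    refine Polynomial.eq_zero_of_infinite_isRoot P ?_
    obtain ⟨u, hu, hsub⟩ := mem_nhdsGT_iff_exists_Ioo_subset.1 h
    refine Set.Infinite.mono (fun t ht => ?_) (Set.Ioo_infinite hu)
    rw [Set.mem_ofPred_eq, Polynomial.IsRoot.def, hev]
    exact hsub ht
  have h1 : P.coeff n = d n := by
    rw [hP, Polynomial.finsetSum_coeff]
    simp only [Polynomial.coeff_monomial]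
    rw [Finset.sum_ite_eq', if_pos (by simpa using Nat.lt_succ_of_le hn)]
  rw [← h1, h0, Polynomial.coeff_zero]

lemma coeff_eq_zero_of_sum_pow_pow {N₁ N₂ : ℕ} {d : ℕ → ℕ → ℝ}
    (h : ∀ᶠ s in 𝓝[>] (0 : ℝ), ∀ᶠ t in 𝓝[>] (0 : ℝ),
      ∑ a ∈ Finset.range (N₁ + 1), ∑ b ∈ Finset.range (N₂ + 1), d a b * (s ^ a * t ^ b) = 0)
    {a b : ℕ} (ha : a ≤ N₁) (hb : b ≤ N₂) : d a b = 0 := by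
  refine coeff_eq_zero_of_sum_pow (N := N₁) (d := fun a => d a b) ?_ ha
  filter_upwards [h] with s hs
  refine coeff_eq_zero_of_sum_pow (N := N₂)
    (d := fun b => ∑ a ∈ Finset.range (N₁ + 1), d a b * s ^ a) ?_ hb
  filter_upwards [hs] with t ht
  rw [← ht, Finset.sum_comm]
  refine Finset.sum_congr rfl fun b _ => ?_
  rw [Finset.sum_mul]
  exact Finset.sum_congr rfl fun a _ => by ring

/-! ### Two-site duality -/

/-- The generating function of the one-site functions `k`, as a polynomial in `s`. -/
def sitePoly (Q R s : ℝ) (x y : ℕ) : ℝ := qPoch (-(R * s)) Q x * qPoch (s / R) Q y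

lemma siteGF_kSite {q : ℝ} (hq : 0 < q) (hq1 : q ≠ 1) {x N : ℕ} (hx : x ≤ N) (ρ t : ℝ) :
    siteGF q N (fun n => kSite n x ρ N q) t
      = sitePoly (q ^ 2) (q ^ ρ) (q ^ ((1 - (N : ℝ)) / 2) * t) x (N - x) := by
  rw [siteGF, sum_wSite_kSite hq hq1 hx, sitePoly, Real.rpow_add hq, Real.rpow_add hq,
    Real.rpow_neg hq.le]
  congr 2 <;> ring

/-- Dilating s by Q shifts each product by one factor. This first-order q-difference equation
underlies both the duality and the one-site recurrence. -/
lemma sitePoly_mul_base (Q R s : ℝ) (x y : ℕ) :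
    ((1 + R * s) * (1 - s / R)) * sitePoly Q R (Q * s) x y
      = sitePoly Q R s x y * ((1 + R * s * Q ^ x) * (1 - s / R * Q ^ y)) := by
  have h1 := qPoch_mul_base (-(R * s)) Q x
  have h2 := qPoch_mul_base (s / R) Q y
  rw [sitePoly, sitePoly, show -(R * (Q * s)) = -(R * s) * Q by ring,
    show Q * s / R = s / R * Q by ring]
  linear_combination (1 - s / R) * qPoch (s / R * Q) Q y * h1
    + qPoch (-(R * s)) Q x * (1 + R * s * Q ^ x) * h2

lemma sitePoly_div_base {Q : ℝ} (hQ : Q ≠ 0) (R s : ℝ) (x y : ℕ) :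
    ((1 + R * s * Q ^ x / Q) * (1 - s / R * Q ^ y / Q)) * sitePoly Q R (s / Q) x y
      = sitePoly Q R s x y * ((1 + R * s / Q) * (1 - s / R / Q)) := by
  have h := sitePoly_mul_base Q R (s / Q) x y
  rw [mul_div_cancel₀ _ hQ] at h
  rw [show R * s * Q ^ x / Q = R * (s / Q) * Q ^ x by ring,
    show s / R * Q ^ y / Q = s / Q / R * Q ^ y by ring, mul_comm, ← h]
  ring

/-- Models the left site of a bond when a particle leaves it to the right: the height grows by 2, so
R becomes RQ, and only the first factors of the products change. `sitePoly_lower` models the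
opposite jump. -/
lemma sitePoly_raise {Q : ℝ} (hQ : Q ≠ 0) (R s : ℝ) (x y : ℕ) :
    (1 + R * s) * sitePoly Q (R * Q) s x (y + 1)
      = sitePoly Q R s (x + 1) y * (1 - s / R / Q) := by
  rw [sitePoly, sitePoly, qPoch_succ_left, qPoch_succ_left,
    show s / (R * Q) * Q = s / R by field_simp, show -(R * Q * s) = -(R * s) * Q by ring,
    show s / (R * Q) = s / R / Q by rw [div_div]]
  ring

lemma sitePoly_lower {Q : ℝ} (hQ : Q ≠ 0) (R s : ℝ) (x y : ℕ) :
    (1 - s / R) * sitePoly Q (R / Q) s (x + 1) y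
      = sitePoly Q R s x (y + 1) * (1 + R * s / Q) := by
  have e : s / (R / Q) = s / R * Q := by rw [div_div_eq_mul_div]; ring
  rw [sitePoly, sitePoly, qPoch_succ_left, qPoch_succ_left, e,
    show -(R / Q * s) * Q = -(R * s) by field_simp]
  ring

/-- At fixed R, one more particle exchanges the last factors of the two products. -/
lemma sitePoly_move (Q R s : ℝ) (x y : ℕ) :
    (1 - s / R * Q ^ y) * sitePoly Q R s (x + 1) y
      = sitePoly Q R s x (y + 1) * (1 + R * s * Q ^ x) := by
  rw [sitePoly, sitePoly, qPoch_succ, qPoch_succ]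
  ring

/-! ### Factors that do not vanish near 0 -/

lemma eventually_one_sub_mul_ne_zero (c : ℝ) : ∀ᶠ s in 𝓝[>] (0 : ℝ), 1 - c * s ≠ 0 := by
  have h : Tendsto (fun s : ℝ => 1 - c * s) (𝓝 0) (𝓝 (1 - c * 0)) :=
    (by fun_prop : Continuous fun s : ℝ => 1 - c * s).tendsto 0
  refine (h.eventually_ne (by simp)).filter_mono nhdsWithin_le_nhds

lemma eventually_qPoch_ne_zero (c Q : ℝ) (n : ℕ) :
    ∀ᶠ s in 𝓝[>] (0 : ℝ), qPoch (c * s) Q n ≠ 0 := by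
  simp only [qPoch, Finset.prod_ne_zero_iff]
  rw [Filter.eventually_all_finset]
  intro j _
  filter_upwards [eventually_one_sub_mul_ne_zero (c * Q ^ j)] with s hs
  rwa [show c * s * Q ^ j = c * Q ^ j * s by ring]

lemma eventually_sitePoly_ne_zero (Q R g : ℝ) (x y : ℕ) :
    ∀ᶠ s in 𝓝[>] (0 : ℝ), sitePoly Q R (g * s) x y ≠ 0 := by
  filter_upwards [eventually_qPoch_ne_zero (-(R * g)) Q x, eventually_qPoch_ne_zero (g / R) Q y]
    with s h1 h2
  rw [sitePoly, show -(R * (g * s)) = -(R * g) * s by ring, show g * s / R = g / R * s by ring]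
  exact mul_ne_zero h1 h2

/-- Jump rate to the right in the dynamic process with right boundary; `h` is the height `h⁺`
between the two sites. -/
def dynRight (q h : ℝ) (N₁ N₂ x₁ x₂ : ℕ) : ℝ :=
  rateRight q N₁ N₂ x₁ x₂ *
    (((1 + q ^ (2 * (x₁ : ℝ) - 2 * (h + (2 * x₁ - N₁)))) * (1 + q ^ (2 * (x₂ : ℝ) - 2 * h)))
      / ((1 + q ^ (-2 * h)) * (1 + q ^ (-2 * h - 2))))

/-- Jump rate to the left in the dynamic process with right boundary; `h` is the height `h⁺`
between the two sites. -/
def dynLeft (q h : ℝ) (N₁ N₂ x₁ x₂ : ℕ) : ℝ :=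
  rateLeft q N₁ N₂ x₁ x₂ *
    (((1 + q ^ (-2 * (x₁ : ℝ) - 2 * h)) * (1 + q ^ (-2 * (x₂ : ℝ) - 2 * (h - (2 * x₂ - N₂)))))
      / ((1 + q ^ (-2 * h)) * (1 + q ^ (-2 * h + 2))))

lemma rpow_two_mul {q : ℝ} (hq : 0 < q) (h : ℝ) : q ^ (2 * h) = (q ^ h) ^ 2 := by
  rw [mul_comm, Real.rpow_mul hq.le, Real.rpow_two]

lemma dynRight_eq {q : ℝ} (hq : 0 < q) (hq1 : q ≠ 1) (h : ℝ) (N₁ N₂ x₁ x₂ : ℕ) :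
    dynRight q h N₁ N₂ x₁ x₂ = (q * q ^ N₁)⁻¹ * ((q ^ 2) ^ x₁ - 1)
      * (q ^ N₂ / (q ^ 2) ^ x₂ - (q ^ N₂)⁻¹)
      * ((1 + (q ^ N₁) ^ 2 / ((q ^ h) ^ 2 * (q ^ 2) ^ x₁)) * (1 + (q ^ 2) ^ x₂ / (q ^ h) ^ 2)
        / ((1 + ((q ^ h) ^ 2)⁻¹) * (1 + ((q ^ h) ^ 2)⁻¹ / q ^ 2))) / (q - q⁻¹) ^ 2 := by
  have e1 : q ^ (2 * (x₁ : ℝ) - 2 * (h + (2 * x₁ - N₁)))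
      = (q ^ N₁) ^ 2 / ((q ^ h) ^ 2 * (q ^ 2) ^ x₁) := by
    rw [show 2 * (x₁ : ℝ) - 2 * (h + (2 * x₁ - N₁)) = 2 * N₁ - (2 * h + 2 * x₁) by ring,
      Real.rpow_sub hq, Real.rpow_add hq, rpow_two_mul hq, rpow_two_mul hq, rpow_two_mul hq]
    simp only [Real.rpow_natCast]
    rw [pow_right_comm q 2 x₁]
  have e2 : q ^ (2 * (x₂ : ℝ) - 2 * h) = (q ^ 2) ^ x₂ / (q ^ h) ^ 2 := by
    rw [Real.rpow_sub hq, rpow_two_mul hq, rpow_two_mul hq, Real.rpow_natCast,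
      pow_right_comm q 2 x₂]
  have e3 : q ^ (-2 * h) = ((q ^ h) ^ 2)⁻¹ := by
    rw [neg_mul, Real.rpow_neg hq.le, rpow_two_mul hq]
  have e4 : q ^ (-2 * h - 2) = ((q ^ h) ^ 2)⁻¹ / q ^ 2 := by
    rw [Real.rpow_sub hq, e3, Real.rpow_two]
  rw [dynRight, rateRight_eq hq hq1, e1, e2, e3, e4]
  ring

lemma dynLeft_eq {q : ℝ} (hq : 0 < q) (hq1 : q ≠ 1) (h : ℝ) (N₁ N₂ x₁ x₂ : ℕ) :
    dynLeft q h N₁ N₂ x₁ x₂ = q * q ^ N₂ * (1 - ((q ^ 2) ^ x₂)⁻¹)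
      * (q ^ N₁ - (q ^ N₁)⁻¹ * (q ^ 2) ^ x₁)
      * ((1 + ((q ^ 2) ^ x₁ * (q ^ h) ^ 2)⁻¹) * (1 + (q ^ 2) ^ x₂ / ((q ^ h) ^ 2 * (q ^ N₂) ^ 2))
        / ((1 + ((q ^ h) ^ 2)⁻¹) * (1 + ((q ^ h) ^ 2)⁻¹ * q ^ 2))) / (q - q⁻¹) ^ 2 := by
  have e1 : q ^ (-2 * (x₁ : ℝ) - 2 * h) = ((q ^ 2) ^ x₁ * (q ^ h) ^ 2)⁻¹ := by
    rw [show -2 * (x₁ : ℝ) - 2 * h = -(2 * x₁ + 2 * h) by ring,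
      Real.rpow_neg hq.le, Real.rpow_add hq, rpow_two_mul hq, rpow_two_mul hq]
    simp only [Real.rpow_natCast]
    rw [pow_right_comm q 2 x₁]
  have e2 : q ^ (-2 * (x₂ : ℝ) - 2 * (h - (2 * x₂ - N₂)))
      = (q ^ 2) ^ x₂ / ((q ^ h) ^ 2 * (q ^ N₂) ^ 2) := by
    rw [show -2 * (x₂ : ℝ) - 2 * (h - (2 * x₂ - N₂)) = 2 * x₂ - (2 * h + 2 * N₂) by ring,
      Real.rpow_sub hq, Real.rpow_add hq, rpow_two_mul hq, rpow_two_mul hq, rpow_two_mul hq]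
    simp only [Real.rpow_natCast]
    rw [pow_right_comm q 2 x₂]
  have e3 : q ^ (-2 * h) = ((q ^ h) ^ 2)⁻¹ := by
    rw [neg_mul, Real.rpow_neg hq.le, rpow_two_mul hq]
  have e4 : q ^ (-2 * h + 2) = ((q ^ h) ^ 2)⁻¹ * q ^ 2 := by
    rw [Real.rpow_add hq, e3, Real.rpow_two]
  rw [dynLeft, rateLeft_eq hq hq1, e1, e2, e3, e4]
  ring

lemma dynRight_zero_left (q h : ℝ) (N₁ N₂ b : ℕ) : dynRight q h N₁ N₂ 0 b = 0 := by
  rw [dynRight, rateRight_zero_left, zero_mul]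

lemma dynRight_full_right (q h : ℝ) (N₁ N₂ a : ℕ) : dynRight q h N₁ N₂ a N₂ = 0 := by
  rw [dynRight, rateRight_full_right, zero_mul]

lemma dynLeft_zero_right (q h : ℝ) (N₁ N₂ a : ℕ) : dynLeft q h N₁ N₂ a 0 = 0 := by
  rw [dynLeft, rateLeft_zero_right, zero_mul]

lemma dynLeft_full_left (q h : ℝ) (N₁ N₂ b : ℕ) : dynLeft q h N₁ N₂ N₁ b = 0 := by
  rw [dynLeft, rateLeft_full_left, zero_mul]

/-- The two-site duality on the level of generating functions. -/
lemma sitePoly_duality {q : ℝ} (hq : 0 < q) (hq1 : q ≠ 1) {N₁ N₂ x₁ x₂ : ℕ} (hx₁ : x₁ ≤ N₁)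
    (hx₂ : x₂ ≤ N₂) (ρ h : ℝ) (hh : h = ρ + (2 * x₂ - N₂)) {s t : ℝ} (hs : s ≠ 0) (ht : t ≠ 0)
    (hF : sitePoly (q ^ 2) (q ^ h) s x₁ (N₁ - x₁) ≠ 0)
    (hG : sitePoly (q ^ 2) (q ^ ρ) t x₂ (N₂ - x₂) ≠ 0)
    (n1 : 1 + q ^ h * s ≠ 0) (n2 : 1 - s / q ^ h ≠ 0)
    (n3 : 1 - q ^ N₂ * t / q ^ h / q ^ 2 ≠ 0) (n4 : 1 + q ^ h * (q ^ N₂ * t) / q ^ 2 ≠ 0) :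
    (s / (q ^ N₂ * t) - 1)
        * ((q * q ^ N₂) * (q ^ N₁ * sitePoly (q ^ 2) (q ^ h) s x₁ (N₁ - x₁)
            - (q ^ N₁)⁻¹ * sitePoly (q ^ 2) (q ^ h) (q ^ 2 * s) x₁ (N₁ - x₁))
          * (sitePoly (q ^ 2) (q ^ ρ) t x₂ (N₂ - x₂)
            - sitePoly (q ^ 2) (q ^ ρ) (t / q ^ 2) x₂ (N₂ - x₂)) / (q - q⁻¹) ^ 2)
      + (q ^ N₂ * t / s - 1) * ((q * q ^ N₁)⁻¹
          * (sitePoly (q ^ 2) (q ^ h) (q ^ 2 * s) x₁ (N₁ - x₁)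
            - sitePoly (q ^ 2) (q ^ h) s x₁ (N₁ - x₁))
          * (q ^ N₂ * sitePoly (q ^ 2) (q ^ ρ) (t / q ^ 2) x₂ (N₂ - x₂)
            - (q ^ N₂)⁻¹ * sitePoly (q ^ 2) (q ^ ρ) t x₂ (N₂ - x₂)) / (q - q⁻¹) ^ 2)
    = dynRight q h N₁ N₂ x₁ x₂
        * (sitePoly (q ^ 2) (q ^ (h + 2)) s (x₁ - 1) (N₁ - (x₁ - 1))
            * sitePoly (q ^ 2) (q ^ ρ) t (x₂ + 1) (N₂ - (x₂ + 1))
          - sitePoly (q ^ 2) (q ^ h) s x₁ (N₁ - x₁) * sitePoly (q ^ 2) (q ^ ρ) t x₂ (N₂ - x₂))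
      + dynLeft q h N₁ N₂ x₁ x₂
        * (sitePoly (q ^ 2) (q ^ (h - 2)) s (x₁ + 1) (N₁ - (x₁ + 1))
            * sitePoly (q ^ 2) (q ^ ρ) t (x₂ - 1) (N₂ - (x₂ - 1))
          - sitePoly (q ^ 2) (q ^ h) s x₁ (N₁ - x₁)
            * sitePoly (q ^ 2) (q ^ ρ) t x₂ (N₂ - x₂)) := by
  have hκ := sub_inv_ne_zero hq hq1
  have hQ : (q ^ 2) ≠ 0 := by positivity
  have hR : 0 < q ^ h := Real.rpow_pos_of_pos hq h
  have hM1 := pow_pos hq N₁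
  have hM2 := pow_pos hq N₂
  have ha1 := pow_pos (pow_pos hq 2) x₁
  have ha2 := pow_pos (pow_pos hq 2) x₂
  have ey1 : (q ^ 2) ^ (N₁ - x₁) = (q ^ N₁) ^ 2 / (q ^ 2) ^ x₁ := by
    rw [eq_div_iff ha1.ne', ← pow_add, Nat.sub_add_cancel hx₁, pow_right_comm]
  have ey2 : (q ^ 2) ^ (N₂ - x₂) = (q ^ N₂) ^ 2 / (q ^ 2) ^ x₂ := by
    rw [eq_div_iff ha2.ne', ← pow_add, Nat.sub_add_cancel hx₂, pow_right_comm]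
  -- The boundary value is eliminated in favour of the height h between the sites. The factors at
  -- the second site then contain t only through T = q^(N₂) t, as in `two_site_rational`.
  have er : q ^ ρ = q ^ h * q ^ N₂ / (q ^ 2) ^ x₂ := by
    rw [hh, Real.rpow_add hq, Real.rpow_sub hq, rpow_two_mul hq]
    simp only [Real.rpow_natCast]
    rw [pow_right_comm q 2 x₂]
    field_simp
  have hp2 : q ^ (h + 2) = q ^ h * q ^ 2 := by rw [Real.rpow_add hq, Real.rpow_two]
  have hm2 : q ^ (h - 2) = q ^ h / q ^ 2 := by rw [Real.rpow_sub hq, Real.rpow_two]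
  have g1 := sitePoly_mul_base (q ^ 2) (q ^ h) s x₁ (N₁ - x₁)
  have g2 := sitePoly_div_base hQ (q ^ ρ) t x₂ (N₂ - x₂)
  rw [ey1] at g1
  rw [ey2] at g2
  -- products that occur in all factors of the second site
  have c1 : q ^ ρ * t * (q ^ 2) ^ x₂ = q ^ h * (q ^ N₂ * t) := by rw [er]; field_simp
  have c2 : t / q ^ ρ * ((q ^ N₂) ^ 2 / (q ^ 2) ^ x₂) = q ^ N₂ * t / q ^ h := by
    rw [er]; field_simp
  have c3 : q ^ ρ * t = q ^ h * (q ^ N₂ * t) / (q ^ 2) ^ x₂ := by rw [er]; field_simp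
  have c4 : t / q ^ ρ = q ^ N₂ * t * (q ^ 2) ^ x₂ / (q ^ h * (q ^ N₂) ^ 2) := by
    rw [er]; field_simp
  -- At x₁ = 0 or x₂ = N₂ the truncated subtractions are meaningless, but the rate vanishes.
  -- Otherwise the first site is raised and the second moved.
  have jR : (1 + q ^ h * s) * (1 - q ^ N₂ * t / q ^ h / q ^ 2) * (dynRight q h N₁ N₂ x₁ x₂
        * (sitePoly (q ^ 2) (q ^ (h + 2)) s (x₁ - 1) (N₁ - (x₁ - 1))
            * sitePoly (q ^ 2) (q ^ ρ) t (x₂ + 1) (N₂ - (x₂ + 1))))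
      = dynRight q h N₁ N₂ x₁ x₂ * (sitePoly (q ^ 2) (q ^ h) s x₁ (N₁ - x₁)
          * sitePoly (q ^ 2) (q ^ ρ) t x₂ (N₂ - x₂))
        * ((1 - s / q ^ h / q ^ 2) * (1 + q ^ h * (q ^ N₂ * t))) := by
    rcases Nat.eq_zero_or_pos x₁ with h0 | h0
    · rw [h0, dynRight_zero_left]; ring
    rcases Nat.eq_or_lt_of_le hx₂ with h2 | h2
    · rw [h2, dynRight_full_right]; ring
    obtain ⟨x, rfl⟩ : ∃ x, x₁ = x + 1 := ⟨x₁ - 1, by omega⟩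
    obtain ⟨y, hy⟩ : ∃ y, N₂ - x₂ = y + 1 := ⟨N₂ - x₂ - 1, by omega⟩
    have r1 := sitePoly_raise hQ (q ^ h) s x (N₁ - (x + 1))
    have r2 := sitePoly_move (q ^ 2) (q ^ ρ) t x₂ y
    have c2' : t / q ^ ρ * (q ^ 2) ^ y = q ^ N₂ * t / q ^ h / q ^ 2 := by
      rw [← c2, ← ey2, hy, pow_succ]; field_simp; ring
    rw [c1, c2'] at r2
    rw [Nat.add_sub_cancel, show N₁ - x = N₁ - (x + 1) + 1 by omega, hy,
      show N₂ - (x₂ + 1) = y by omega, hp2]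
    linear_combination dynRight q h N₁ N₂ (x + 1) x₂ * ((1 - q ^ N₂ * t / q ^ h / q ^ 2)
      * sitePoly (q ^ 2) (q ^ ρ) t (x₂ + 1) y * r1 + sitePoly (q ^ 2) (q ^ h) s (x + 1)
        (N₁ - (x + 1)) * (1 - s / q ^ h / q ^ 2) * r2)
  have jL : (1 - s / q ^ h) * (1 + q ^ h * (q ^ N₂ * t) / q ^ 2) * (dynLeft q h N₁ N₂ x₁ x₂
        * (sitePoly (q ^ 2) (q ^ (h - 2)) s (x₁ + 1) (N₁ - (x₁ + 1))
            * sitePoly (q ^ 2) (q ^ ρ) t (x₂ - 1) (N₂ - (x₂ - 1))))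
      = dynLeft q h N₁ N₂ x₁ x₂ * (sitePoly (q ^ 2) (q ^ h) s x₁ (N₁ - x₁)
          * sitePoly (q ^ 2) (q ^ ρ) t x₂ (N₂ - x₂))
        * ((1 + q ^ h * s / q ^ 2) * (1 - q ^ N₂ * t / q ^ h)) := by
    rcases Nat.eq_zero_or_pos x₂ with h0 | h0
    · rw [h0, dynLeft_zero_right]; ring
    rcases Nat.eq_or_lt_of_le hx₁ with h2 | h2
    · rw [h2, dynLeft_full_left]; ring
    obtain ⟨x, rfl⟩ : ∃ x, x₂ = x + 1 := ⟨x₂ - 1, by omega⟩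
    obtain ⟨y, hy⟩ : ∃ y, N₁ - x₁ = y + 1 := ⟨N₁ - x₁ - 1, by omega⟩
    have r1 := sitePoly_lower hQ (q ^ h) s x₁ y
    have r2 := sitePoly_move (q ^ 2) (q ^ ρ) t x (N₂ - (x + 1))
    have c1' : q ^ ρ * t * (q ^ 2) ^ x = q ^ h * (q ^ N₂ * t) / q ^ 2 := by
      rw [← c1, pow_succ]; field_simp; ring
    rw [c1', ey2, c2] at r2
    rw [Nat.add_sub_cancel, show N₂ - x = N₂ - (x + 1) + 1 by omega, hy,
      show N₁ - (x₁ + 1) = y by omega, hm2]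
    linear_combination dynLeft q h N₁ N₂ x₁ (x + 1) * ((1 + q ^ h * (q ^ N₂ * t) / q ^ 2)
      * sitePoly (q ^ 2) (q ^ ρ) t x (N₂ - (x + 1) + 1) * r1 - sitePoly (q ^ 2) (q ^ h) s x₁
        (y + 1) * (1 + q ^ h * s / q ^ 2) * r2)
  rw [c1, c2, c3, c4] at g2
  rw [dynRight_eq hq hq1, dynLeft_eq hq hq1] at *
  clear c1 c2 c3 c4 hp2 hm2 er ey1 ey2
  generalize sitePoly (q ^ 2) (q ^ (h + 2)) s (x₁ - 1) (N₁ - (x₁ - 1))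
            * sitePoly (q ^ 2) (q ^ ρ) t (x₂ + 1) (N₂ - (x₂ + 1)) = Jp at *
  generalize sitePoly (q ^ 2) (q ^ (h - 2)) s (x₁ + 1) (N₁ - (x₁ + 1))
            * sitePoly (q ^ 2) (q ^ ρ) t (x₂ - 1) (N₂ - (x₂ - 1)) = Jm at *
  generalize sitePoly (q ^ 2) (q ^ h) s x₁ (N₁ - x₁) = F at *
  generalize sitePoly (q ^ 2) (q ^ ρ) t x₂ (N₂ - x₂) = G at *
  generalize sitePoly (q ^ 2) (q ^ h) (q ^ 2 * s) x₁ (N₁ - x₁) = F' at *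
  generalize sitePoly (q ^ 2) (q ^ ρ) (t / q ^ 2) x₂ (N₂ - x₂) = G' at *
  have hT : q ^ N₂ * t ≠ 0 := mul_ne_zero hM2.ne' ht
  generalize q ^ N₂ * t = T at *
  have key := two_site_rational (q := q) (M1 := q ^ N₁) (M2 := q ^ N₂) (a1 := (q ^ 2) ^ x₁)
    (a2 := (q ^ 2) ^ x₂) (R := q ^ h) (s := s) (T := T) (r1 := F' / F) (r2 := G' / G)
    (jp := (1 - s / q ^ h / q ^ 2) * (1 + q ^ h * T) / ((1 + q ^ h * s) * (1 - T / q ^ h / q ^ 2)))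
    (jm := (1 + q ^ h * s / q ^ 2) * (1 - T / q ^ h) / ((1 - s / q ^ h) * (1 + q ^ h * T / q ^ 2)))
    hq hM1 hM2 ha1 ha2 hR hs hT rfl rfl rfl rfl n1 n2 n3 n4
    (by rw [← mul_div_assoc, g1, mul_div_cancel_left₀ _ hF])
    (by rw [← mul_div_assoc, g2, mul_div_cancel_left₀ _ hG])
    (mul_div_cancel₀ _ (mul_ne_zero n1 n3)) (mul_div_cancel₀ _ (mul_ne_zero n2 n4))
  have jR' := eq_div_of_mul_eq (mul_ne_zero n1 n3) ((mul_comm _ _).trans jR)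
  have jL' := eq_div_of_mul_eq (mul_ne_zero n2 n4) ((mul_comm _ _).trans jL)
  have k1 : F' = F * (F' / F) := by field_simp
  have k2 : G' = G * (G' / G) := by field_simp
  rw [k1, k2]
  generalize F' / F = r1 at *
  generalize G' / G = r2 at *
  linear_combination (F * G / (q - q⁻¹) ^ 2) * key - jR' - jL'

/-- Two-site duality between ASEP and dynamic ASEP with right boundary value `ρ`. -/
lemma two_site_duality {q : ℝ} (hq : 0 < q) (hq1 : q ≠ 1) {N₁ N₂ x₁ x₂ : ℕ} (hx₁ : x₁ ≤ N₁)
    (hx₂ : x₂ ≤ N₂) (ρ h : ℝ) (hh : h = ρ + (2 * x₂ - N₂)) {a b : ℕ} (ha : a ≤ N₁)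
    (hb : b ≤ N₂) :
    bondOp q N₁ N₂ (q ^ (((N₁ : ℝ) + N₂) / 2)) (fun n => kSite n x₁ h N₁ q)
        (fun n => kSite n x₂ ρ N₂ q) a b
    = dynRight q h N₁ N₂ x₁ x₂ * (kSite a (x₁ - 1) (h + 2) N₁ q * kSite b (x₂ + 1) ρ N₂ q
          - kSite a x₁ h N₁ q * kSite b x₂ ρ N₂ q)
      + dynLeft q h N₁ N₂ x₁ x₂ * (kSite a (x₁ + 1) (h - 2) N₁ q * kSite b (x₂ - 1) ρ N₂ q
          - kSite a x₁ h N₁ q * kSite b x₂ ρ N₂ q) := by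
  set D := q ^ (((N₁ : ℝ) + N₂) / 2) with hDdef
  have hD : D ^ 2 = q ^ N₁ * q ^ N₂ := by
    rw [hDdef, ← rpow_two_mul hq, mul_div_cancel₀ _ two_ne_zero, Real.rpow_add hq]
    simp
  have hDpos : 0 < D := Real.rpow_pos_of_pos hq _
  have hw : wSite a N₁ q * wSite b N₂ q ≠ 0 :=
    mul_ne_zero (wSite_pos hq hq1 ha).ne' (wSite_pos hq hq1 hb).ne'
  -- The nonzero weight is inserted so that summation over a and b produces generating functions.
  refine sub_eq_zero.1 (mul_left_cancel₀ hw (Eq.trans ?_ (mul_zero _).symm))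
  refine coeff_eq_zero_of_sum_pow_pow (N₁ := N₁) (N₂ := N₂) (d := fun a b =>
    wSite a N₁ q * wSite b N₂ q * (bondOp q N₁ N₂ D (fun n => kSite n x₁ h N₁ q)
        (fun n => kSite n x₂ ρ N₂ q) a b
    - (dynRight q h N₁ N₂ x₁ x₂ * (kSite a (x₁ - 1) (h + 2) N₁ q * kSite b (x₂ + 1) ρ N₂ q
          - kSite a x₁ h N₁ q * kSite b x₂ ρ N₂ q)
      + dynLeft q h N₁ N₂ x₁ x₂ * (kSite a (x₁ + 1) (h - 2) N₁ q * kSite b (x₂ - 1) ρ N₂ q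
          - kSite a x₁ h N₁ q * kSite b x₂ ρ N₂ q)))) ?_ ha hb
  set g₁ := q ^ ((1 - (N₁ : ℝ)) / 2) with hg₁
  set g₂ := q ^ ((1 - (N₂ : ℝ)) / 2) with hg₂
  have hg₁pos : 0 < g₁ := Real.rpow_pos_of_pos hq _
  have hg₂pos : 0 < g₂ := Real.rpow_pos_of_pos hq _
  -- The scales q^((1-N)/2) of the generating functions fit D: in the rescaled variables D⁻¹ s/t
  -- becomes s/T.
  have hg : g₁ * q ^ N₁ = D * g₂ := by
    rw [hg₁, hg₂, hDdef, ← Real.rpow_natCast q N₁, ← Real.rpow_add hq, ← Real.rpow_add hq]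
    congr 1
    ring
  filter_upwards [self_mem_nhdsWithin, eventually_sitePoly_ne_zero (q ^ 2) (q ^ h) g₁ x₁ (N₁ - x₁),
    eventually_one_sub_mul_ne_zero (-(q ^ h * g₁)),
    eventually_one_sub_mul_ne_zero (g₁ / q ^ h)] with s hs hF m1 m2
  filter_upwards [self_mem_nhdsWithin, eventually_sitePoly_ne_zero (q ^ 2) (q ^ ρ) g₂ x₂ (N₂ - x₂),
    eventually_one_sub_mul_ne_zero (q ^ N₂ * g₂ / q ^ h / q ^ 2),
    eventually_one_sub_mul_ne_zero (-(q ^ h * (q ^ N₂ * g₂) / q ^ 2))] with t ht hG m3 m4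
  have hs0 : s ≠ 0 := ne_of_gt hs
  have ht0 : t ≠ 0 := ne_of_gt ht
  have key := sitePoly_duality hq hq1 hx₁ hx₂ ρ h hh (s := g₁ * s) (t := g₂ * t)
    (mul_ne_zero hg₁pos.ne' hs0) (mul_ne_zero hg₂pos.ne' ht0) hF hG
    (by convert m1 using 1; ring) (by convert m2 using 1; ring)
    (by convert m3 using 1; ring) (by convert m4 using 1; ring)
  have hsum := sum_bondOp hq hq1 N₁ N₂ hD (fun n => kSite n x₁ h N₁ q)
    (fun n => kSite n x₂ ρ N₂ q) hs0 ht0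
  have hM1 := pow_pos hq N₁
  have hM2 := pow_pos hq N₂
  have e1 : D⁻¹ * (s / t) = g₁ * s / (q ^ N₂ * (g₂ * t)) := by
    field_simp
    apply mul_right_cancel₀ hM1.ne'
    linear_combination -hD * g₂ - D * hg
  have e2 : D * (t / s) = q ^ N₂ * (g₂ * t) / (g₁ * s) := by
    field_simp
    apply mul_right_cancel₀ hM1.ne'
    linear_combination hD * g₂ + D * hg
  simp only [siteGF_kSite hq hq1 hx₁, siteGF_kSite hq hq1 hx₂] at hsum
  rw [← hg₁, ← hg₂, show g₁ * (q ^ 2 * s) = q ^ 2 * (g₁ * s) by ring,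
    show g₂ * (t / q ^ 2) = g₂ * t / q ^ 2 by ring, e1, e2, key] at hsum
  have gf : ∀ (y₁ y₂ : ℕ) (h₁ h₂ : ℝ), y₁ ≤ N₁ → y₂ ≤ N₂ →
      ∑ a ∈ Finset.range (N₁ + 1), ∑ b ∈ Finset.range (N₂ + 1), wSite a N₁ q * wSite b N₂ q
        * (kSite a y₁ h₁ N₁ q * kSite b y₂ h₂ N₂ q) * (s ^ a * t ^ b)
      = sitePoly (q ^ 2) (q ^ h₁) (g₁ * s) y₁ (N₁ - y₁)
        * sitePoly (q ^ 2) (q ^ h₂) (g₂ * t) y₂ (N₂ - y₂) := by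
    intro y₁ y₂ h₁ h₂ hy₁ hy₂
    rw [← siteGF_kSite hq hq1 hy₁, ← siteGF_kSite hq hq1 hy₂, siteGF, siteGF, Finset.sum_mul_sum]
    refine Finset.sum_congr rfl fun a _ => Finset.sum_congr rfl fun b _ => ?_
    ring
  -- For x₂ = N₂ the generating function formula is not available at x₂ + 1; the zero rate covers
  -- this case.
  have tR : ∑ a ∈ Finset.range (N₁ + 1), ∑ b ∈ Finset.range (N₂ + 1), wSite a N₁ q * wSite b N₂ q
        * (dynRight q h N₁ N₂ x₁ x₂ * (kSite a (x₁ - 1) (h + 2) N₁ q * kSite b (x₂ + 1) ρ N₂ q))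
        * (s ^ a * t ^ b) = dynRight q h N₁ N₂ x₁ x₂
        * (sitePoly (q ^ 2) (q ^ (h + 2)) (g₁ * s) (x₁ - 1) (N₁ - (x₁ - 1))
          * sitePoly (q ^ 2) (q ^ ρ) (g₂ * t) (x₂ + 1) (N₂ - (x₂ + 1))) := by
    rcases Nat.eq_or_lt_of_le hx₂ with h2 | h2
    · simp [h2, dynRight_full_right]
    rw [← gf _ _ _ _ (by omega) h2, Finset.mul_sum]
    refine Finset.sum_congr rfl fun a _ => ?_
    rw [Finset.mul_sum]
    exact Finset.sum_congr rfl fun b _ => by ring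
  have tL : ∑ a ∈ Finset.range (N₁ + 1), ∑ b ∈ Finset.range (N₂ + 1), wSite a N₁ q * wSite b N₂ q
        * (dynLeft q h N₁ N₂ x₁ x₂ * (kSite a (x₁ + 1) (h - 2) N₁ q * kSite b (x₂ - 1) ρ N₂ q))
        * (s ^ a * t ^ b) = dynLeft q h N₁ N₂ x₁ x₂
        * (sitePoly (q ^ 2) (q ^ (h - 2)) (g₁ * s) (x₁ + 1) (N₁ - (x₁ + 1))
          * sitePoly (q ^ 2) (q ^ ρ) (g₂ * t) (x₂ - 1) (N₂ - (x₂ - 1))) := by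
    rcases Nat.eq_or_lt_of_le hx₁ with h2 | h2
    · simp [h2, dynLeft_full_left]
    rw [← gf _ _ _ _ h2 (by omega), Finset.mul_sum]
    refine Finset.sum_congr rfl fun a _ => ?_
    rw [Finset.mul_sum]
    exact Finset.sum_congr rfl fun b _ => by ring
  rw [mul_sub, mul_sub, ← tR, ← tL, ← gf _ _ _ _ hx₁ hx₂, ← sub_eq_zero] at hsum
  rw [← hsum]
  simp only [Finset.mul_sum, ← Finset.sum_sub_distrib, ← Finset.sum_add_distrib]
  refine Finset.sum_congr rfl fun a _ => Finset.sum_congr rfl fun b _ => ?_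
  ring

/-! ### Jumps of configurations -/

section Jump

variable {m : ℕ} {N : Fin (m + 1) → ℕ}

lemma config_le (η : Config N) (i : Fin (m + 1)) : (η i : ℕ) ≤ N i := Nat.lt_succ_iff.1 (η i).isLt

lemma jump_val {η : Config N} {i j : Fin (m + 1)} (h : 0 < (η i : ℕ) ∧ (η j : ℕ) < N j)
    (l : Fin (m + 1)) :
    ((jump η i j l : Fin (N l + 1)) : ℕ)
      = if l = j then (η j : ℕ) + 1 else if l = i then (η i : ℕ) - 1 else η l := by
  rw [jump, dif_pos h]
  by_cases h1 : l = j
  · subst h1; simp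
  · rw [Function.update_of_ne h1, if_neg h1]
    by_cases h2 : l = i
    · subst h2; simp
    · rw [Function.update_of_ne h2, if_neg h2]

lemma jump_val_source {η : Config N} {i j : Fin (m + 1)} (hij : i ≠ j)
    (h : 0 < (η i : ℕ) ∧ (η j : ℕ) < N j) : ((jump η i j i : Fin (N i + 1)) : ℕ) = (η i : ℕ) - 1 := by
  rw [jump_val h, if_neg hij, if_pos rfl]

lemma jump_val_target {η : Config N} {i j : Fin (m + 1)}
    (h : 0 < (η i : ℕ) ∧ (η j : ℕ) < N j) : ((jump η i j j : Fin (N j + 1)) : ℕ) = (η j : ℕ) + 1 := by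
  rw [jump_val h, if_pos rfl]

lemma jump_val_of_ne {η : Config N} {i j l : Fin (m + 1)} (hi : l ≠ i) (hj : l ≠ j) :
    jump η i j l = η l := by
  rw [jump]
  split_ifs
  · rw [Function.update_of_ne hj, Function.update_of_ne hi]
  · rfl

lemma jump_allowed_back {η : Config N} {i j : Fin (m + 1)} (hij : i ≠ j)
    (h : 0 < (η i : ℕ) ∧ (η j : ℕ) < N j) :
    0 < (jump η i j j : ℕ) ∧ (jump η i j i : ℕ) < N i := by
  rw [jump_val_target h, jump_val_source hij h]
  have := config_le η i
  omega

lemma jump_jump {η : Config N} {i j : Fin (m + 1)} (hij : i ≠ j)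
    (h : 0 < (η i : ℕ) ∧ (η j : ℕ) < N j) : jump (jump η i j) j i = η := by
  funext l
  apply Fin.ext
  have hb := jump_allowed_back hij h
  rw [jump_val hb, jump_val_target h, jump_val_source hij h]
  by_cases h1 : l = i
  · subst h1; rw [if_pos rfl]; omega
  · rw [if_neg h1]
    by_cases h2 : l = j
    · subst h2; rw [if_pos rfl]; omega
    · rw [if_neg h2, jump_val_of_ne h1 h2]

/-- Particle number, heights and the exponent u are all affine in the occupation numbers, so this
computation settles their behaviour under jumps. -/
lemma sum_mul_jump {η : Config N} {i j : Fin (m + 1)} (hij : i ≠ j)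
    (h : 0 < (η i : ℕ) ∧ (η j : ℕ) < N j) (φ : Fin (m + 1) → ℝ) :
    ∑ l, φ l * ((jump η i j l : ℕ) : ℝ) = ∑ l, φ l * ((η l : ℕ) : ℝ) + φ j - φ i := by
  have key : ∀ l, φ l * ((jump η i j l : ℕ) : ℝ) = φ l * ((η l : ℕ) : ℝ)
      + (if l = j then φ j else 0) - (if l = i then φ i else 0) := by
    intro l
    by_cases h1 : l = j
    · subst h1
      rw [jump_val_target h, if_pos rfl, if_neg hij.symm]
      push_cast; ring
    · by_cases h2 : l = i
      · subst h2
        rw [jump_val_source hij h, if_neg hij, if_pos rfl, Nat.cast_sub h.1]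
        push_cast; ring
      · rw [jump_val_of_ne h2 h1, if_neg h1, if_neg h2]; ring
  rw [Finset.sum_congr rfl fun l _ => key l, Finset.sum_sub_distrib, Finset.sum_add_distrib]
  simp

lemma total_jump {η : Config N} {i j : Fin (m + 1)} (hij : i ≠ j)
    (h : 0 < (η i : ℕ) ∧ (η j : ℕ) < N j) : total (jump η i j) = total η := by
  have := sum_mul_jump hij h (fun _ => 1)
  simp only [one_mul, add_sub_cancel_right] at this
  unfold total
  exact_mod_cast this

lemma hPlus_eq (ρ : ℝ) (ξ : Config N) (k : ℕ) : hPlus ρ ξ k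
    = ∑ l : Fin (m + 1), (if k ≤ (l : ℕ) + 1 then 2 else 0) * ((ξ l : ℕ) : ℝ)
      + (ρ - ∑ l : Fin (m + 1), if k ≤ (l : ℕ) + 1 then (N l : ℝ) else 0) := by
  rw [hPlus, add_sub_left_comm, ← Finset.sum_sub_distrib]
  congr 1
  refine Finset.sum_congr rfl fun l _ => ?_
  split_ifs <;> ring

lemma hMinus_eq (lam : ℝ) (ζ : Config N) (k : ℕ) : hMinus lam ζ k
    = ∑ l : Fin (m + 1), (if (l : ℕ) + 1 ≤ k then 2 else 0) * ((ζ l : ℕ) : ℝ)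
      + (lam - ∑ l : Fin (m + 1), if (l : ℕ) + 1 ≤ k then (N l : ℝ) else 0) := by
  rw [hMinus, add_sub_left_comm, ← Finset.sum_sub_distrib]
  congr 1
  refine Finset.sum_congr rfl fun l _ => ?_
  split_ifs <;> ring

lemma hPlus_jump (ρ : ℝ) {ξ : Config N} {i j : Fin (m + 1)} (hij : i ≠ j)
    (h : 0 < (ξ i : ℕ) ∧ (ξ j : ℕ) < N j) (k : ℕ) : hPlus ρ (jump ξ i j) k
    = hPlus ρ ξ k + (if k ≤ (j : ℕ) + 1 then 2 else 0) - (if k ≤ (i : ℕ) + 1 then 2 else 0) := by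
  rw [hPlus_eq, hPlus_eq, sum_mul_jump hij h]
  ring

lemma hMinus_jump (lam : ℝ) {ζ : Config N} {i j : Fin (m + 1)} (hij : i ≠ j)
    (h : 0 < (ζ i : ℕ) ∧ (ζ j : ℕ) < N j) (k : ℕ) : hMinus lam (jump ζ i j) k
    = hMinus lam ζ k + (if (j : ℕ) + 1 ≤ k then 2 else 0) - (if (i : ℕ) + 1 ≤ k then 2 else 0) := by
  rw [hMinus_eq, hMinus_eq, sum_mul_jump hij h]
  ring

lemma hPlus_succ (ρ : ℝ) (ξ : Config N) (i : Fin (m + 1)) :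
    hPlus ρ ξ ((i : ℕ) + 1) = hPlus ρ ξ ((i : ℕ) + 2) + (2 * ((ξ i : ℕ) : ℝ) - N i) := by
  rw [hPlus, hPlus, add_assoc]
  congr 1
  have : ∀ l : Fin (m + 1), (if (i : ℕ) + 1 ≤ (l : ℕ) + 1 then 2 * ((ξ l : ℕ) : ℝ) - N l else 0)
      = (if (i : ℕ) + 2 ≤ (l : ℕ) + 1 then 2 * ((ξ l : ℕ) : ℝ) - N l else 0)
        + if l = i then 2 * ((ξ i : ℕ) : ℝ) - N i else 0 := by
    intro l
    by_cases h1 : l = i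
    · subst h1; simp
    · have : (l : ℕ) ≠ i := fun h => h1 (Fin.ext h)
      rw [if_neg h1, add_zero]
      congr 1
      simp only [eq_iff_iff]; omega
  rw [Finset.sum_congr rfl fun l _ => this l, Finset.sum_add_distrib]
  simp

lemma hMinus_succ (lam : ℝ) (ζ : Config N) (i : Fin (m + 1)) :
    hMinus lam ζ ((i : ℕ) + 1) = hMinus lam ζ i + (2 * ((ζ i : ℕ) : ℝ) - N i) := by
  rw [hMinus, hMinus, add_assoc]
  congr 1
  have : ∀ l : Fin (m + 1), (if (l : ℕ) + 1 ≤ (i : ℕ) + 1 then 2 * ((ζ l : ℕ) : ℝ) - N l else 0)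
      = (if (l : ℕ) + 1 ≤ (i : ℕ) then 2 * ((ζ l : ℕ) : ℝ) - N l else 0)
        + if l = i then 2 * ((ζ i : ℕ) : ℝ) - N i else 0 := by
    intro l
    by_cases h1 : l = i
    · subst h1; simp
    · have : (l : ℕ) ≠ i := fun h => h1 (Fin.ext h)
      rw [if_neg h1, add_zero]
      congr 1
      simp only [eq_iff_iff]; omega
  rw [Finset.sum_congr rfl fun l _ => this l, Finset.sum_add_distrib]
  simp

lemma castSucc_ne_succ (b : Fin m) : b.castSucc ≠ b.succ := by
  intro h
  have := congrArg Fin.val h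
  simp at this

/-- The coefficient of `η_l` in the exponent `u(η)`. -/
def uCoeff (N : Fin (m + 1) → ℕ) (l : Fin (m + 1)) : ℝ :=
  N l - 2 * ∑ j : Fin (m + 1), if j ≤ l then (N j : ℝ) else 0

lemma uExp_eq (η : Config N) : uExp η = ∑ l, uCoeff N l * ((η l : ℕ) : ℝ) := by
  rw [uExp]
  refine Finset.sum_congr rfl fun l _ => ?_
  rw [uCoeff]; ring

/-- This step makes a jump over the bond change q^u by the factor q^(±(N_k + N_(k+1))) that
`rate_balance` requires, and q^(-u/2) by the D^(±1) of `bondOp`. -/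
lemma uCoeff_succ_sub (N : Fin (m + 1) → ℕ) (b : Fin m) :
    uCoeff N b.succ = uCoeff N b.castSucc - ((N b.castSucc : ℝ) + N b.succ) := by
  have : ∀ l : Fin (m + 1), (if l ≤ b.succ then (N l : ℝ) else 0)
      = (if l ≤ b.castSucc then (N l : ℝ) else 0) + if l = b.succ then (N b.succ : ℝ) else 0 := by
    intro l
    by_cases h1 : l = b.succ
    · subst h1
      have : ¬ b.succ ≤ b.castSucc := by simp [Fin.le_def]
      simp [this]
    · have h2 : (l : ℕ) ≠ (b : ℕ) + 1 := fun h => h1 (Fin.ext (by simpa using h))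
      rw [if_neg h1, add_zero]
      congr 1
      simp only [eq_iff_iff, Fin.le_def, Fin.val_succ, Fin.val_castSucc]; omega
  rw [uCoeff, uCoeff, Finset.sum_congr rfl fun l _ => this l, Finset.sum_add_distrib]
  simp only [Finset.sum_ite_eq', Finset.mem_univ, if_true]
  ring

lemma uExp_jump_right {η : Config N} {b : Fin m}
    (h : 0 < (η b.castSucc : ℕ) ∧ (η b.succ : ℕ) < N b.succ) :
    uExp (jump η b.castSucc b.succ) = uExp η - ((N b.castSucc : ℝ) + N b.succ) := by
  rw [uExp_eq, uExp_eq, sum_mul_jump (castSucc_ne_succ b) h, uCoeff_succ_sub]; ring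

lemma uExp_jump_left {η : Config N} {b : Fin m}
    (h : 0 < (η b.succ : ℕ) ∧ (η b.castSucc : ℕ) < N b.castSucc) :
    uExp (jump η b.succ b.castSucc) = uExp η + ((N b.castSucc : ℝ) + N b.succ) := by
  rw [uExp_eq, uExp_eq, sum_mul_jump (castSucc_ne_succ b).symm h, uCoeff_succ_sub]; ring

/-! ### Reversibility -/

lemma prod_eq_mul_mul_prod {i j : Fin (m + 1)} (hij : i ≠ j) (F : Fin (m + 1) → ℝ) :
    ∏ l, F l = F i * F j * ∏ l ∈ (Finset.univ.erase i).erase j, F l := by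
  rw [← Finset.mul_prod_erase _ F (Finset.mem_univ i),
    ← Finset.mul_prod_erase _ F (Finset.mem_erase.2 ⟨hij.symm, Finset.mem_univ j⟩), mul_assoc]

/-- The reversible measure `w(η) (-v)^|η|`. -/
def revWeight (q v : ℝ) (η : Config N) : ℝ := wConfig q η * (-v) ^ total η

lemma cPlus_eq (q : ℝ) (η : Config N) (i j : Fin (m + 1)) :
    cPlus q η i j = rateRight q (N i) (N j) (η i) (η j) := rfl

lemma cMinus_eq (q : ℝ) (η : Config N) (i j : Fin (m + 1)) :
    cMinus q η j i = rateLeft q (N i) (N j) (η i) (η j) := rfl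

lemma rateRight_ne_zero {q : ℝ} {N₁ N₂ a b : ℕ} (hb : b ≤ N₂)
    (h : rateRight q N₁ N₂ a b ≠ 0) : 0 < a ∧ b < N₂ := by
  constructor
  · rcases Nat.eq_zero_or_pos a with rfl | h1
    · exact absurd (rateRight_zero_left ..) h
    · exact h1
  · rcases Nat.eq_or_lt_of_le hb with rfl | h1
    · exact absurd (rateRight_full_right ..) h
    · exact h1

lemma rateLeft_ne_zero {q : ℝ} {N₁ N₂ a b : ℕ} (ha : a ≤ N₁)
    (h : rateLeft q N₁ N₂ a b ≠ 0) : 0 < b ∧ a < N₁ := by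
  constructor
  · rcases Nat.eq_zero_or_pos b with rfl | h1
    · exact absurd (rateLeft_zero_right ..) h
    · exact h1
  · rcases Nat.eq_or_lt_of_le ha with rfl | h1
    · exact absurd (rateLeft_full_left ..) h
    · exact h1

/-- The change of q^u compensates the power of q in `rate_balance`, and (-v)^|η| is inert because
jumps conserve particles. This is why a free parameter v is available. -/
lemma detailed_balance {q : ℝ} (hq : 0 < q) (hq1 : q ≠ 1) (v : ℝ) {η : Config N} {b : Fin m}
    (h : 0 < (η b.castSucc : ℕ) ∧ (η b.succ : ℕ) < N b.succ) :
    revWeight q v η * cPlus q η b.castSucc b.succ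
      = revWeight q v (jump η b.castSucc b.succ)
        * cMinus q (jump η b.castSucc b.succ) b.succ b.castSucc := by
  have hij := castSucc_ne_succ b
  have hle := config_le η b.castSucc
  have hprod : ∏ l ∈ (Finset.univ.erase b.castSucc).erase b.succ,
      wSite (jump η b.castSucc b.succ l) (N l) q
      = ∏ l ∈ (Finset.univ.erase b.castSucc).erase b.succ, wSite (η l) (N l) q := by
    refine Finset.prod_congr rfl fun l hl => ?_
    rw [Finset.mem_erase, Finset.mem_erase] at hl
    rw [jump_val_of_ne hl.2.1 hl.1]
  rw [revWeight, revWeight, wConfig, wConfig, total_jump hij h, uExp_jump_right h,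
    prod_eq_mul_mul_prod hij (fun l => wSite (η l) (N l) q),
    prod_eq_mul_mul_prod hij (fun l => wSite (jump η b.castSucc b.succ l) (N l) q),
    hprod, cPlus_eq, cMinus_eq, jump_val_target h, jump_val_source hij h, Real.rpow_sub hq,
    Real.rpow_add hq, Real.rpow_natCast, Real.rpow_natCast]
  have hb := rate_balance hq hq1 (N₁ := N b.castSucc) (N₂ := N b.succ)
    (a := (η b.castSucc : ℕ) - 1) (b := η b.succ) (by omega) h.2
  rw [Nat.sub_add_cancel h.1] at hb
  have h1 := pow_pos hq (N b.castSucc)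
  have h2 := pow_pos hq (N b.succ)
  rw [mul_comm, ← eq_div_iff (by positivity)] at hb
  linear_combination (q ^ uExp η * (∏ l ∈ (Finset.univ.erase b.castSucc).erase b.succ,
    wSite (η l) (N l) q) * (-v) ^ total η) * hb

/-- Allowed jumps to the right and to the left over b are inverse bijections, so this is detailed
balance after a change of variables. Where the jump is not allowed, the rate is zero. -/
lemma sum_cPlus_eq_sum_cMinus {q : ℝ} (hq : 0 < q) (hq1 : q ≠ 1) (v : ℝ) (b : Fin m)
    (f g : Config N → ℝ) :
    ∑ η, revWeight q v η * cPlus q η b.castSucc b.succ * (f (jump η b.castSucc b.succ) * g η)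
      = ∑ η, revWeight q v η * cMinus q η b.succ b.castSucc
        * (f η * g (jump η b.succ b.castSucc)) := by
  classical
  have hij := castSucc_ne_succ b
  rw [← Finset.sum_filter_of_ne (p := fun η : Config N =>
      0 < (η b.castSucc : ℕ) ∧ (η b.succ : ℕ) < N b.succ),
    ← Finset.sum_filter_of_ne (s := Finset.univ) (f := fun η : Config N =>
        revWeight q v η * cMinus q η b.succ b.castSucc * (f η * g (jump η b.succ b.castSucc)))
      (p := fun η : Config N => 0 < (η b.succ : ℕ) ∧ (η b.castSucc : ℕ) < N b.castSucc)]
  · refine Finset.sum_nbij' (fun η => jump η b.castSucc b.succ)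
      (fun η => jump η b.succ b.castSucc) ?_ ?_ ?_ ?_ ?_
    · intro η hη
      rw [Finset.mem_filter] at hη ⊢
      exact ⟨Finset.mem_univ _, jump_allowed_back hij hη.2⟩
    · intro η hη
      rw [Finset.mem_filter] at hη ⊢
      exact ⟨Finset.mem_univ _, jump_allowed_back hij.symm hη.2⟩
    · intro η hη
      exact jump_jump hij (Finset.mem_filter.1 hη).2
    · intro η hη
      exact jump_jump hij.symm (Finset.mem_filter.1 hη).2
    · intro η hη
      rw [detailed_balance hq hq1 v (Finset.mem_filter.1 hη).2,
        jump_jump hij (Finset.mem_filter.1 hη).2]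
  · intro η _ h
    have hc : rateLeft q (N b.castSucc) (N b.succ) (η b.castSucc) (η b.succ) ≠ 0 := by
      rw [← cMinus_eq]
      intro h0
      exact h (by rw [h0]; ring)
    exact rateLeft_ne_zero (config_le η _) hc
  · intro η _ h
    have hc : rateRight q (N b.castSucc) (N b.succ) (η b.castSucc) (η b.succ) ≠ 0 := by
      rw [← cPlus_eq]
      intro h0
      exact h (by rw [h0]; ring)
    exact rateRight_ne_zero (config_le η _) hc

/-- The part of the ASEP generator belonging to one bond. -/
def aspBond (q : ℝ) (b : Fin m) (f : Config N → ℝ) (η : Config N) : ℝ :=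
  cPlus q η b.castSucc b.succ * (f (jump η b.castSucc b.succ) - f η)
    + cMinus q η b.succ b.castSucc * (f (jump η b.succ b.castSucc) - f η)

/-- The jump terms are exchanged by detailed balance and the diagonal terms are already symmetric.
Positivity of the weight is not needed, so v may have either sign. -/
lemma aspBond_symm {q : ℝ} (hq : 0 < q) (hq1 : q ≠ 1) (v : ℝ) (b : Fin m) (f g : Config N → ℝ) :
    ∑ η, revWeight q v η * (aspBond q b f η * g η)
      = ∑ η, revWeight q v η * (f η * aspBond q b g η) := by
  have h1 := sum_cPlus_eq_sum_cMinus hq hq1 v b f g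
  have h2 := sum_cPlus_eq_sum_cMinus hq hq1 v b g f
  rw [← sub_eq_zero] at h1 h2 ⊢
  rw [← Finset.sum_sub_distrib] at h1 h2 ⊢
  -- The difference of the two sides is the difference of the exchange identities for (f, g) and (g,
  -- f).
  rw [← sub_zero (0 : ℝ)]
  nth_rewrite 1 [← h1]
  rw [← h2, ← Finset.sum_sub_distrib]
  refine Finset.sum_congr rfl fun η _ => ?_
  rw [aspBond, aspBond]
  ring

/-! ### Duality of one bond -/

/-- Common form of `K_R` and `K_L`. -/
def dualFun (q p : ℝ) (H : Config N → Fin (m + 1) → ℝ) (η ξ : Config N) : ℝ :=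
  q ^ (-(1 / 2) * uExp η) * ∏ l, kSite (η l) (ξ l) (H ξ l) (N l) p

/-- Splits off the two sites of a bond; `hH` expresses that the height parameters at all other sites
are unaffected. -/
lemma dualFun_eq (q p : ℝ) (H : Config N → Fin (m + 1) → ℝ) (η ξ η' ξ' : Config N)
    {i j : Fin (m + 1)} (hij : i ≠ j) (hη : ∀ l, l ≠ i → l ≠ j → η' l = η l)
    (hξ : ∀ l, l ≠ i → l ≠ j → ξ' l = ξ l) (hH : ∀ l, l ≠ i → l ≠ j → H ξ' l = H ξ l) :
    dualFun q p H η' ξ' = q ^ (-(1 / 2) * uExp η')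
      * (kSite (η' i) (ξ' i) (H ξ' i) (N i) p * kSite (η' j) (ξ' j) (H ξ' j) (N j) p)
      * ∏ l ∈ (Finset.univ.erase i).erase j, kSite (η l) (ξ l) (H ξ l) (N l) p := by
  rw [dualFun, prod_eq_mul_mul_prod hij, ← mul_assoc]
  congr 1
  refine Finset.prod_congr rfl fun l hl => ?_
  rw [Finset.mem_erase, Finset.mem_erase] at hl
  rw [hη l hl.2.1 hl.1, hξ l hl.2.1 hl.1, hH l hl.2.1 hl.1]

/-- The prefactor q^(-u/2) supplies exactly the D and D⁻¹ of `bondOp`. For impossible jumps both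
sides have rate zero. -/
lemma aspBond_dualFun {q : ℝ} (hq : 0 < q) (p : ℝ) (H : Config N → Fin (m + 1) → ℝ)
    (b : Fin m) (η ξ : Config N) :
    aspBond q b (fun η => dualFun q p H η ξ) η
      = bondOp q (N b.castSucc) (N b.succ) (q ^ (((N b.castSucc : ℝ) + N b.succ) / 2))
          (fun n => kSite n (ξ b.castSucc) (H ξ b.castSucc) (N b.castSucc) p)
          (fun n => kSite n (ξ b.succ) (H ξ b.succ) (N b.succ) p) (η b.castSucc) (η b.succ)
        * (q ^ (-(1 / 2) * uExp η) * ∏ l ∈ (Finset.univ.erase b.castSucc).erase b.succ,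
          kSite (η l) (ξ l) (H ξ l) (N l) p) := by
  have hij := castSucc_ne_succ b
  have e := fun η' hη => dualFun_eq q p H η ξ η' ξ hij hη (fun _ _ _ => rfl) (fun _ _ _ => rfl)
  rw [aspBond, bondOp, add_mul]
  congr 1
  · rw [cPlus_eq]
    by_cases h : 0 < (η b.castSucc : ℕ) ∧ (η b.succ : ℕ) < N b.succ
    · rw [e _ fun l h1 h2 => jump_val_of_ne h1 h2, e η fun _ _ _ => rfl, jump_val_target h,
        jump_val_source hij h, uExp_jump_right h,
        show -(1 / 2) * (uExp η - ((N b.castSucc : ℝ) + N b.succ))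
          = -(1 / 2) * uExp η + ((N b.castSucc : ℝ) + N b.succ) / 2 by ring, Real.rpow_add hq]
      ring
    · have h0 : rateRight q (N b.castSucc) (N b.succ) (η b.castSucc) (η b.succ) = 0 := by
        by_contra h0
        exact h (rateRight_ne_zero (config_le η _) h0)
      rw [h0]; ring
  · rw [cMinus_eq]
    by_cases h : 0 < (η b.succ : ℕ) ∧ (η b.castSucc : ℕ) < N b.castSucc
    · rw [e _ fun l h1 h2 => jump_val_of_ne h2 h1, e η fun _ _ _ => rfl, jump_val_target h,
        jump_val_source hij.symm h, uExp_jump_left h,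
        show -(1 / 2) * (uExp η + ((N b.castSucc : ℝ) + N b.succ))
          = -(1 / 2) * uExp η + -(((N b.castSucc : ℝ) + N b.succ) / 2) by ring, Real.rpow_add hq,
        Real.rpow_neg hq.le (((N b.castSucc : ℝ) + N b.succ) / 2)]
      ring
    · have h0 : rateLeft q (N b.castSucc) (N b.succ) (η b.castSucc) (η b.succ) = 0 := by
        by_contra h0
        exact h (rateLeft_ne_zero (config_le η _) h0)
      rw [h0]; ring

/-! ### The dynamic rates in two-site form, and the mirror symmetry -/

lemma CRPlus_eq (q ρ : ℝ) (ξ : Config N) (b : Fin m) :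
    CRPlus q ρ ξ b.castSucc b.succ = dynRight q (hPlus ρ ξ ((b.castSucc : ℕ) + 2)) (N b.castSucc)
      (N b.succ) (ξ b.castSucc) (ξ b.succ) := by
  simp only [CRPlus, dynRight]
  rw [hPlus_succ, cPlus_eq]

lemma CRMinus_eq (q ρ : ℝ) (ξ : Config N) (b : Fin m) :
    CRMinus q ρ ξ b.succ b.castSucc = dynLeft q (hPlus ρ ξ ((b.castSucc : ℕ) + 2)) (N b.castSucc)
      (N b.succ) (ξ b.castSucc) (ξ b.succ) := by
  have h := hPlus_succ ρ ξ b.succ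
  have e : hPlus ρ ξ ((b.castSucc : ℕ) + 2) = hPlus ρ ξ ((b.succ : ℕ) + 1) := by
    simp
  simp only [CRMinus, dynLeft]
  rw [cMinus_eq, e, show hPlus ρ ξ ((b.succ : ℕ) + 1) - (2 * ((ξ b.succ : ℕ) : ℝ) - N b.succ)
    = hPlus ρ ξ ((b.succ : ℕ) + 1 + 1) by rw [h]; ring]

lemma rpow_inv_base {q : ℝ} (hq : 0 < q) (x : ℝ) : q⁻¹ ^ x = q ^ (-x) := by
  rw [Real.inv_rpow hq.le, Real.rpow_neg hq.le]

lemma qNum_inv (q a : ℝ) (hq : 0 < q) : qNum q⁻¹ a = qNum q a := by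
  rw [qNum, qNum]
  by_cases h : q = 1
  · simp [h]
  · rw [if_neg h, if_neg (by simpa using h), rpow_inv_base hq, rpow_inv_base hq, neg_neg, inv_inv,
      ← neg_sub (q ^ a), ← neg_sub q q⁻¹, neg_div_neg_eq]

lemma rateRight_inv {q : ℝ} (hq : 0 < q) (N₁ N₂ a b : ℕ) :
    rateRight q⁻¹ N₂ N₁ b a = rateLeft q N₁ N₂ a b := by
  rw [rateRight, rateLeft, qNum_inv _ _ hq, qNum_inv _ _ hq, rpow_inv_base hq, neg_neg]

lemma rateLeft_inv {q : ℝ} (hq : 0 < q) (N₁ N₂ a b : ℕ) :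
    rateLeft q⁻¹ N₂ N₁ b a = rateRight q N₁ N₂ a b := by
  rw [rateRight, rateLeft, qNum_inv _ _ hq, qNum_inv _ _ hq, rpow_inv_base hq]

/-- Inverting q exchanges the left and right rates, so reading the bond backwards restores the
operator. This mirror symmetry derives K_L from K_R. -/
lemma bondOp_inv {q : ℝ} (hq : 0 < q) (N₁ N₂ : ℕ) (D : ℝ) (f g : ℕ → ℝ) (a b : ℕ) :
    bondOp q⁻¹ N₂ N₁ D⁻¹ g f b a = bondOp q N₁ N₂ D f g a b := by
  rw [bondOp, bondOp, rateRight_inv hq, rateLeft_inv hq, inv_inv]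
  ring

/-- Mirror image of `CRMinus_eq`: h⁻ accumulates from the left as h⁺ does from the right, and q⁻¹
reverses the signs of the exponents. -/
lemma CLPlus_eq {q : ℝ} (hq : 0 < q) (lam : ℝ) (ζ : Config N) (b : Fin m) :
    CLPlus q lam ζ b.castSucc b.succ = dynLeft q⁻¹ (hMinus lam ζ (b.succ : ℕ)) (N b.succ)
      (N b.castSucc) (ζ b.succ) (ζ b.castSucc) := by
  have h := hMinus_succ lam ζ b.castSucc
  have e : (b.castSucc : ℕ) + 1 = (b.succ : ℕ) := by simp
  rw [e] at h
  simp only [CLPlus, dynLeft]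
  rw [rateLeft_inv hq, cPlus_eq, Nat.add_sub_cancel, e, show hMinus lam ζ (b.succ : ℕ)
    - (2 * ((ζ b.castSucc : ℕ) : ℝ) - N b.castSucc) = hMinus lam ζ (b.castSucc : ℕ) by rw [h]; ring,
    rpow_inv_base hq, rpow_inv_base hq, rpow_inv_base hq, rpow_inv_base hq]
  congr 2
  · rw [mul_comm]
    congr 3 <;> ring
  · congr 3 <;> ring

lemma CLMinus_eq {q : ℝ} (hq : 0 < q) (lam : ℝ) (ζ : Config N) (b : Fin m) :
    CLMinus q lam ζ b.succ b.castSucc = dynRight q⁻¹ (hMinus lam ζ (b.succ : ℕ)) (N b.succ)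
      (N b.castSucc) (ζ b.succ) (ζ b.castSucc) := by
  have h := hMinus_succ lam ζ b.succ
  simp only [CLMinus, dynRight]
  rw [rateRight_inv hq, cMinus_eq, Nat.add_sub_cancel, h,
    rpow_inv_base hq, rpow_inv_base hq, rpow_inv_base hq, rpow_inv_base hq]
  congr 2
  · rw [mul_comm]
    congr 3 <;> ring
  · congr 3 <;> ring

/-- Of the height parameters in K_R, a jump between sites k and k + 1 changes only h⁺_(k+1),
attached to site k: the other sums contain both sites or neither. The remaining factors are
therefore spectators of the two-site duality. -/
lemma KR_duality {q : ℝ} (hq : 0 < q) (hq1 : q ≠ 1) (ρ : ℝ) (b : Fin m) (η ξ : Config N) :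
    aspBond q b (fun η => KR q ρ η ξ) η
      = CRPlus q ρ ξ b.castSucc b.succ * (KR q ρ η (jump ξ b.castSucc b.succ) - KR q ρ η ξ)
        + CRMinus q ρ ξ b.succ b.castSucc
          * (KR q ρ η (jump ξ b.succ b.castSucc) - KR q ρ η ξ) := by
  have hij := castSucc_ne_succ b
  set H : Config N → Fin (m + 1) → ℝ := fun ξ l => hPlus ρ ξ ((l : ℕ) + 2) with hHdef
  have hH : ∀ l, H ξ l = hPlus ρ ξ ((l : ℕ) + 2) := fun _ => rfl
  have hKR : ∀ η ξ : Config N, KR q ρ η ξ = dualFun q q H η ξ := fun _ _ => rfl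
  have hb1 : ((b.castSucc : Fin (m + 1)) : ℕ) = b := rfl
  have hb2 : ((b.succ : Fin (m + 1)) : ℕ) = b + 1 := rfl
  have e := fun ξ' hξ hH => dualFun_eq q q H η ξ η ξ' hij (fun _ _ _ => rfl) hξ hH
  have hs := hPlus_succ ρ ξ b.succ
  have key := two_site_duality hq hq1 (config_le ξ b.castSucc) (config_le ξ b.succ)
    (hPlus ρ ξ ((b.succ : ℕ) + 2)) (hPlus ρ ξ ((b.castSucc : ℕ) + 2)) hs
    (config_le η b.castSucc) (config_le η b.succ)
  simp only [hKR]
  rw [aspBond_dualFun hq, hH, hH, key, CRPlus_eq, CRMinus_eq, add_mul]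
  congr 1
  · by_cases h : 0 < (ξ b.castSucc : ℕ) ∧ (ξ b.succ : ℕ) < N b.succ
    · rw [e (jump ξ b.castSucc b.succ) (fun l h1 h2 => jump_val_of_ne h1 h2), e ξ (fun _ _ _ => rfl)
        (fun _ _ _ => rfl), jump_val_target h, jump_val_source hij h]
      · have h1 : H (jump ξ b.castSucc b.succ) b.castSucc
            = hPlus ρ ξ ((b.castSucc : ℕ) + 2) + 2 := by
          rw [hHdef]
          simp only
          rw [hPlus_jump ρ hij h, hb1, hb2, if_pos (by omega), if_neg (by omega)]
          ring
        have h2 : H (jump ξ b.castSucc b.succ) b.succ = hPlus ρ ξ ((b.succ : ℕ) + 2) := by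
          rw [hHdef]
          simp only
          rw [hPlus_jump ρ hij h, hb1, hb2, if_neg (by omega), if_neg (by omega)]
          ring
        rw [h1, h2, hH, hH]
        ring
      · intro l h1 h2
        have h1' : (l : ℕ) ≠ b := fun h => h1 (Fin.ext h)
        have h2' : (l : ℕ) ≠ b + 1 := fun h => h2 (Fin.ext h)
        rw [hHdef]
        simp only
        rw [hPlus_jump ρ hij h, hb1, hb2]
        split_ifs <;> first | ring1 | omega
    · have h0 : rateRight q (N b.castSucc) (N b.succ) (ξ b.castSucc) (ξ b.succ) = 0 := by
        by_contra h0
        exact h (rateRight_ne_zero (config_le ξ _) h0)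
      rw [dynRight, h0]; ring
  · by_cases h : 0 < (ξ b.succ : ℕ) ∧ (ξ b.castSucc : ℕ) < N b.castSucc
    · rw [e (jump ξ b.succ b.castSucc) (fun l h1 h2 => jump_val_of_ne h2 h1), e ξ (fun _ _ _ => rfl)
        (fun _ _ _ => rfl), jump_val_target h, jump_val_source hij.symm h]
      · have h1 : H (jump ξ b.succ b.castSucc) b.castSucc
            = hPlus ρ ξ ((b.castSucc : ℕ) + 2) - 2 := by
          rw [hHdef]
          simp only
          rw [hPlus_jump ρ hij.symm h, hb1, hb2, if_neg (by omega), if_pos (by omega)]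
          ring
        have h2 : H (jump ξ b.succ b.castSucc) b.succ = hPlus ρ ξ ((b.succ : ℕ) + 2) := by
          rw [hHdef]
          simp only
          rw [hPlus_jump ρ hij.symm h, hb1, hb2, if_neg (by omega), if_neg (by omega)]
          ring
        rw [h1, h2, hH, hH]
        ring
      · intro l h1 h2
        have h1' : (l : ℕ) ≠ b := fun h => h1 (Fin.ext h)
        have h2' : (l : ℕ) ≠ b + 1 := fun h => h2 (Fin.ext h)
        rw [hHdef]
        simp only
        rw [hPlus_jump ρ hij.symm h, hb1, hb2]
        split_ifs <;> first | ring1 | omega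
    · have h0 : rateLeft q (N b.castSucc) (N b.succ) (ξ b.castSucc) (ξ b.succ) = 0 := by
        by_contra h0
        exact h (rateLeft_ne_zero (config_le ξ _) h0)
      rw [dynLeft, h0]; ring

/-- Two-site duality in base q⁻¹ on the reversed bond; now the height attached to site k + 1 is the
one that moves. -/
lemma KL_duality {q : ℝ} (hq : 0 < q) (hq1 : q ≠ 1) (lam : ℝ) (b : Fin m) (η ζ : Config N) :
    aspBond q b (fun η => KL q lam η ζ) η
      = CLPlus q lam ζ b.castSucc b.succ * (KL q lam η (jump ζ b.castSucc b.succ) - KL q lam η ζ)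
        + CLMinus q lam ζ b.succ b.castSucc
          * (KL q lam η (jump ζ b.succ b.castSucc) - KL q lam η ζ) := by
  have hij := castSucc_ne_succ b
  set H : Config N → Fin (m + 1) → ℝ := fun ζ l => hMinus lam ζ (l : ℕ) with hHdef
  have hH : ∀ l, H ζ l = hMinus lam ζ (l : ℕ) := fun _ => rfl
  have hKL : ∀ η ζ : Config N, KL q lam η ζ = dualFun q q⁻¹ H η ζ := fun _ _ => rfl
  have hb1 : ((b.castSucc : Fin (m + 1)) : ℕ) = b := rfl
  have hb2 : ((b.succ : Fin (m + 1)) : ℕ) = b + 1 := rfl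
  have e := fun ζ' hζ hH => dualFun_eq q q⁻¹ H η ζ η ζ' hij (fun _ _ _ => rfl) hζ hH
  have hs : hMinus lam ζ (b.succ : ℕ) = hMinus lam ζ (b.castSucc : ℕ)
      + (2 * ((ζ b.castSucc : ℕ) : ℝ) - N b.castSucc) := hMinus_succ lam ζ b.castSucc
  have key := two_site_duality (inv_pos.2 hq) (by simpa using hq1) (config_le ζ b.succ)
    (config_le ζ b.castSucc) (hMinus lam ζ (b.castSucc : ℕ)) (hMinus lam ζ (b.succ : ℕ)) hs
    (config_le η b.succ) (config_le η b.castSucc)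
  rw [Real.inv_rpow hq.le, bondOp_inv hq, add_comm (N b.succ : ℝ)] at key
  simp only [hKL]
  rw [aspBond_dualFun hq, hH, hH, key, CLPlus_eq hq, CLMinus_eq hq, add_mul, add_comm]
  congr 1
  · by_cases h : 0 < (ζ b.castSucc : ℕ) ∧ (ζ b.succ : ℕ) < N b.succ
    · rw [e (jump ζ b.castSucc b.succ) (fun l h1 h2 => jump_val_of_ne h1 h2), e ζ (fun _ _ _ => rfl)
        (fun _ _ _ => rfl), jump_val_target h, jump_val_source hij h]
      · have h1 : H (jump ζ b.castSucc b.succ) b.castSucc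
            = hMinus lam ζ (b.castSucc : ℕ) := by
          rw [hHdef]
          simp only
          rw [hMinus_jump lam hij h, hb1, hb2, if_neg (by omega), if_neg (by omega)]
          ring
        have h2 : H (jump ζ b.castSucc b.succ) b.succ = hMinus lam ζ (b.succ : ℕ) - 2 := by
          rw [hHdef]
          simp only
          rw [hMinus_jump lam hij h, hb1, hb2, if_neg (by omega), if_pos (by omega)]
          ring
        rw [h1, h2, hH, hH]
        ring
      · intro l h1 h2
        have h1' : (l : ℕ) ≠ b := fun h => h1 (Fin.ext h)
        have h2' : (l : ℕ) ≠ b + 1 := fun h => h2 (Fin.ext h)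
        rw [hHdef]
        simp only
        rw [hMinus_jump lam hij h, hb1, hb2]
        split_ifs <;> first | ring1 | omega
    · have h0 : rateLeft q⁻¹ (N b.succ) (N b.castSucc) (ζ b.succ) (ζ b.castSucc) = 0 := by
        by_contra h0
        exact h (rateLeft_ne_zero (config_le ζ _) h0)
      rw [dynLeft, h0]; ring
  · by_cases h : 0 < (ζ b.succ : ℕ) ∧ (ζ b.castSucc : ℕ) < N b.castSucc
    · rw [e (jump ζ b.succ b.castSucc) (fun l h1 h2 => jump_val_of_ne h2 h1), e ζ (fun _ _ _ => rfl)
        (fun _ _ _ => rfl), jump_val_target h, jump_val_source hij.symm h]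
      · have h1 : H (jump ζ b.succ b.castSucc) b.castSucc
            = hMinus lam ζ (b.castSucc : ℕ) := by
          rw [hHdef]
          simp only
          rw [hMinus_jump lam hij.symm h, hb1, hb2, if_neg (by omega), if_neg (by omega)]
          ring
        have h2 : H (jump ζ b.succ b.castSucc) b.succ = hMinus lam ζ (b.succ : ℕ) + 2 := by
          rw [hHdef]
          simp only
          rw [hMinus_jump lam hij.symm h, hb1, hb2, if_pos (by omega), if_neg (by omega)]
          ring
        rw [h1, h2, hH, hH]
        ring
      · intro l h1 h2
        have h1' : (l : ℕ) ≠ b := fun h => h1 (Fin.ext h)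
        have h2' : (l : ℕ) ≠ b + 1 := fun h => h2 (Fin.ext h)
        rw [hHdef]
        simp only
        rw [hMinus_jump lam hij.symm h, hb1, hb2]
        split_ifs <;> first | ring1 | omega
    · have h0 : rateRight q⁻¹ (N b.succ) (N b.castSucc) (ζ b.succ) (ζ b.castSucc) = 0 := by
        by_contra h0
        exact h (rateRight_ne_zero (config_le ζ _) h0)
      rw [dynRight, h0]; ring

/-- The functions `R^v` are duality functions between the two dynamic processes. -/
theorem isDualityFunction_Rv {q : ℝ} (hq : 0 < q) (hq1 : q ≠ 1) (lam ρ v : ℝ) :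
    IsDualityFunction (genL q N lam) (genR q N ρ) (Rv q lam ρ v) := by
  intro ζ ξ
  rw [genL, genR]
  refine Finset.sum_congr rfl fun b _ => ?_
  -- Bond by bond the generator is carried from ζ to η by K_L, across the bilinear form by symmetry,
  -- and from η to ξ by K_R.
  have h := aspBond_symm hq hq1 v b (fun η => KL q lam η ζ) (fun η => KR q ρ η ξ)
  simp only [KR_duality hq hq1, KL_duality hq hq1] at h
  simp only [Rv, ← Finset.sum_sub_distrib, Finset.mul_sum, ← Finset.sum_add_distrib]
  refine Eq.trans (Finset.sum_congr rfl fun η _ => ?_)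
    (h.trans (Finset.sum_congr rfl fun η _ => ?_)) <;> rw [revWeight] <;> ring

end Jump

/-! ### Three-term recurrence for the one-site sums -/

/-- One-site contribution to `R^v`. -/
def siteSum (y x : ℕ) (lam ρ v : ℝ) (N : ℕ) (q : ℝ) : ℝ :=
  ∑ n ∈ Finset.range (N + 1), kSite n y lam N q⁻¹ * kSite n x ρ N q * wSite n N q * (-v) ^ n

/-- A polynomial identity in t survives the linear map that sends t^n to ψ n. -/
lemma sum_functional_eq_zero {N : ℕ} (a b c : ℕ → ℝ)
    (h : ∀ t : ℝ, ∑ n ∈ Finset.range (N + 1),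
      (a n * t ^ n + b n * t ^ (n + 1) + c n * t ^ (n + 2)) = 0) (ψ : ℕ → ℝ) :
    ∑ n ∈ Finset.range (N + 1), (a n * ψ n + b n * ψ (n + 1) + c n * ψ (n + 2)) = 0 := by
  set P : Polynomial ℝ := ∑ n ∈ Finset.range (N + 1), (Polynomial.monomial n (a n)
    + Polynomial.monomial (n + 1) (b n) + Polynomial.monomial (n + 2) (c n)) with hP
  have h0 : P = 0 := by
    refine Polynomial.funext fun t => ?_
    rw [Polynomial.eval_zero, ← h t, hP, Polynomial.eval_finsetSum]
    simp
  have h1 := congrArg (Polynomial.lsum fun n => (LinearMap.id : ℝ →ₗ[ℝ] ℝ).smulRight (ψ n)) h0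
  rw [hP, map_zero, map_sum] at h1
  rw [← h1]
  refine Finset.sum_congr rfl fun n _ => ?_
  rw [map_add, map_add]
  simp [Polynomial.lsum_apply, Polynomial.sum_monomial_index]

/-- Coefficient form of `sitePoly_mul_base`, whose multipliers are quadratic in s, hence three
values of ψ. Apart from the function k itself, y enters only in an n-independent part of the factor
of ψ (n + 1), so it acts as a spectral parameter. -/
lemma kSite_functional {q : ℝ} (hq : 0 < q) (hq1 : q ≠ 1) {y N : ℕ} (hy : y ≤ N) (lam : ℝ)
    {Q g R : ℝ} (hQ : Q = q ^ 2) (hg : g = q ^ ((1 - (N : ℝ)) / 2)) (hR : R = q ^ lam)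
    (ψ : ℕ → ℝ) :
    ∑ n ∈ Finset.range (N + 1), wSite n N q * kSite n y lam N q
      * ((Q ^ n - 1) * ψ n + g * (Q ^ n * (R - R⁻¹) - (R * Q ^ y - Q ^ (N - y) / R)) * ψ (n + 1)
        - g ^ 2 * (Q ^ n - Q ^ N) * ψ (n + 2)) = 0 := by
  set h : ℕ → ℝ := fun n => wSite n N q * kSite n y lam N q with hh
  have key := sum_functional_eq_zero (N := N) (fun n => h n * (Q ^ n - 1))
    (fun n => h n * (g * (Q ^ n * (R - R⁻¹) - (R * Q ^ y - Q ^ (N - y) / R))))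
    (fun n => h n * (-(g ^ 2 * (Q ^ n - Q ^ N)))) ?_ ψ
  · rw [← key]
    refine Finset.sum_congr rfl fun n _ => ?_
    rw [hh]
    ring
  · intro t
    have e := sitePoly_mul_base (q ^ 2) (q ^ lam) (q ^ ((1 - (N : ℝ)) / 2) * t) y (N - y)
    rw [show q ^ 2 * (q ^ ((1 - (N : ℝ)) / 2) * t) = q ^ ((1 - (N : ℝ)) / 2) * (q ^ 2 * t) by ring,
      ← siteGF_kSite hq hq1 hy, ← siteGF_kSite hq hq1 hy, ← hQ, ← hg, ← hR, siteGF, siteGF] at e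
    have hR0 : R ≠ 0 := by rw [hR]; exact (Real.rpow_pos_of_pos hq _).ne'
    have eN : Q ^ N = Q ^ y * Q ^ (N - y) := by rw [← pow_add, Nat.add_sub_cancel' hy]
    rw [← sub_eq_zero, Finset.mul_sum, Finset.sum_mul, ← Finset.sum_sub_distrib] at e
    rw [← e]
    refine Finset.sum_congr rfl fun n _ => ?_
    rw [hh, eN, mul_pow]
    field_simp
    ring

/-- Racah recurrence coefficient `A`, in the variables `M = q^N`, `L = q^lam`, `r = q^ρ`,
`X = q^(2x)`. -/
def recA (q M L r v X : ℝ) : ℝ :=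
  (1 + L * q * r * X / (v * M)) * (1 + v * r * L * q * X / M)
    * ((1 + r ^ 2 * X / M ^ 2) * (1 - X / M ^ 2))
    / ((1 + r ^ 2 * q ^ 2 * X ^ 2 / M ^ 2) * (1 + r ^ 2 * X ^ 2 / M ^ 2))

/-- Racah recurrence coefficient `C`. -/
def recC (q M L r v X : ℝ) : ℝ :=
  (1 - L * q * M / (v * r * X)) * (1 - v * L * M * q / (r * X))
    * ((1 - X⁻¹) * (1 + (r ^ 2 * X)⁻¹))
    / ((1 + q ^ 2 * M ^ 2 / (r ^ 2 * X ^ 2)) * (1 + M ^ 2 / (r ^ 2 * X ^ 2)))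

/-- Coefficient of the one-site sum at `x + 1` in its recurrence. -/
def recUp (q M L r v X : ℝ) : ℝ :=
  L⁻¹ * ((1 + L * q * r * X / (v * M)) * (1 - v * M * L / (q * r * X))
    * ((1 + r ^ 2 * X / M ^ 2) * (1 - X / M ^ 2))
    / ((1 + r ^ 2 * q ^ 2 * X ^ 2 / M ^ 2) * (1 + r ^ 2 * X ^ 2 / M ^ 2)))

/-- Coefficient of the one-site sum at `x - 1` in its recurrence. -/
def recDown (q M L r v X : ℝ) : ℝ :=
  L⁻¹ * ((1 - L * q * M / (v * r * X)) * (1 + L * v * r * X / (q * M))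
    * ((1 - X⁻¹) * (1 + (r ^ 2 * X)⁻¹))
    / ((1 + q ^ 2 * M ^ 2 / (r ^ 2 * X ^ 2)) * (1 + M ^ 2 / (r ^ 2 * X ^ 2))))

/-- A partial fraction expansion in s with denominators cleared. The poles at 0 and ∞ cancel;
`recUp` and `recDown` come from the poles at the zeros of 1 - s M²/(r X q²) and 1 + r s X/q². -/
lemma recUp_recDown_identity {q M L r X v s : ℝ} (hq : 0 < q) (hM : 0 < M) (hL : 0 < L)
    (hr : 0 < r) (hX : 0 < X) (hv : v ≠ 0) (hs : s ≠ 0) :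
    ((L⁻¹ - L) + v⁻¹ * (M / q) * s - v * (q / M) / s)
        * ((1 + r * s / q ^ 2) * (1 - s / r / q ^ 2))
      + (v * (q / M) / s - v⁻¹ * (1 / (q * M)) * s)
        * ((1 + r * s * X / q ^ 2) * (1 - s / r * (M ^ 2 / X) / q ^ 2))
    = recUp q M L r v X * ((1 + r * s * X) * (1 + r * s * X / q ^ 2))
      + L⁻¹ * ((1 - L ^ 2 / M ^ 2) - (recA q M L r v X + recC q M L r v X))
        * ((1 + r * s * X / q ^ 2) * (1 - s / r * (M ^ 2 / X) / q ^ 2))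
      + recDown q M L r v X
        * ((1 - s / r * (M ^ 2 / X)) * (1 - s / r * (M ^ 2 / X) / q ^ 2)) := by
  have p1 : 0 < M ^ 2 + r ^ 2 * q ^ 2 * X ^ 2 := by positivity
  have p2 : 0 < M ^ 2 + r ^ 2 * X ^ 2 := by positivity
  have p3 : 0 < r ^ 2 * X ^ 2 + q ^ 2 * M ^ 2 := by positivity
  have p4 : 0 < r ^ 2 * X ^ 2 + M ^ 2 := by positivity
  have e1 : 1 + r ^ 2 * q ^ 2 * X ^ 2 / M ^ 2 = (M ^ 2 + r ^ 2 * q ^ 2 * X ^ 2) / M ^ 2 := by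
    field_simp
  have e2 : 1 + r ^ 2 * X ^ 2 / M ^ 2 = (M ^ 2 + r ^ 2 * X ^ 2) / M ^ 2 := by
    field_simp
  have e3 : 1 + q ^ 2 * M ^ 2 / (r ^ 2 * X ^ 2) = (r ^ 2 * X ^ 2 + q ^ 2 * M ^ 2) / (r ^ 2 * X ^ 2) := by
    field_simp
  have e4 : 1 + M ^ 2 / (r ^ 2 * X ^ 2) = (M ^ 2 + r ^ 2 * X ^ 2) / (r ^ 2 * X ^ 2) := by
    field_simp; ring
  rw [recUp, recA, recDown, recC, e1, e2, e3, e4]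
  field_simp
  ring

lemma inv_pow_mul_eq {a Q : ℝ} (ha : a ≠ 0) (hQ : Q = a⁻¹) {t : ℝ} {n : ℕ} :
    Q ^ n * t ^ n = t ^ n / a ^ n := by
  rw [hQ, inv_pow]
  field_simp

lemma recUp_full {q M L r v : ℝ} (hM : 0 < M) : recUp q M L r v (M ^ 2) = 0 := by
  rw [recUp, div_self (by positivity)]; ring

lemma recDown_zero (q M L r v : ℝ) : recDown q M L r v 1 = 0 := by
  rw [recDown]; simp

/-- The recurrence operator in `n` acts tridiagonally in `x` on the Krawtchouk functions. -/
lemma kSite_tridiagonal {q : ℝ} (hq : 0 < q) (hq1 : q ≠ 1) {x N : ℕ} (hx : x ≤ N) (ρ : ℝ)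
    {L v M r X g Q : ℝ} (hL : 0 < L) (hv : v ≠ 0) (hM : M = q ^ N) (hr : r = q ^ ρ)
    (hX : X = (q ^ 2) ^ x) (hg : g = q ^ (((N : ℝ) - 1) / 2)) (hQ : Q = (q ^ 2)⁻¹) {n : ℕ}
    (hn : n ≤ N) :
    g * (L⁻¹ - L) * (Q ^ n * kSite n x ρ N q)
        - (Q ^ n - 1) * v⁻¹ * kSite (n - 1) x ρ N q
        + g ^ 2 * (Q ^ n - Q ^ N) * v * kSite (n + 1) x ρ N q
      = g * (recUp q M L r v X * kSite n (x + 1) ρ N q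
        + L⁻¹ * ((1 - L ^ 2 / M ^ 2) - (recA q M L r v X + recC q M L r v X)) * kSite n x ρ N q
        + recDown q M L r v X * kSite n (x - 1) ρ N q) := by
  have hMpos : 0 < M := hM ▸ pow_pos hq N
  have hrpos : 0 < r := hr ▸ Real.rpow_pos_of_pos hq ρ
  have hXpos : 0 < X := hX ▸ pow_pos (pow_pos hq 2) x
  have hgpos : 0 < g := hg ▸ Real.rpow_pos_of_pos hq _
  have hQpos : 0 < Q := by rw [hQ]; positivity
  have hq2 : q ^ 2 ≠ 0 := by positivity
  have hQM : Q ^ N = (M ^ 2)⁻¹ := by rw [hQ, hM, inv_pow, pow_right_comm]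
  have hginv : q ^ ((1 - (N : ℝ)) / 2) = g⁻¹ := by
    rw [hg, ← Real.rpow_neg hq.le]; congr 1; ring
  have hg2 : g ^ 2 = M / q := by
    rw [hg, ← rpow_two_mul hq, mul_div_cancel₀ _ two_ne_zero, Real.rpow_sub hq, Real.rpow_one,
      Real.rpow_natCast, hM]
  refine sub_eq_zero.1 (mul_left_cancel₀ (wSite_pos hq hq1 hn).ne'
    (Eq.trans ?_ (mul_zero _).symm))
  refine coeff_eq_zero_of_sum_pow (N := N) (d := fun n => wSite n N q
    * (g * (L⁻¹ - L) * (Q ^ n * kSite n x ρ N q)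
        - (Q ^ n - 1) * v⁻¹ * kSite (n - 1) x ρ N q
        + g ^ 2 * (Q ^ n - Q ^ N) * v * kSite (n + 1) x ρ N q
      - g * (recUp q M L r v X * kSite n (x + 1) ρ N q
        + L⁻¹ * ((1 - L ^ 2 / M ^ 2) - (recA q M L r v X + recC q M L r v X)) * kSite n x ρ N q
        + recDown q M L r v X * kSite n (x - 1) ρ N q))) ?_ hn
  filter_upwards [self_mem_nhdsWithin,
    eventually_one_sub_mul_ne_zero (-(r * g⁻¹ * X / q ^ 2)),
    eventually_one_sub_mul_ne_zero (g⁻¹ / r * (M ^ 2 / X) / q ^ 2)] with t ht m1 m2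
  have ht0 : t ≠ 0 := ne_of_gt ht
  set F : ℝ → ℝ := siteGF q N (fun n => kSite n x ρ N q) with hF
  -- At n = 0 the index n - 1 is truncated, but its coefficient Q^0 - 1 vanishes.
  have s1 : ∑ n ∈ Finset.range (N + 1), wSite n N q * ((Q ^ n - 1) * kSite (n - 1) x ρ N q) * t ^ n
      = -(t / q * (M * F (t / q ^ 2) - M⁻¹ * F t)) := by
    rw [Finset.sum_range_succ', hF]
    simp only [siteGF]
    rw [Finset.mul_sum, Finset.mul_sum, ← Finset.sum_sub_distrib, Finset.mul_sum,
      ← Finset.sum_neg_distrib, Finset.sum_range_succ]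
    congr 1
    · refine Finset.sum_congr rfl fun n hn => ?_
      have hw := wSite_succ hq hq1 (Finset.mem_range.1 hn)
      rw [← hM] at hw
      have e : Q ^ (n + 1) - 1 = -((q ^ 2) ^ (n + 1) - 1) / (q ^ 2) ^ (n + 1) := by
        rw [hQ, inv_pow]
        have := pow_pos (pow_pos hq 2) (n + 1)
        field_simp
        ring
      have e2 : wSite (n + 1) N q * ((Q ^ (n + 1) - 1) * kSite (n + 1 - 1) x ρ N q)
          = -(wSite (n + 1) N q * ((q ^ 2) ^ (n + 1) - 1)) / (q ^ 2) ^ (n + 1)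
            * kSite n x ρ N q := by
        rw [e, Nat.add_sub_cancel]; ring
      rw [e2, hw, pow_succ (q ^ 2), div_pow]
      have := pow_pos (pow_pos hq 2) n
      field_simp
      ring
    · rw [div_pow, ← inv_pow_mul_eq hq2 hQ, hQM]
      have e : M * (wSite N N q * kSite N x ρ N q * ((M ^ 2)⁻¹ * t ^ N))
          - M⁻¹ * (wSite N N q * kSite N x ρ N q * t ^ N) = 0 := by
        field_simp
        ring
      rw [e]
      simp
  -- At n = N the function with index N + 1 is killed by Q^N - Q^N.
  have s2 : ∑ n ∈ Finset.range (N + 1), wSite n N q * ((Q ^ n - Q ^ N) * kSite (n + 1) x ρ N q)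
      * t ^ n = q / M / t * (F t - F (t / q ^ 2)) := by
    rw [Finset.sum_range_succ, hF]
    simp only [siteGF]
    rw [← Finset.sum_sub_distrib, Finset.mul_sum, Finset.sum_range_succ']
    congr 1
    · refine Finset.sum_congr rfl fun n hn => ?_
      have hw := wSite_succ hq hq1 (Finset.mem_range.1 hn)
      rw [← hM] at hw
      have e : wSite n N q * (Q ^ n - Q ^ N) = q / M * (wSite (n + 1) N q * ((q ^ 2) ^ (n + 1) - 1))
          / (q ^ 2) ^ (n + 1) := by
        rw [hw, hQM, hQ, inv_pow, pow_succ (q ^ 2)]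
        have := pow_pos (pow_pos hq 2) n
        field_simp
      rw [← mul_assoc, e, div_pow, pow_succ t]
      have := pow_pos (pow_pos hq 2) (n + 1)
      field_simp
    · simp
  have hsum : ∀ (x' : ℕ), x' ≤ N → siteGF q N (fun n => kSite n x' ρ N q) t
      = sitePoly (q ^ 2) r (g⁻¹ * t) x' (N - x') := by
    intro x' hx'
    rw [siteGF_kSite hq hq1 hx', ← hr, hginv]
  have hF1 : F t = sitePoly (q ^ 2) r (g⁻¹ * t) x (N - x) := hsum x hx
  have hF2 : F (t / q ^ 2) = sitePoly (q ^ 2) r (g⁻¹ * t / q ^ 2) x (N - x) := by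
    rw [hF, siteGF_kSite hq hq1 hx, ← hr, hginv, mul_div_assoc]
  have hY : (q ^ 2) ^ (N - x) = M ^ 2 / X := by
    rw [eq_div_iff hXpos.ne', hX, ← pow_add, Nat.sub_add_cancel hx, hM, pow_right_comm]
  set s := g⁻¹ * t with hs
  have hs0 : s ≠ 0 := mul_ne_zero (inv_ne_zero hgpos.ne') ht0
  have hts : t = g * s := by rw [hs]; field_simp
  have d1 : 1 + r * s * X / q ^ 2 ≠ 0 := by convert m1 using 1; rw [hs]; ring
  have d2 : 1 - s / r * (M ^ 2 / X) / q ^ 2 ≠ 0 := by convert m2 using 1; rw [hs]; ring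
  have g2 := sitePoly_div_base hq2 r s x (N - x)
  rw [hY, ← hX, ← hF1, ← hF2] at g2
  -- The neighbours x ± 1 at fixed ρ differ by rational factors in s; at x = N and x = 0 the
  -- coefficient of the missing neighbour vanishes.
  have up : (1 - s / r * (M ^ 2 / X) / q ^ 2) * (recUp q M L r v X
      * siteGF q N (fun n => kSite n (x + 1) ρ N q) t)
      = recUp q M L r v X * (F t * (1 + r * s * X)) := by
    rcases Nat.eq_or_lt_of_le hx with h | h
    · have : X = M ^ 2 := by rw [hX, hM, h, pow_right_comm]
      rw [this, recUp_full hMpos]; ring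
    · obtain ⟨k, hk⟩ : ∃ k, N - x = k + 1 := ⟨N - x - 1, by omega⟩
      have := sitePoly_move (q ^ 2) r s x k
      rw [hsum (x + 1) h, hF1, hk, show N - (x + 1) = k by omega, ← hY, hk, hX,
        show s / r * (q ^ 2) ^ (k + 1) / q ^ 2 = s / r * (q ^ 2) ^ k by
          rw [pow_succ]; field_simp]
      linear_combination recUp q M L r v ((q ^ 2) ^ x) * this
  have down : (1 + r * s * X / q ^ 2) * (recDown q M L r v X
      * siteGF q N (fun n => kSite n (x - 1) ρ N q) t)
      = recDown q M L r v X * (F t * (1 - s / r * (M ^ 2 / X))) := by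
    rcases Nat.eq_zero_or_pos x with h | h
    · have : X = 1 := by rw [hX, h, pow_zero]
      rw [this, recDown_zero]; ring
    · obtain ⟨k, rfl⟩ : ∃ k, x = k + 1 := ⟨x - 1, by omega⟩
      have := sitePoly_move (q ^ 2) r s k (N - (k + 1))
      rw [Nat.add_sub_cancel, hsum k (by omega), hF1, ← hY, hX,
        show N - k = N - (k + 1) + 1 by omega,
        show r * s * (q ^ 2) ^ (k + 1) / q ^ 2 = r * s * (q ^ 2) ^ k by
          rw [pow_succ]; field_simp]
      linear_combination (-recDown q M L r v ((q ^ 2) ^ (k + 1))) * this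
  have core := recUp_recDown_identity (q := q) (s := s) hq hMpos hL hrpos hXpos hv hs0
  have expand : ∑ n ∈ Finset.range (N + 1), wSite n N q
      * (g * (L⁻¹ - L) * (Q ^ n * kSite n x ρ N q)
        - (Q ^ n - 1) * v⁻¹ * kSite (n - 1) x ρ N q
        + g ^ 2 * (Q ^ n - Q ^ N) * v * kSite (n + 1) x ρ N q
      - g * (recUp q M L r v X * kSite n (x + 1) ρ N q
        + L⁻¹ * ((1 - L ^ 2 / M ^ 2) - (recA q M L r v X + recC q M L r v X)) * kSite n x ρ N q
        + recDown q M L r v X * kSite n (x - 1) ρ N q)) * t ^ n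
      = g * (L⁻¹ - L) * F (t / q ^ 2) - v⁻¹ * (-(t / q * (M * F (t / q ^ 2) - M⁻¹ * F t)))
        + g ^ 2 * v * (q / M / t * (F t - F (t / q ^ 2)))
        - g * (recUp q M L r v X * siteGF q N (fun n => kSite n (x + 1) ρ N q) t
          + L⁻¹ * ((1 - L ^ 2 / M ^ 2) - (recA q M L r v X + recC q M L r v X)) * F t
          + recDown q M L r v X * siteGF q N (fun n => kSite n (x - 1) ρ N q) t) := by
    rw [← s1, ← s2, hF]
    simp only [siteGF, Finset.mul_sum, ← Finset.sum_add_distrib, ← Finset.sum_sub_distrib]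
    refine Finset.sum_congr rfl fun n _ => ?_
    rw [div_pow, ← inv_pow_mul_eq hq2 hQ]
    ring
  rw [expand]
  rw [mul_comm, ← eq_div_iff (mul_ne_zero d1 d2)] at g2
  rw [mul_comm, ← eq_div_iff d2] at up
  rw [mul_comm, ← eq_div_iff d1] at down
  rw [g2, up, down, hg2, hts]
  have core2 : (L⁻¹ - L + v⁻¹ * (M / q) * s - v * (q / M) / s)
        * ((1 + r * s / q ^ 2) * (1 - s / r / q ^ 2))
      / ((1 + r * s * X / q ^ 2) * (1 - s / r * (M ^ 2 / X) / q ^ 2))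
      + (v * (q / M) / s - v⁻¹ * (1 / (q * M)) * s)
    = recUp q M L r v X * (1 + r * s * X) / (1 - s / r * (M ^ 2 / X) / q ^ 2)
      + L⁻¹ * ((1 - L ^ 2 / M ^ 2) - (recA q M L r v X + recC q M L r v X))
      + recDown q M L r v X * (1 - s / r * (M ^ 2 / X)) / (1 + r * s * X / q ^ 2) := by
    generalize recUp q M L r v X = al at *
    generalize recDown q M L r v X = ga at *
    generalize L⁻¹ * ((1 - L ^ 2 / M ^ 2) - (recA q M L r v X + recC q M L r v X)) = be at *
    generalize (L⁻¹ - L + v⁻¹ * (M / q) * s - v * (q / M) / s) = E1 at *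
    generalize (v * (q / M) / s - v⁻¹ * (1 / (q * M)) * s) = E2 at *
    generalize (1 + r * s * X / q ^ 2) = D1 at *
    generalize (1 - s / r * (M ^ 2 / X) / q ^ 2) = D2 at *
    generalize (1 + r * s * X) = U1 at *
    generalize (1 - s / r * (M ^ 2 / X)) = U2 at *
    generalize ((1 + r * s / q ^ 2) * (1 - s / r / q ^ 2)) = Z at *
    have c1 : E1 * Z / (D1 * D2) + E2 = (E1 * Z + E2 * (D1 * D2)) / (D1 * D2) := by
      field_simp
    rw [c1, core]
    field_simp
  generalize recUp q M L r v X = al at *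
  generalize recDown q M L r v X = ga at *
  generalize L⁻¹ * ((1 - L ^ 2 / M ^ 2) - (recA q M L r v X + recC q M L r v X)) = be at *
  generalize ((1 + r * s / q ^ 2) * (1 - s / r / q ^ 2)) = Z at *
  generalize (1 + r * s * X / q ^ 2) = D1 at *
  generalize (1 - s / r * (M ^ 2 / X) / q ^ 2) = D2 at *
  have e1 : v⁻¹ * (-(g * s / q * (M * (F (g * s) * Z / (D1 * D2)) - M⁻¹ * F (g * s))))
      = -(g * F (g * s)) * (v⁻¹ * (M / q) * s * Z / (D1 * D2) - v⁻¹ * (1 / (q * M)) * s) := by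
    field_simp
  have e2 : M / q * v * (q / M / (g * s) * (F (g * s) - F (g * s) * Z / (D1 * D2)))
      = (g * F (g * s)) * (v * (M / q / g ^ 2) * (q / M) / s
        - v * (M / q / g ^ 2) * (q / M) / s * Z / (D1 * D2)) := by
    field_simp
  rw [← hg2, div_self (by positivity)] at e2
  rw [← hg2, e1, e2]
  linear_combination (g * F (g * s)) * core2

/-- Three-term recurrence in `x` for the one-site sums. -/
lemma siteSum_recurrence {q : ℝ} (hq : 0 < q) (hq1 : q ≠ 1) {x y N : ℕ} (hx : x ≤ N) (hy : y ≤ N)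
    (lam ρ : ℝ) {L v M r X Y : ℝ} (hL : L = q ^ lam) (hv : v ≠ 0) (hM : M = q ^ N)
    (hr : r = q ^ ρ) (hX : X = (q ^ 2) ^ x) (hY : Y = (q ^ 2) ^ y) :
    (L⁻¹ * Y⁻¹ - L * Y / M ^ 2) * siteSum y x lam ρ v N q
      = recUp q M L r v X * siteSum y (x + 1) lam ρ v N q
        + L⁻¹ * ((1 - L ^ 2 / M ^ 2) - (recA q M L r v X + recC q M L r v X))
          * siteSum y x lam ρ v N q
        + recDown q M L r v X * siteSum y (x - 1) lam ρ v N q := by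
  have hLpos : 0 < L := hL ▸ Real.rpow_pos_of_pos hq lam
  have hMpos : 0 < M := hM ▸ pow_pos hq N
  have hYpos : 0 < Y := hY ▸ pow_pos (pow_pos hq 2) y
  set g := q ^ (((N : ℝ) - 1) / 2) with hg
  have hgpos : 0 < g := Real.rpow_pos_of_pos hq _
  set Q := (q ^ 2)⁻¹ with hQ
  -- The y-side has base q⁻¹. The sequence ψ is the x-side at n - 1, so ψ n, ψ (n+1), ψ (n+2) give
  -- the three terms of `kSite_tridiagonal`. Writing the power as (-v)^n (-v)⁻¹ avoids a truncated
  -- exponent at n = 0.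
  have key := kSite_functional (inv_pos.2 hq) (by simpa using hq1) hy lam (Q := Q) (g := g)
    (R := L⁻¹) (by rw [hQ, inv_pow]) (by rw [rpow_inv_base hq, hg]; congr 1; ring)
    (by rw [hL, Real.inv_rpow hq.le])
    (fun n => kSite (n - 1) x ρ N q * ((-v) ^ n * (-v)⁻¹))
  have hQy : Q ^ y = Y⁻¹ := by rw [hQ, hY, inv_pow]
  have hQN : Q ^ (N - y) = Y / M ^ 2 := by
    have h1 : Q ^ N = (M ^ 2)⁻¹ := by rw [hQ, hM, inv_pow, pow_right_comm]
    have h2 : Q ^ (N - y) * Q ^ y = Q ^ N := by rw [← pow_add, Nat.sub_add_cancel hy]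
    rw [hQy, h1] at h2
    field_simp at h2 ⊢
    exact h2
  rw [hQy, hQN, inv_inv] at key
  have hv' : -v ≠ 0 := neg_ne_zero.2 hv
  have term : ∀ n ∈ Finset.range (N + 1), wSite n N q⁻¹ * kSite n y lam N q⁻¹
      * ((Q ^ n - 1) * (kSite (n - 1) x ρ N q * ((-v) ^ n * (-v)⁻¹))
        + g * (Q ^ n * (L⁻¹ - L) - (L⁻¹ * Y⁻¹ - Y / M ^ 2 / L⁻¹))
          * (kSite (n + 1 - 1) x ρ N q * ((-v) ^ (n + 1) * (-v)⁻¹))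
        - g ^ 2 * (Q ^ n - Q ^ N) * (kSite (n + 2 - 1) x ρ N q * ((-v) ^ (n + 2) * (-v)⁻¹)))
      = g * (recUp q M L r v X
          * (kSite n y lam N q⁻¹ * kSite n (x + 1) ρ N q * wSite n N q * (-v) ^ n)
        + L⁻¹ * ((1 - L ^ 2 / M ^ 2) - (recA q M L r v X + recC q M L r v X))
          * (kSite n y lam N q⁻¹ * kSite n x ρ N q * wSite n N q * (-v) ^ n)
        + recDown q M L r v X
          * (kSite n y lam N q⁻¹ * kSite n (x - 1) ρ N q * wSite n N q * (-v) ^ n)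
        - (L⁻¹ * Y⁻¹ - L * Y / M ^ 2)
          * (kSite n y lam N q⁻¹ * kSite n x ρ N q * wSite n N q * (-v) ^ n)) := by
    intro n hn
    have hn' : n ≤ N := Nat.lt_succ_iff.1 (Finset.mem_range.1 hn)
    have tri := kSite_tridiagonal hq hq1 hx ρ hLpos hv hM hr hX hg hQ hn'
    rw [wSite_inv hq hn', Nat.add_sub_cancel, show n + 2 - 1 = n + 1 by omega, pow_succ (-v) n,
      show (-v) ^ (n + 2) = (-v) ^ n * (-v) * (-v) by ring, mul_inv_cancel_right₀ hv',
      mul_inv_cancel_right₀ hv', inv_neg]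
    have e : Y / M ^ 2 / L⁻¹ = L * Y / M ^ 2 := by field_simp
    rw [e]
    linear_combination (wSite n N q * kSite n y lam N q⁻¹ * (-v) ^ n) * tri
  rw [Finset.sum_congr rfl term, ← Finset.mul_sum, Finset.sum_sub_distrib, Finset.sum_add_distrib,
    Finset.sum_add_distrib, ← Finset.mul_sum, ← Finset.mul_sum, ← Finset.mul_sum,
    ← Finset.mul_sum] at key
  have h0 := (mul_eq_zero.1 key).resolve_left hgpos.ne'
  rw [siteSum, siteSum, siteSum]
  linear_combination -h0

/-! ### The one-site sum at x = 0 -/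

lemma qPoch_add (a p : ℝ) (k n : ℕ) : qPoch a p (k + n) = qPoch a p k * qPoch (a * p ^ k) p n := by
  induction n with
  | zero => simp
  | succ n ih => rw [← add_assoc, qPoch_succ, ih, qPoch_succ, pow_add]; ring

lemma qPoch_inv_base {p : ℝ} (hp : p ≠ 0) (a : ℝ) (n : ℕ) :
    qPoch a p⁻¹ n = qPoch (a * p / p ^ n) p n := by
  induction n with
  | zero => simp
  | succ n ih =>
    rw [qPoch_succ, ih, qPoch_succ_left, pow_succ, inv_pow]
    have h1 : a * p / (p ^ n * p) = a * (p ^ n)⁻¹ := by field_simp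
    have h2 : a * (p ^ n)⁻¹ * p = a * p / p ^ n := by field_simp
    rw [h1, h2]
    ring

lemma qPoch_invert {b p : ℝ} (hb : b ≠ 0) (hp : p ≠ 0) (n : ℕ) :
    qPoch b p⁻¹ n = (-b) ^ n / p ^ n.choose 2 * qPoch b⁻¹ p n := by
  induction n with
  | zero => simp
  | succ n ih =>
    rw [qPoch_succ, ih, qPoch_succ, Nat.choose_succ_succ' n 1, Nat.choose_one_right, inv_pow]
    field_simp
    ring

/-- Since K_n(0) = 1, only a pure n-th power remains, and the one-site sum at x = 0 becomes the
generating function of its other factor. -/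
lemma kSite_zero_right {q : ℝ} (hq : 0 < q) {n N : ℕ} (hn : n ≤ N) (ρ : ℝ) :
    kSite n 0 ρ N q = (-(q ^ (-ρ) * q ^ (((N : ℝ) - 1) / 2))) ^ n := by
  rw [kSite, qKrawtchouk_eq_sum (by positivity) hn, sum_krawTerm_zero_right (by positivity),
    neg_pow (q ^ (-ρ) * q ^ (((N : ℝ) - 1) / 2)), mul_pow, ← Real.rpow_mul_natCast hq.le,
    ← Real.rpow_mul_natCast hq.le, mul_one, mul_assoc]
  congr 3 <;> ring

/-- The one-site sum at `x = 0`. -/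
lemma siteSum_zero {q : ℝ} (hq : 0 < q) (hq1 : q ≠ 1) {y N : ℕ} (hy : y ≤ N)
    (lam ρ v : ℝ) : siteSum y 0 lam ρ v N q
      = sitePoly (q ^ 2)⁻¹ (q ^ lam)⁻¹ (v * q ^ N / (q ^ ρ * q)) y (N - y) := by
  have key := siteGF_kSite (inv_pos.2 hq) (by simpa using hq1) hy lam
    (v * (q ^ (-ρ) * q ^ (((N : ℝ) - 1) / 2)))
  have e : q⁻¹ ^ ((1 - (N : ℝ)) / 2) * (v * (q ^ (-ρ) * q ^ (((N : ℝ) - 1) / 2)))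
      = v * q ^ N / (q ^ ρ * q) := by
    have h1 : q ^ (-((1 - (N : ℝ)) / 2)) * q ^ (((N : ℝ) - 1) / 2) = q ^ N / q := by
      rw [← Real.rpow_add hq, show -((1 - (N : ℝ)) / 2) + ((N : ℝ) - 1) / 2 = N - 1 by ring,
        Real.rpow_sub hq, Real.rpow_one, Real.rpow_natCast]
    rw [rpow_inv_base hq, Real.rpow_neg hq.le ρ]
    calc _ = v * (q ^ ρ)⁻¹ * (q ^ (-((1 - (N : ℝ)) / 2)) * q ^ (((N : ℝ) - 1) / 2)) := by ring
      _ = _ := by rw [h1]; field_simp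
  rw [e, inv_pow, Real.inv_rpow hq.le] at key
  rw [← key, siteSum, siteGF]
  refine Finset.sum_congr rfl fun n hn => ?_
  have hn' : n ≤ N := Nat.lt_succ_iff.1 (Finset.mem_range.1 hn)
  rw [kSite_zero_right hq hn', wSite_inv hq hn']
  have : (-(q ^ (-ρ) * q ^ (((N : ℝ) - 1) / 2))) ^ n * (-v) ^ n
      = (v * (q ^ (-ρ) * q ^ (((N : ℝ) - 1) / 2))) ^ n := by
    rw [← mul_pow]; congr 1; ring
  rw [← this]
  ring

/-! ### Three-term recurrence for the `q`-Racah polynomials -/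

/-- Terms of the `q`-Racah series, with `P` in place of `p ^ n`. -/
def racahTerm (α β γ δ p P : ℝ) (j : ℕ) : ℝ :=
  qPoch P⁻¹ p j * qPoch (α * β * p * P) p j
    / (qPoch (α * p) p j * qPoch (β * δ * p) p j * qPoch (γ * p) p j * qPoch p p j)

/-- The basis functions of the `q`-Racah series. -/
def racahBasis (y : ℕ) (γ δ p : ℝ) (j : ℕ) : ℝ :=
  qPoch (p ^ y)⁻¹ p j * qPoch (γ * δ * p * p ^ y) p j

/-- The `q`-Racah series, with `P` in place of `p ^ n`. -/
def racahSum (N y : ℕ) (α β γ δ p P : ℝ) : ℝ :=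
  ∑ j ∈ Finset.range (N + 1), racahTerm α β γ δ p P j * (p ^ j * racahBasis y γ δ p j)

/-- What `racahTerm_recurrence` reduces to after the q-shifted factorials and the factor 1 - p^(j+1)
are divided out. -/
lemma racahTerm_core {p P J α β γ δ : ℝ} (hp : p ≠ 0) (hP : P ≠ 0)
    (h : 1 - α * β * p * P ^ 2 ≠ 0) :
    (1 - α * J) * (1 - β * δ * J) * (1 - γ * J)
        - (1 - γ * δ * p * J) * (1 - J / (p * P)) * (1 - α * β * P * J)
      = J * ((1 - α * p * P) * (1 - β * δ * p * P) * (1 - γ * p * P) * (1 - α * β * P * J)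
            / (p * P * (1 - α * β * p * P ^ 2))
          + p * (1 - β * P) * (γ - α * β * P) * (δ - α * P) * (1 - J / (p * P))
            / (1 - α * β * p * P ^ 2)) := by
  field_simp
  ring

/-- The comparison of coefficients of the basis function with index j + 1 in `racahSum_recurrence`.
A free P replaces p^n, so no degree n - 1 has to be interpreted at n = 0. -/
lemma racahTerm_recurrence {p P α β γ δ : ℝ} (hp : p ≠ 0) (hP : P ≠ 0) {j : ℕ}
    (h0 : 1 - α * β * P ^ 2 ≠ 0) (h1 : 1 - α * β * p * P ^ 2 ≠ 0)
    (h2 : 1 - α * β * p ^ 2 * P ^ 2 ≠ 0)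
    (hD : qPoch (α * p) p (j + 1) * qPoch (β * δ * p) p (j + 1) * qPoch (γ * p) p (j + 1)
      * qPoch p p (j + 1) ≠ 0) {A C : ℝ}
    (hA : A = (1 - α * p * P) * (1 - α * β * p * P) * (1 - β * δ * p * P) * (1 - γ * p * P)
      / ((1 - α * β * p * P ^ 2) * (1 - α * β * p ^ 2 * P ^ 2)))
    (hC : C = p * (1 - P) * (1 - β * P) * (γ - α * β * P) * (δ - α * P)
      / ((1 - α * β * P ^ 2) * (1 - α * β * p * P ^ 2))) :
    p ^ (j + 1) * (A * (racahTerm α β γ δ p (p * P) (j + 1) - racahTerm α β γ δ p P (j + 1))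
        + C * (racahTerm α β γ δ p (P / p) (j + 1) - racahTerm α β γ δ p P (j + 1)))
      = -racahTerm α β γ δ p P j
        + (1 - p ^ (j + 1)) * (1 - γ * δ * p * p ^ (j + 1)) * racahTerm α β γ δ p P (j + 1) := by
  have core := racahTerm_core (J := p ^ (j + 1)) (δ := δ) (γ := γ) hp hP h1
  -- A contains 1 - αβpP, and C contains 1 - P, a multiple of 1 - P⁻¹. These supply the left factors
  -- of `hV` and `hW`, so nothing has to be divided by them.
  have hV := qPoch_mul_base (α * β * p * P) p j
  have hW := qPoch_mul_base P⁻¹ p j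
  have e1 : qPoch (p * P)⁻¹ p (j + 1) = (1 - (p * P)⁻¹) * qPoch P⁻¹ p j := by
    rw [qPoch_succ_left, show (p * P)⁻¹ * p = P⁻¹ by field_simp]
  have e2 : qPoch (α * β * p * (p * P)) p (j + 1)
      = qPoch (α * β * p * P * p) p j * (1 - α * β * p ^ 2 * P * p ^ j) := by
    rw [qPoch_succ, show α * β * p * (p * P) = α * β * p * P * p by ring]
    ring
  have e3 : qPoch (P / p)⁻¹ p (j + 1) = qPoch (P⁻¹ * p) p j * (1 - P⁻¹ * p * p ^ j) := by
    rw [qPoch_succ, show (P / p)⁻¹ = P⁻¹ * p by rw [inv_div]; ring]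
  have e4 : qPoch (α * β * p * (P / p)) p (j + 1)
      = (1 - α * β * P) * qPoch (α * β * p * P) p j := by
    rw [qPoch_succ_left, show α * β * p * (P / p) = α * β * P by field_simp,
      show α * β * P * p = α * β * p * P by ring]
  rw [qPoch_succ (α * p), qPoch_succ (β * δ * p), qPoch_succ (γ * p), qPoch_succ p] at hD
  rw [racahTerm, racahTerm, racahTerm, racahTerm, e1, e2, e3, e4, qPoch_succ P⁻¹,
    qPoch_succ (α * β * p * P), qPoch_succ (α * p), qPoch_succ (β * δ * p), qPoch_succ (γ * p),
    qPoch_succ p]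
  simp only [mul_ne_zero_iff] at hD
  obtain ⟨⟨⟨⟨n1, m1⟩, ⟨n2, m2⟩⟩, ⟨n3, m3⟩⟩, ⟨n4, m4⟩⟩ := hD
  rw [pow_succ] at core ⊢
  generalize qPoch P⁻¹ p j = W at *
  generalize qPoch (P⁻¹ * p) p j = W2 at *
  generalize qPoch (α * β * p * P) p j = V at *
  generalize qPoch (α * β * p * P * p) p j = V2 at *
  generalize qPoch (α * p) p j = D1 at *
  generalize qPoch (β * δ * p) p j = D2 at *
  generalize qPoch (γ * p) p j = D3 at *
  generalize qPoch p p j = D4 at *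
  generalize p ^ j = J at *
  -- the three numerators, as multiples of `W * V`
  have f1 : A * ((1 - (p * P)⁻¹) * W * (V2 * (1 - α * β * p ^ 2 * P * J)))
      = (1 - α * p * P) * (1 - β * δ * p * P) * (1 - γ * p * P)
        / ((1 - α * β * p * P ^ 2) * (1 - α * β * p ^ 2 * P ^ 2))
        * ((1 - (p * P)⁻¹) * (1 - α * β * p ^ 2 * P * J) * (1 - α * β * p * P * J)) * (W * V) := by
    rw [hA]
    linear_combination ((1 - α * p * P) * (1 - β * δ * p * P) * (1 - γ * p * P)
        / ((1 - α * β * p * P ^ 2) * (1 - α * β * p ^ 2 * P ^ 2))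
        * ((1 - (p * P)⁻¹) * W * (1 - α * β * p ^ 2 * P * J))) * hV
  have f2 : C * (W2 * (1 - P⁻¹ * p * J) * ((1 - α * β * P) * V))
      = -(p * P * ((1 - β * P) * (γ - α * β * P) * (δ - α * P))
        / ((1 - α * β * P ^ 2) * (1 - α * β * p * P ^ 2)))
        * ((1 - P⁻¹ * J) * (1 - P⁻¹ * p * J) * (1 - α * β * P)) * (W * V) := by
    have hP1 : 1 - P = -P * (1 - P⁻¹) := by field_simp; ring
    rw [hC, hP1]
    linear_combination (-(p * P * ((1 - β * P) * (γ - α * β * P) * (δ - α * P))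
        / ((1 - α * β * P ^ 2) * (1 - α * β * p * P ^ 2)))
        * ((1 - P⁻¹ * p * J) * (1 - α * β * P)) * V) * hW
  have g1 : (1 - α * p * P) * (1 - β * δ * p * P) * (1 - γ * p * P)
        / ((1 - α * β * p * P ^ 2) * (1 - α * β * p ^ 2 * P ^ 2))
        * ((1 - (p * P)⁻¹) * (1 - α * β * p ^ 2 * P * J) * (1 - α * β * p * P * J))
      - A * ((1 - P⁻¹ * J) * (1 - α * β * p * P * J))
      = (p * J - 1) * ((1 - α * p * P) * (1 - β * δ * p * P) * (1 - γ * p * P)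
        * (1 - α * β * p * P * J) / (p * P * (1 - α * β * p * P ^ 2))) := by
    have b : (1 - (p * P)⁻¹) * (1 - α * β * p ^ 2 * P * J)
        - (1 - P⁻¹ * J) * (1 - α * β * p * P)
        = (p * J - 1) * (p * P)⁻¹ * (1 - α * β * p ^ 2 * P ^ 2) := by
      field_simp
      ring
    have e : (1 - α * p * P) * (1 - β * δ * p * P) * (1 - γ * p * P)
        / ((1 - α * β * p * P ^ 2) * (1 - α * β * p ^ 2 * P ^ 2))
        * (1 - α * β * p ^ 2 * P ^ 2) * (p * P)⁻¹
        = (1 - α * p * P) * (1 - β * δ * p * P) * (1 - γ * p * P)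
          / (p * P * (1 - α * β * p * P ^ 2)) := by
      rw [← div_div, div_mul_cancel₀ _ h2, mul_comm (p * P), ← div_div _ _ (p * P),
        div_eq_mul_inv _ (p * P)]
    rw [hA]
    linear_combination ((1 - α * p * P) * (1 - β * δ * p * P) * (1 - γ * p * P)
        / ((1 - α * β * p * P ^ 2) * (1 - α * β * p ^ 2 * P ^ 2)) * (1 - α * β * p * P * J)) * b
      + (p * J - 1) * (1 - α * β * p * P * J) * e
  have g2 : -(p * P * ((1 - β * P) * (γ - α * β * P) * (δ - α * P))
        / ((1 - α * β * P ^ 2) * (1 - α * β * p * P ^ 2)))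
        * ((1 - P⁻¹ * J) * (1 - P⁻¹ * p * J) * (1 - α * β * P))
      - C * ((1 - P⁻¹ * J) * (1 - α * β * p * P * J))
      = (p * J - 1) * (p * (1 - β * P) * (γ - α * β * P) * (δ - α * P) * (1 - P⁻¹ * J)
        / (1 - α * β * p * P ^ 2)) := by
    have b : (1 - P⁻¹ * p * J) * (1 - α * β * P) - (1 - P⁻¹) * (1 - α * β * p * P * J)
        = (1 - p * J) * P⁻¹ * (1 - α * β * P ^ 2) := by
      field_simp
      ring
    have e : p * P * ((1 - β * P) * (γ - α * β * P) * (δ - α * P))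
        / ((1 - α * β * P ^ 2) * (1 - α * β * p * P ^ 2)) * (1 - α * β * P ^ 2) * P⁻¹
        = p * (1 - β * P) * (γ - α * β * P) * (δ - α * P) / (1 - α * β * p * P ^ 2) := by
      rw [mul_comm (1 - α * β * P ^ 2), ← div_div, div_mul_cancel₀ _ h0, div_mul_eq_mul_div]
      congr 1
      field_simp
    have e' : C = -(p * P * ((1 - β * P) * (γ - α * β * P) * (δ - α * P))
        / ((1 - α * β * P ^ 2) * (1 - α * β * p * P ^ 2))) * (1 - P⁻¹) := by
      have hP1 : 1 - P = -P * (1 - P⁻¹) := by field_simp; ring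
      rw [hC, hP1]
      ring
    rw [e']
    linear_combination (-(p * P * ((1 - β * P) * (γ - α * β * P) * (δ - α * P))
        / ((1 - α * β * P ^ 2) * (1 - α * β * p * P ^ 2))) * (1 - P⁻¹ * J)) * b
      + (p * J - 1) * (1 - P⁻¹ * J) * e
  have e5 : J * p / (p * P) = P⁻¹ * J := by field_simp
  rw [e5] at core
  set D := D1 * (1 - α * p * J) * (D2 * (1 - β * δ * p * J)) * (D3 * (1 - γ * p * J))
    * (D4 * (1 - p * J)) with hDdef
  have hD0 : D ≠ 0 := by
    rw [hDdef]
    simp only [ne_eq, mul_eq_zero, not_or]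
    exact ⟨⟨⟨⟨n1, m1⟩, ⟨n2, m2⟩⟩, ⟨n3, m3⟩⟩, ⟨n4, m4⟩⟩
  have e6 : W * V / (D1 * D2 * D3 * D4)
      = W * V * ((1 - α * p * J) * (1 - β * δ * p * J) * (1 - γ * p * J) * (1 - p * J)) / D := by
    rw [hDdef, div_eq_div_iff (mul_ne_zero (mul_ne_zero (mul_ne_zero n1 n2) n3) n4) hD0]
    ring
  rw [e6]
  apply mul_right_cancel₀ hD0
  have lhs : J * p * (A * ((1 - (p * P)⁻¹) * W * (V2 * (1 - α * β * p ^ 2 * P * J)) / D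
        - W * (1 - P⁻¹ * J) * (V * (1 - α * β * p * P * J)) / D)
      + C * (W2 * (1 - P⁻¹ * p * J) * ((1 - α * β * P) * V) / D
        - W * (1 - P⁻¹ * J) * (V * (1 - α * β * p * P * J)) / D)) * D
      = J * p * (A * ((1 - (p * P)⁻¹) * W * (V2 * (1 - α * β * p ^ 2 * P * J)))
        - A * (W * (1 - P⁻¹ * J) * (V * (1 - α * β * p * P * J)))
      + C * (W2 * (1 - P⁻¹ * p * J) * ((1 - α * β * P) * V))
        - C * (W * (1 - P⁻¹ * J) * (V * (1 - α * β * p * P * J)))) := by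
    field_simp
    ring
  have rhs : (-(W * V * ((1 - α * p * J) * (1 - β * δ * p * J) * (1 - γ * p * J) * (1 - p * J)) / D)
      + (1 - J * p) * (1 - γ * δ * p * (J * p))
        * (W * (1 - P⁻¹ * J) * (V * (1 - α * β * p * P * J)) / D)) * D
      = W * V * (-((1 - α * p * J) * (1 - β * δ * p * J) * (1 - γ * p * J) * (1 - p * J))
      + (1 - J * p) * (1 - γ * δ * p * (J * p))
        * ((1 - P⁻¹ * J) * (1 - α * β * p * P * J))) := by
    generalize (1 - α * p * J) * (1 - β * δ * p * J) * (1 - γ * p * J) * (1 - p * J) = z1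
    generalize (1 - J * p) * (1 - γ * δ * p * (J * p)) = z2
    generalize (1 - P⁻¹ * J) = z3
    field_simp
  rw [lhs, rhs, f1, f2]
  linear_combination (W * V) * ((J * p) * g1 + (J * p) * g2 - (p * J - 1) * core)

/-- The y-dependent factor is the spectral parameter of the recurrence, and multiplication by it is
bidiagonal in this basis. -/
lemma racahBasis_succ (y : ℕ) {p : ℝ} (hp : p ≠ 0) (γ δ : ℝ) (j : ℕ) :
    p ^ j * ((1 - (p ^ y)⁻¹) * (1 - γ * δ * p * p ^ y)) * racahBasis y γ δ p j
      = racahBasis y γ δ p (j + 1)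
        - (1 - p ^ j) * (1 - γ * δ * p * p ^ j) * racahBasis y γ δ p j := by
  rw [racahBasis, racahBasis, qPoch_succ, qPoch_succ]
  have := pow_ne_zero y hp
  generalize qPoch (p ^ y)⁻¹ p j = z1
  generalize qPoch (γ * δ * p * p ^ y) p j = z2
  generalize p ^ y = Y at *
  field_simp
  ring

/-- Both sides are expanded in the basis functions of y. The spectral parameter produces the index N
+ 1, whose basis function vanishes for y ≤ N. -/
lemma racahSum_recurrence {N y : ℕ} {p P α β γ δ : ℝ} (hp : 0 < p) (hy : y ≤ N) (hP : P ≠ 0)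
    (h0 : 1 - α * β * P ^ 2 ≠ 0) (h1 : 1 - α * β * p * P ^ 2 ≠ 0)
    (h2 : 1 - α * β * p ^ 2 * P ^ 2 ≠ 0)
    (hD : ∀ j ≤ N, qPoch (α * p) p j * qPoch (β * δ * p) p j * qPoch (γ * p) p j
      * qPoch p p j ≠ 0) {A C : ℝ}
    (hA : A = (1 - α * p * P) * (1 - α * β * p * P) * (1 - β * δ * p * P) * (1 - γ * p * P)
      / ((1 - α * β * p * P ^ 2) * (1 - α * β * p ^ 2 * P ^ 2)))
    (hC : C = p * (1 - P) * (1 - β * P) * (γ - α * β * P) * (δ - α * P)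
      / ((1 - α * β * P ^ 2) * (1 - α * β * p * P ^ 2))) :
    A * (racahSum N y α β γ δ p (p * P) - racahSum N y α β γ δ p P)
        + C * (racahSum N y α β γ δ p (P / p) - racahSum N y α β γ δ p P)
      = -((1 - (p ^ y)⁻¹) * (1 - γ * δ * p * p ^ y)) * racahSum N y α β γ δ p P := by
  have hlast : racahBasis y γ δ p (N + 1) = 0 := by
    rw [racahBasis, qPoch_inv_pow_eq_zero hp (by omega), zero_mul]
  have lhs : A * (racahSum N y α β γ δ p (p * P) - racahSum N y α β γ δ p P)
        + C * (racahSum N y α β γ δ p (P / p) - racahSum N y α β γ δ p P)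
      = ∑ j ∈ Finset.range (N + 1), racahBasis y γ δ p j * (p ^ j
        * (A * (racahTerm α β γ δ p (p * P) j - racahTerm α β γ δ p P j)
          + C * (racahTerm α β γ δ p (P / p) j - racahTerm α β γ δ p P j))) := by
    simp only [racahSum, ← Finset.sum_sub_distrib, Finset.mul_sum, ← Finset.sum_add_distrib]
    exact Finset.sum_congr rfl fun j _ => by ring
  have rhs : -((1 - (p ^ y)⁻¹) * (1 - γ * δ * p * p ^ y)) * racahSum N y α β γ δ p P
      = ∑ j ∈ Finset.range (N + 1), (-(racahTerm α β γ δ p P j * racahBasis y γ δ p (j + 1))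
        + (1 - p ^ j) * (1 - γ * δ * p * p ^ j) * racahTerm α β γ δ p P j
          * racahBasis y γ δ p j) := by
    rw [racahSum, Finset.mul_sum]
    refine Finset.sum_congr rfl fun j _ => ?_
    have := racahBasis_succ y hp.ne' γ δ j
    linear_combination (-racahTerm α β γ δ p P j) * this
  rw [lhs, rhs, Finset.sum_add_distrib, Finset.sum_range_succ (fun j =>
    -(racahTerm α β γ δ p P j * racahBasis y γ δ p (j + 1))), hlast, Finset.sum_range_succ',
    Finset.sum_range_succ' (fun j => (1 - p ^ j) * (1 - γ * δ * p * p ^ j)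
      * racahTerm α β γ δ p P j * racahBasis y γ δ p j)]
  have z1 : ∀ P, racahTerm α β γ δ p P 0 = 1 := fun P => by simp [racahTerm]
  simp only [z1, pow_zero, sub_self, mul_zero, zero_mul, neg_zero, add_zero]
  rw [← Finset.sum_add_distrib]
  refine Finset.sum_congr rfl fun j hj => ?_
  rw [Finset.mem_range] at hj
  rw [racahTerm_recurrence hp.ne' hP h0 h1 h2 (hD (j + 1) (by omega)) hA hC]
  ring

lemma qRacah_eq_racahSum {p : ℝ} (hp : 0 < p) {n N : ℕ} (hn : n ≤ N) (y : ℕ) (α β γ δ : ℝ) :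
    qRacah n y α β γ δ p = racahSum N y α β γ δ p (p ^ n) := by
  have e1 : ∀ k : ℕ, p ^ (-(k : ℝ)) = (p ^ k)⁻¹ := fun k => by
    rw [Real.rpow_neg hp.le, Real.rpow_natCast]
  have e2 : ∀ (a : ℝ) (k : ℕ), a * p ^ ((k : ℝ) + 1) = a * p * p ^ k := fun a k => by
    rw [Real.rpow_add hp, Real.rpow_one, Real.rpow_natCast]; ring
  rw [qRacah, qHyp, racahSum, tsum_eq_sum (s := Finset.range (N + 1))]
  · refine Finset.sum_congr rfl fun j _ => ?_
    simp only [List.map_cons, List.map_nil, List.prod_cons, List.prod_nil, e1, e2, racahTerm,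
      racahBasis]
    simp only [div_eq_mul_inv, mul_inv, mul_one]
    ring
  · intro j hj
    simp only [Finset.mem_range, not_lt] at hj
    simp only [List.map_cons, List.map_nil, List.prod_cons, List.prod_nil, e1]
    rw [qPoch_inv_pow_eq_zero hp (by omega : n < j)]
    simp

lemma racahSum_one (N y : ℕ) (α β γ δ : ℝ) {p : ℝ} (hp : 0 < p) :
    racahSum N y α β γ δ p 1 = 1 := by
  rw [racahSum, Finset.sum_range_succ', Finset.sum_eq_zero]
  · simp [racahTerm, racahBasis]
  · intro j _
    have := qPoch_inv_pow_eq_zero (n := 0) hp (Nat.succ_pos j)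
    rw [pow_zero] at this
    rw [racahTerm, this]
    simp

/-! ### The one-site sum is a `q`-Racah function -/

/-- The part of `cr` that depends on `x`. -/
def crRatio (q M L r v : ℝ) (y x : ℕ) : ℝ :=
  qPoch (-(v * r * L * q / M)) (q ^ 2) x / qPoch (v * L * M * q / r / (q ^ 2) ^ x) (q ^ 2) (x + y)

/-- The lower argument is divided by q² while the length grows by one, so numerator and denominator
each gain a single factor. This quotient turns `recA` and `recC` into `recUp` and `recDown`. -/
lemma crRatio_succ {q M L r v : ℝ} (hq : 0 < q) {y x : ℕ} {X : ℝ} (hX : X = (q ^ 2) ^ x)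
    (hD : 1 - v * M * L / (q * r * X) ≠ 0) :
    crRatio q M L r v y (x + 1) * (1 - v * M * L / (q * r * X))
      = crRatio q M L r v y x * (1 + v * r * L * q * X / M) := by
  have hXpos : 0 < X := hX ▸ pow_pos (pow_pos hq 2) x
  have e1 : v * L * M * q / r / (q ^ 2) ^ (x + 1) = v * M * L / (q * r * X) := by
    rw [pow_succ, ← hX]; field_simp
  have e2 : v * M * L / (q * r * X) * q ^ 2 = v * L * M * q / r / X := by field_simp
  rw [crRatio, crRatio, qPoch_succ, show x + 1 + y = x + y + 1 by ring, e1, qPoch_succ_left, e2,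
    ← hX, ← div_div, div_right_comm, div_mul_cancel₀ _ hD]
  ring

/-- At x = 0 the truncated x - 1 is again 0, so a single initial value determines the solution. -/
lemma eq_of_three_term {N : ℕ} {S G e u c d : ℕ → ℝ}
    (hS : ∀ x < N, e x * S x = u x * S (x + 1) + c x * S x + d x * S (x - 1))
    (hG : ∀ x < N, e x * G x = u x * G (x + 1) + c x * G x + d x * G (x - 1))
    (hu : ∀ x < N, u x ≠ 0) (h0 : S 0 = G 0) : ∀ x ≤ N, S x = G x := by
  intro x
  induction x using Nat.strong_induction_on with
  | _ x ih =>
    intro hx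
    rcases x with _ | x
    · exact h0
    · have i1 := ih x (by omega) (by omega)
      have i2 := ih (x - 1) (by omega) (by omega)
      have s1 := hS x (by omega)
      have s2 := hG x (by omega)
      rw [i1, i2] at s1
      exact mul_left_cancel₀ (hu x (by omega)) (by linarith)

/-- Conjugating the q-Racah recurrence by `crRatio` gives the recurrence of the one-site sum. `hD`
and `hD'` permit `crRatio_succ` at x and x - 1; `hα` and `hβ` exclude zero denominators in the
series. -/
lemma crRatio_racahSum_recurrence {q : ℝ} (hq : 0 < q) (hq1 : q ≠ 1) {x y N : ℕ}
    (hy : y ≤ N) {M L r v X Y : ℝ} (hL : 0 < L) (hr : 0 < r) (hv : v ≠ 0) (hM : M = q ^ N)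
    (hX : X = (q ^ 2) ^ x) (hY : Y = (q ^ 2) ^ y)
    (hD : 1 - v * M * L / (q * r * X) ≠ 0) (hD' : x ≠ 0 → 1 - v * L * M * q / (r * X) ≠ 0)
    (hα : ∀ j ≤ N, qPoch (-(L * r * q / (v * M))) (q ^ 2) j ≠ 0)
    (hβ : ∀ j ≤ N, qPoch (-(v * r * L * q / M)) (q ^ 2) j ≠ 0) {G : ℕ → ℝ}
    (hG : ∀ x, G x = crRatio q M L r v y x * racahSum N y (-(L * r / (v * M * q)))
      (v * r / (L * M * q)) ((M * q) ^ 2)⁻¹ (-L ^ 2) (q ^ 2) ((q ^ 2) ^ x)) :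
    (L⁻¹ * Y⁻¹ - L * Y / M ^ 2) * G x
      = recUp q M L r v X * G (x + 1)
        + L⁻¹ * ((1 - L ^ 2 / M ^ 2) - (recA q M L r v X + recC q M L r v X)) * G x
        + recDown q M L r v X * G (x - 1) := by
  have hMpos : 0 < M := hM ▸ pow_pos hq N
  have hXpos : 0 < X := hX ▸ pow_pos (pow_pos hq 2) x
  have hYpos : 0 < Y := hY ▸ pow_pos (pow_pos hq 2) y
  have hp : 0 < q ^ 2 := by positivity
  have hp1 : q ^ 2 ≠ 1 := sq_ne_one hq hq1
  set α := -(L * r / (v * M * q)) with hαdef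
  set β := v * r / (L * M * q) with hβdef
  set γ := ((M * q) ^ 2)⁻¹ with hγdef
  set δ := -L ^ 2 with hδdef
  have aβ : α * β = -(r ^ 2 / (M ^ 2 * q ^ 2)) := by rw [hαdef, hβdef]; field_simp
  have aα : α * q ^ 2 = -(L * r * q / (v * M)) := by rw [hαdef]; field_simp
  have aδ : β * δ * q ^ 2 = -(v * r * L * q / M) := by rw [hβdef, hδdef]; field_simp
  have aγ : γ * q ^ 2 = ((q ^ 2) ^ N)⁻¹ := by
    rw [hγdef, pow_right_comm q 2 N, ← hM]; field_simp
  have aγM : γ * q ^ 2 = (M ^ 2)⁻¹ := by rw [hγdef]; field_simp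
  have d0 : 1 - α * β * X ^ 2 = 1 + r ^ 2 * X ^ 2 / (M ^ 2 * q ^ 2) := by rw [aβ]; ring
  have d1 : 1 - α * β * q ^ 2 * X ^ 2 = 1 + r ^ 2 * X ^ 2 / M ^ 2 := by rw [aβ]; field_simp; ring
  have d2 : 1 - α * β * (q ^ 2) ^ 2 * X ^ 2 = 1 + r ^ 2 * q ^ 2 * X ^ 2 / M ^ 2 := by
    rw [aβ]; field_simp; ring
  have hA : recA q M L r v X = (1 - α * q ^ 2 * X) * (1 - α * β * q ^ 2 * X)
      * (1 - β * δ * q ^ 2 * X) * (1 - γ * q ^ 2 * X)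
      / ((1 - α * β * q ^ 2 * X ^ 2) * (1 - α * β * (q ^ 2) ^ 2 * X ^ 2)) := by
    have d3 : 1 - α * β * q ^ 2 * X = 1 + r ^ 2 * X / M ^ 2 := by rw [aβ]; field_simp; ring
    rw [d1, d2, aα, aδ, aγM, d3, recA,
      show 1 + L * q * r * X / (v * M) = 1 - -(L * r * q / (v * M)) * X by ring]
    congr 1
    · ring
    · ring
  have hC : recC q M L r v X = q ^ 2 * (1 - X) * (1 - β * X) * (γ - α * β * X) * (δ - α * X)
      / ((1 - α * β * X ^ 2) * (1 - α * β * q ^ 2 * X ^ 2)) := by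
    have t1 : (1 - β * X) * (δ - α * X) = -(r ^ 2 * X ^ 2 / (M ^ 2 * q ^ 2))
        * ((1 - L * q * M / (v * r * X)) * (1 - v * L * M * q / (r * X))) := by
      rw [hβdef, hδdef, hαdef]; field_simp; ring
    have t2 : γ - α * β * X = r ^ 2 * X / (M ^ 2 * q ^ 2) * (1 + (r ^ 2 * X)⁻¹) := by
      rw [aβ, hγdef]; field_simp; ring
    have t3 : q ^ 2 * (1 - X) * (1 - β * X) * (γ - α * β * X) * (δ - α * X)
        = r ^ 4 * X ^ 4 / (M ^ 4 * q ^ 2) * ((1 - L * q * M / (v * r * X))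
          * (1 - v * L * M * q / (r * X)) * ((1 - X⁻¹) * (1 + (r ^ 2 * X)⁻¹))) := by
      rw [show q ^ 2 * (1 - X) * (1 - β * X) * (γ - α * β * X) * (δ - α * X)
        = q ^ 2 * (1 - X) * ((1 - β * X) * (δ - α * X)) * (γ - α * β * X) by ring, t1, t2]
      have : 1 - X = -X * (1 - X⁻¹) := by field_simp; ring
      rw [this]
      field_simp
    have t4 : (1 + r ^ 2 * X ^ 2 / (M ^ 2 * q ^ 2)) * (1 + r ^ 2 * X ^ 2 / M ^ 2)
        = r ^ 4 * X ^ 4 / (M ^ 4 * q ^ 2) * ((1 + q ^ 2 * M ^ 2 / (r ^ 2 * X ^ 2))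
          * (1 + M ^ 2 / (r ^ 2 * X ^ 2))) := by
      field_simp; ring
    rw [d0, d1, t3, t4, mul_div_mul_left _ _ (by positivity), recC]
  have n0 : 1 - α * β * X ^ 2 ≠ 0 := by rw [d0]; positivity
  have n1 : 1 - α * β * q ^ 2 * X ^ 2 ≠ 0 := by rw [d1]; positivity
  have n2 : 1 - α * β * (q ^ 2) ^ 2 * X ^ 2 ≠ 0 := by rw [d2]; positivity
  have nD : ∀ j ≤ N, qPoch (α * q ^ 2) (q ^ 2) j * qPoch (β * δ * q ^ 2) (q ^ 2) j
      * qPoch (γ * q ^ 2) (q ^ 2) j * qPoch (q ^ 2) (q ^ 2) j ≠ 0 := by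
    intro j hj
    rw [aα, aδ, aγ]
    exact mul_ne_zero (mul_ne_zero (mul_ne_zero (hα j hj) (hβ j hj))
      (qPoch_inv_pow_ne_zero hp hp1 hj)) (qPoch_self_ne_zero hp hp1 j)
  have racah := racahSum_recurrence hp hy hXpos.ne' n0 n1 n2 nD hA hC
  have eup : q ^ 2 * X = (q ^ 2) ^ (x + 1) := by rw [pow_succ, hX]; ring
  have up : recUp q M L r v X * crRatio q M L r v y (x + 1)
      = L⁻¹ * recA q M L r v X * crRatio q M L r v y x := by
    have h := crRatio_succ (y := y) hq hX hD
    rw [recUp, recA]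
    linear_combination (L⁻¹ * ((1 + L * q * r * X / (v * M))
      * ((1 + r ^ 2 * X / M ^ 2) * (1 - X / M ^ 2))
      / ((1 + r ^ 2 * q ^ 2 * X ^ 2 / M ^ 2) * (1 + r ^ 2 * X ^ 2 / M ^ 2)))) * h
  have down : recDown q M L r v X * G (x - 1) = L⁻¹ * recC q M L r v X
      * (crRatio q M L r v y x * racahSum N y α β γ δ (q ^ 2) (X / q ^ 2)) := by
    -- At x = 0 both lowering coefficients contain 1 - X⁻¹ = 0, so the value `G (0 - 1)` and the
    -- series at P = q⁻² are irrelevant.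
    rcases x with _ | x
    · have : X = 1 := by rw [hX, pow_zero]
      rw [this, recDown_zero, recC]
      simp
    · have hX' : X = q ^ 2 * (q ^ 2) ^ x := by rw [hX, pow_succ]; ring
      have hX'' : (q ^ 2) ^ x = X / q ^ 2 := by rw [hX']; field_simp
      have e : q * r * (X / q ^ 2) = r * X / q := by field_simp
      have e1 : v * M * L / (r * X / q) = v * L * M * q / (r * X) := by field_simp
      have h := crRatio_succ (M := M) (L := L) (r := r) (v := v) (y := y) hq hX''.symm
        (by rw [e, e1]; exact hD' (by omega))
      rw [e, e1] at h
      have e2 : v * r * L * q * (X / q ^ 2) / M = L * v * r * X / (q * M) := by field_simp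
      rw [e2] at h
      rw [Nat.add_sub_cancel, hG, ← hX'', recDown, recC]
      linear_combination (-(L⁻¹ * ((1 - L * q * M / (v * r * X))
        * ((1 - X⁻¹) * (1 + (r ^ 2 * X)⁻¹))
        / ((1 + q ^ 2 * M ^ 2 / (r ^ 2 * X ^ 2)) * (1 + M ^ 2 / (r ^ 2 * X ^ 2))))
        * racahSum N y α β γ δ (q ^ 2) ((q ^ 2) ^ x))) * h
  have lam_eq : (1 - ((q ^ 2) ^ y)⁻¹) * (1 - γ * δ * q ^ 2 * (q ^ 2) ^ y)
      = L * (L⁻¹ * (1 - L ^ 2 / M ^ 2) - (L⁻¹ * Y⁻¹ - L * Y / M ^ 2)) := by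
    rw [← hY, show γ * δ * q ^ 2 = -(L ^ 2 / M ^ 2) by rw [hγdef, hδdef]; field_simp]
    field_simp
    ring
  rw [lam_eq, eup] at racah
  rw [down, hG, hG, ← hX]
  have hLL : L⁻¹ * L = 1 := inv_mul_cancel₀ hL.ne'
  generalize racahSum N y α β γ δ (q ^ 2) ((q ^ 2) ^ (x + 1)) = T1 at *
  generalize racahSum N y α β γ δ (q ^ 2) (X / q ^ 2) = T2 at *
  generalize racahSum N y α β γ δ (q ^ 2) X = T0 at *
  linear_combination (-L⁻¹ * crRatio q M L r v y x) * racah - T1 * up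
    + (L⁻¹ * (1 - L ^ 2 / M ^ 2) - (L⁻¹ * Y⁻¹ - L * Y / M ^ 2)) * T0
      * crRatio q M L r v y x * hLL

/-- Initial value of the three-term recurrence. -/
lemma siteSum_zero_eq {q : ℝ} (hq : 0 < q) (hq1 : q ≠ 1) {y N : ℕ} (hy : y ≤ N) (lam ρ : ℝ)
    {M L r v Y : ℝ} (hL : L = q ^ lam) (hr : r = q ^ ρ) (hv : v ≠ 0) (hM : M = q ^ N)
    (hY : Y = (q ^ 2) ^ y) (h : qPoch (v * L * M * q / r) (q ^ 2) y ≠ 0) :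
    siteSum y 0 lam ρ v N q = v ^ y * qPoch (-(L * r * q / (v * M))) (q ^ 2) y
      * qPoch (v * Y * L * q / (r * M)) (q ^ 2) N
      / ((q ^ 2) ^ y.choose 2 * (q * r * L / M) ^ y) * crRatio q M L r v y 0 := by
  have hMpos : 0 < M := hM ▸ pow_pos hq N
  have hLpos : 0 < L := hL ▸ Real.rpow_pos_of_pos hq lam
  have hrpos : 0 < r := hr ▸ Real.rpow_pos_of_pos hq ρ
  have hYpos : 0 < Y := hY ▸ pow_pos (pow_pos hq 2) y
  have hp : q ^ 2 ≠ 0 := by positivity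
  have hNy : (q ^ 2) ^ (N - y) = M ^ 2 / Y := by
    have h2 : (q ^ 2) ^ (N - y) * (q ^ 2) ^ y = (q ^ 2) ^ N := by
      rw [← pow_add, Nat.sub_add_cancel hy]
    rw [← hY, pow_right_comm q 2 N, ← hM] at h2
    field_simp
    exact h2
  -- The last y of the N factors are the denominator of `crRatio` at x = 0 and cancel it.
  have split : qPoch (v * Y * L * q / (r * M)) (q ^ 2) N
      = qPoch (v * Y * L * q / (r * M)) (q ^ 2) (N - y)
        * qPoch (v * L * M * q / r) (q ^ 2) y := by
    conv_lhs => rw [← Nat.sub_add_cancel hy, qPoch_add, hNy]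
    congr 2
    field_simp
  have first : qPoch (-(L⁻¹ * (v * M / (r * q)))) (q ^ 2)⁻¹ y
      = v ^ y / ((q ^ 2) ^ y.choose 2 * (q * r * L / M) ^ y)
        * qPoch (-(L * r * q / (v * M))) (q ^ 2) y := by
    rw [qPoch_invert (by simp [hLpos.ne', hv, hMpos.ne', hrpos.ne', hq.ne']) hp, neg_neg,
      show L⁻¹ * (v * M / (r * q)) = v / (q * r * L / M) by field_simp, div_pow, div_div,
      mul_comm ((q * r * L / M) ^ y), show (-(v / (q * r * L / M)))⁻¹ = -(L * r * q / (v * M)) by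
        rw [inv_neg, inv_div]; congr 1; field_simp]
  rw [siteSum_zero hq hq1 hy, ← hL, ← hr, ← hM, sitePoly, first, qPoch_inv_base hp, hNy, split,
    crRatio, pow_zero, div_one, qPoch_zero, zero_add,
    show v * M / (r * q) / L⁻¹ * q ^ 2 / (M ^ 2 / Y) = v * Y * L * q / (r * M) by field_simp]
  generalize qPoch (v * L * M * q / r) (q ^ 2) y = Z at *
  field_simp

/-- The one-site sum is a `q`-Racah function, for generic `v`. -/
lemma siteSum_eq_racahSum {q : ℝ} (hq : 0 < q) (hq1 : q ≠ 1) {x y N : ℕ} (hx : x ≤ N) (hy : y ≤ N)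
    (lam ρ : ℝ) {M L r v Y : ℝ} (hL : L = q ^ lam) (hr : r = q ^ ρ) (hv : v ≠ 0) (hM : M = q ^ N)
    (hY : Y = (q ^ 2) ^ y) (h : qPoch (v * L * M * q / r) (q ^ 2) y ≠ 0)
    (hD : ∀ j < N, 1 - v * M * L / (q * r * (q ^ 2) ^ j) ≠ 0)
    (hα : ∀ j ≤ N, qPoch (-(L * r * q / (v * M))) (q ^ 2) j ≠ 0)
    (hβ : ∀ j ≤ N, qPoch (-(v * r * L * q / M)) (q ^ 2) j ≠ 0) :
    siteSum y x lam ρ v N q = v ^ y * qPoch (-(L * r * q / (v * M))) (q ^ 2) y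
      * qPoch (v * Y * L * q / (r * M)) (q ^ 2) N
      / ((q ^ 2) ^ y.choose 2 * (q * r * L / M) ^ y) * (crRatio q M L r v y x
        * racahSum N y (-(L * r / (v * M * q))) (v * r / (L * M * q)) ((M * q) ^ 2)⁻¹ (-L ^ 2)
          (q ^ 2) ((q ^ 2) ^ x)) := by
  have hMpos : 0 < M := hM ▸ pow_pos hq N
  have hLpos : 0 < L := hL ▸ Real.rpow_pos_of_pos hq lam
  have hrpos : 0 < r := hr ▸ Real.rpow_pos_of_pos hq ρ
  have hp : 0 < q ^ 2 := by positivity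
  set K := v ^ y * qPoch (-(L * r * q / (v * M))) (q ^ 2) y
      * qPoch (v * Y * L * q / (r * M)) (q ^ 2) N
      / ((q ^ 2) ^ y.choose 2 * (q * r * L / M) ^ y) with hK
  refine eq_of_three_term (N := N) (S := fun x => siteSum y x lam ρ v N q)
    (G := fun x => K * (crRatio q M L r v y x
      * racahSum N y (-(L * r / (v * M * q))) (v * r / (L * M * q)) ((M * q) ^ 2)⁻¹ (-L ^ 2)
        (q ^ 2) ((q ^ 2) ^ x)))
    (fun x hx => siteSum_recurrence hq hq1 hx.le hy lam ρ hL hv hM hr rfl hY)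
    (fun x hx => ?_) (fun x hx => ?_) ?_ x hx
  · have key := crRatio_racahSum_recurrence hq hq1 (x := x) hy hLpos hrpos hv hM rfl hY (hD x hx)
      (fun hx0 => ?_) hα hβ (fun _ => rfl)
    · linear_combination K * key
    · obtain ⟨k, rfl⟩ := Nat.exists_eq_succ_of_ne_zero hx0
      have e : v * L * M * q / (r * (q ^ 2) ^ (k + 1)) = v * M * L / (q * r * (q ^ 2) ^ k) := by
        rw [pow_succ]
        field_simp
      rw [Nat.succ_eq_add_one, e]
      exact hD k (by omega)
  -- The coefficient of x + 1 must not vanish: its v-dependent factors are nonzero by genericity, 1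
  -- - X/M² because x < N, and the rest is positive.
  · have n1 : 1 + L * q * r * (q ^ 2) ^ x / (v * M) ≠ 0 := by
      have := hα (x + 1) hx
      rw [qPoch_succ] at this
      have h2 := right_ne_zero_of_mul this
      rwa [show 1 - -(L * r * q / (v * M)) * (q ^ 2) ^ x = 1 + L * q * r * (q ^ 2) ^ x / (v * M) by
        ring] at h2
    have n2 : 1 - (q ^ 2) ^ x / M ^ 2 ≠ 0 := by
      have e : M ^ 2 = (q ^ 2) ^ x * (q ^ 2) ^ (N - x - 1 + 1) := by
        rw [hM, pow_right_comm, ← pow_add]; congr 1; omega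
      rw [e, ← div_div, div_self (pow_pos hp x).ne']
      have := one_sub_pow_ne_zero hp (sq_ne_one hq hq1) (N - x - 1)
      have pos := pow_pos hp (N - x - 1 + 1)
      intro h0
      apply this
      field_simp at h0
      linarith
    have n3 := hD x hx
    have pX := pow_pos hp x
    rw [recUp]
    refine mul_ne_zero (inv_ne_zero hLpos.ne') (div_ne_zero (mul_ne_zero (mul_ne_zero n1 n3)
      (mul_ne_zero ?_ n2)) (mul_ne_zero ?_ ?_)) <;> positivity
  · simp only [pow_zero, racahSum_one N y _ _ _ _ hp, mul_one]
    exact siteSum_zero_eq hq hq1 hy lam ρ hL hr hv hM hY h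

/-- A translation of exponents. The conditions have the form of constants times v or v⁻¹, as the
genericity lemmas need; they are not implied by `RegularSite`, and continuity in v closes the gap.
-/
lemma siteSum_eq_rSite {q : ℝ} (hq : 0 < q) (hq1 : q ≠ 1) {x y N : ℕ} (hx : x ≤ N) (hy : y ≤ N)
    (lam ρ : ℝ) {M L r v : ℝ} (hL : L = q ^ lam) (hr : r = q ^ ρ) (hv : v ≠ 0) (hM : M = q ^ N)
    (h : qPoch (v * (L * M * q / r)) (q ^ 2) y ≠ 0)
    (hD : ∀ j < N, 1 - v * (M * L / (q * r * (q ^ 2) ^ j)) ≠ 0)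
    (hα : ∀ j ≤ N, qPoch (v⁻¹ * -(L * r * q / M)) (q ^ 2) j ≠ 0)
    (hβ : ∀ j ≤ N, qPoch (v * -(r * L * q / M)) (q ^ 2) j ≠ 0) :
    siteSum y x lam ρ v N q = rSite y x lam ρ v N q := by
  have hp : 0 < q ^ 2 := by positivity
  have hMpos : 0 < M := hM ▸ pow_pos hq N
  have hLpos : 0 < L := hL ▸ Real.rpow_pos_of_pos hq lam
  have hrpos : 0 < r := hr ▸ Real.rpow_pos_of_pos hq ρ
  have eα : ∀ w : ℝ, w⁻¹ * -(L * r * q / M) = -(L * r * q / (w * M)) := fun w => by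
    rw [← div_div, div_right_comm]; ring
  have eβ : v * -(r * L * q / M) = -(v * r * L * q / M) := by ring
  have e2n : ∀ n : ℕ, q ^ (2 * (n : ℝ)) = (q ^ 2) ^ n := fun n => by
    rw [rpow_two_mul hq, Real.rpow_natCast, pow_right_comm]
  have e1 : q ^ (ρ + lam - N + 1) = r * L * q / M := by
    rw [Real.rpow_add hq, Real.rpow_sub hq, Real.rpow_add hq, Real.rpow_one, Real.rpow_natCast,
      ← hL, ← hr, ← hM]
    ring
  have e2 : q ^ (ρ + lam - N - 1) = r * L / M / q := by
    rw [Real.rpow_sub hq, Real.rpow_sub hq, Real.rpow_add hq, Real.rpow_one, Real.rpow_natCast,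
      ← hL, ← hr, ← hM]
  have e3 : q ^ (ρ - lam - N - 1) = r / L / M / q := by
    rw [Real.rpow_sub hq, Real.rpow_sub hq, Real.rpow_sub hq, Real.rpow_one, Real.rpow_natCast,
      ← hL, ← hr, ← hM]
  have e4 : q ^ (-2 * (N : ℝ) - 2) = ((M * q) ^ 2)⁻¹ := by
    rw [show -2 * (N : ℝ) - 2 = -(2 * (N : ℝ) + (2 : ℕ)) by push_cast; ring, Real.rpow_neg hq.le,
      Real.rpow_add hq, Real.rpow_natCast, e2n, pow_right_comm, ← hM, mul_pow]
  have e5 : q ^ (2 * lam) = L ^ 2 := by rw [rpow_two_mul hq, ← hL]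
  have e6 : q ^ (2 * (y : ℝ) - ρ + lam - N + 1) = (q ^ 2) ^ y / r * L / M * q := by
    rw [Real.rpow_add hq, Real.rpow_sub hq, Real.rpow_add hq, Real.rpow_sub hq, Real.rpow_one,
      Real.rpow_natCast, e2n, ← hL, ← hr, ← hM]
  have e7 : q ^ (-2 * (x : ℝ) - ρ + lam + N + 1) = ((q ^ 2) ^ x)⁻¹ / r * L * M * q := by
    rw [Real.rpow_add hq, Real.rpow_add hq, Real.rpow_add hq, Real.rpow_sub hq, Real.rpow_one,
      Real.rpow_natCast, neg_mul, Real.rpow_neg hq.le, e2n, ← hL, ← hr, ← hM]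
  have e8 : q ^ ((y : ℝ) * ((y : ℝ) + ρ + lam - N))
      = (q ^ 2) ^ y.choose 2 * (q * r * L / M) ^ y := by
    have t1 : (q ^ 2) ^ y.choose 2 * q ^ y = q ^ (y * y) := by
      rw [← pow_mul, ← pow_add, Nat.choose_two_right, Nat.mul_div_cancel' (Nat.even_mul_pred_self y).two_dvd]
      congr 1
      rcases y with _ | y
      · rfl
      · rw [Nat.add_sub_cancel]; ring
    have t2 : q ^ (y : ℝ) = q ^ y := Real.rpow_natCast q y
    rw [mul_comm, Real.rpow_mul_natCast hq.le, Real.rpow_sub hq, Real.rpow_add hq, Real.rpow_add hq,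
      Real.rpow_natCast, Real.rpow_natCast, ← hL, ← hr, ← hM,
      show q * r * L / M = q * (r * L / M) by ring, mul_pow q, ← mul_assoc, t1, pow_mul, ← mul_pow]
    congr 1
    ring
  rw [siteSum_eq_racahSum hq hq1 hx hy lam ρ hL hr hv hM rfl
    (by rwa [show v * L * M * q / r = v * (L * M * q / r) by ring])
    (fun j hj => by
      rw [show v * M * L / (q * r * (q ^ 2) ^ j) = v * (M * L / (q * r * (q ^ 2) ^ j)) by ring]
      exact hD j hj)
    (fun j hj => by rw [← eα]; exact hα j hj) (fun j hj => by rw [← eβ]; exact hβ j hj),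
    rSite, cr, qRacah_eq_racahSum hp hx, e1, e2, e3, e4, e5, e6, e7, e8, crRatio,
    show -v * (r * L * q / M) = -(v * r * L * q / M) by ring,
    show -v⁻¹ * (r * L * q / M) = -(L * r * q / (v * M)) by rw [← eα]; ring,
    show -v⁻¹ * (r * L / M / q) = -(L * r / (v * M * q)) by field_simp,
    show v * (r / L / M / q) = v * r / (L * M * q) by field_simp,
    show v * ((q ^ 2) ^ y / r * L / M * q) = v * (q ^ 2) ^ y * L * q / (r * M) by field_simp,
    show v * (((q ^ 2) ^ x)⁻¹ / r * L * M * q) = v * L * M * q / r / (q ^ 2) ^ x by field_simp]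
  simp only [div_eq_mul_inv, mul_inv]
  ring

/-! ### Genericity in `v` -/

lemma eventually_nhdsNE_ne (v c : ℝ) : ∀ᶠ w in 𝓝[≠] v, w ≠ c := by
  by_cases h : v = c
  · subst h; exact self_mem_nhdsWithin
  · exact (eventually_ne_nhds h).filter_mono nhdsWithin_le_nhds

lemma eventually_one_sub_mul_nhdsNE (v c : ℝ) : ∀ᶠ w in 𝓝[≠] v, 1 - w * c ≠ 0 := by
  filter_upwards [eventually_nhdsNE_ne v c⁻¹] with w hw h
  exact hw (eq_inv_of_mul_eq_one_left (by linarith))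

lemma eventually_one_sub_inv_mul_nhdsNE (v c : ℝ) : ∀ᶠ w in 𝓝[≠] v, 1 - w⁻¹ * c ≠ 0 := by
  filter_upwards [eventually_nhdsNE_ne v c] with w hw h
  have := eq_inv_of_mul_eq_one_left (show w⁻¹ * c = 1 by linarith)
  exact hw (inv_injective this)

lemma eventually_qPoch_mul_nhdsNE (v c p : ℝ) (n : ℕ) :
    ∀ᶠ w in 𝓝[≠] v, qPoch (w * c) p n ≠ 0 := by
  have h : ∀ᶠ w in 𝓝[≠] v, ∀ j ∈ Finset.range n, 1 - w * (c * p ^ j) ≠ 0 :=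
    (Filter.eventually_all_finset _).2 fun j _ => eventually_one_sub_mul_nhdsNE v _
  filter_upwards [h] with w hw
  exact Finset.prod_ne_zero_iff.2 fun j hj => by rw [mul_assoc]; exact hw j hj

lemma eventually_qPoch_inv_mul_nhdsNE (v c p : ℝ) (n : ℕ) :
    ∀ᶠ w in 𝓝[≠] v, qPoch (w⁻¹ * c) p n ≠ 0 := by
  have h : ∀ᶠ w in 𝓝[≠] v, ∀ j ∈ Finset.range n, 1 - w⁻¹ * (c * p ^ j) ≠ 0 :=
    (Filter.eventually_all_finset _).2 fun j _ => eventually_one_sub_inv_mul_nhdsNE v _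
  filter_upwards [h] with w hw
  exact Finset.prod_ne_zero_iff.2 fun j hj => by rw [mul_assoc]; exact hw j hj

lemma qPoch_ne_zero_of_le {a p : ℝ} {j n : ℕ} (hj : j ≤ n) (h : qPoch a p n ≠ 0) :
    qPoch a p j ≠ 0 := by
  obtain ⟨k, rfl⟩ := Nat.exists_eq_add_of_le hj
  rw [qPoch_add] at h
  exact left_ne_zero_of_mul h

lemma eventually_regularSite (y x : ℕ) (lam ρ v : ℝ) (N : ℕ) (q : ℝ) :
    ∀ᶠ w in 𝓝[≠] v, RegularSite y x lam ρ w N q := by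
  filter_upwards [eventually_qPoch_mul_nhdsNE v (q ^ (-2 * (x : ℝ) - ρ + lam + N + 1)) (q ^ 2)
      (x + y),
    eventually_qPoch_inv_mul_nhdsNE v (-q ^ (ρ + lam - N + 1)) (q ^ 2) (min x y),
    eventually_qPoch_mul_nhdsNE v (-q ^ (ρ + lam - N + 1)) (q ^ 2) (min x y)] with w h1 h2 h3
  refine ⟨h1, ?_, ?_⟩
  · rwa [neg_mul_comm]
  · rwa [neg_mul_comm]

/-- Each condition of `siteSum_eq_rSite` excludes finitely many values, possibly v itself, hence the
punctured neighbourhood. -/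
lemma eventually_siteSum_eq_rSite {q : ℝ} (hq : 0 < q) (hq1 : q ≠ 1) {x y N : ℕ} (hx : x ≤ N)
    (hy : y ≤ N) (lam ρ v : ℝ) :
    ∀ᶠ w in 𝓝[≠] v, siteSum y x lam ρ w N q = rSite y x lam ρ w N q := by
  have hD : ∀ᶠ w in 𝓝[≠] v, ∀ j ∈ Finset.range N,
      1 - w * (q ^ N * q ^ lam / (q * q ^ ρ * (q ^ 2) ^ j)) ≠ 0 :=
    (Filter.eventually_all_finset _).2 fun j _ => eventually_one_sub_mul_nhdsNE v _
  filter_upwards [eventually_nhdsNE_ne v 0,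
    eventually_qPoch_mul_nhdsNE v (q ^ lam * q ^ N * q / q ^ ρ) (q ^ 2) y, hD,
    eventually_qPoch_inv_mul_nhdsNE v (-(q ^ lam * q ^ ρ * q / q ^ N)) (q ^ 2) N,
    eventually_qPoch_mul_nhdsNE v (-(q ^ ρ * q ^ lam * q / q ^ N)) (q ^ 2) N]
    with w h0 h1 h2 h3 h4
  exact siteSum_eq_rSite hq hq1 hx hy lam ρ rfl rfl h0 rfl h1
    (fun j hj => h2 j (Finset.mem_range.2 hj)) (fun j hj => qPoch_ne_zero_of_le hj h3)
    (fun j hj => qPoch_ne_zero_of_le hj h4)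

/-! ### Continuity in `v` -/

lemma continuousAt_qPoch {f : ℝ → ℝ} {v : ℝ} (hf : ContinuousAt f v) (p : ℝ) (n : ℕ) :
    ContinuousAt (fun w => qPoch (f w) p n) v := by
  unfold qPoch
  fun_prop

/-- `RegularSite` controls the series denominators only up to index min x y. Later terms are zero
for every parameter value, so their denominators are harmless. -/
lemma continuousAt_rSite {q : ℝ} (hq : 0 < q) (hq1 : q ≠ 1) {x y N : ℕ} (hx : x ≤ N) {lam ρ v : ℝ}
    (hv : v ≠ 0) (h : RegularSite y x lam ρ v N q) :
    ContinuousAt (fun w => rSite y x lam ρ w N q) v := by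
  obtain ⟨h1, h2, h3⟩ := h
  have hp : 0 < q ^ 2 := by positivity
  have hinv : ContinuousAt (fun w : ℝ => -w⁻¹) v := (continuousAt_inv₀ hv).neg
  unfold rSite
  refine ContinuousAt.mul ?_ ?_
  · unfold cr
    refine (continuousAt_id.pow y).mul (ContinuousAt.div ?_ ?_ ?_)
    · exact ((continuousAt_qPoch (continuousAt_id.neg.mul continuousAt_const) _ _).mul
        (continuousAt_qPoch (hinv.mul continuousAt_const) _ _)).mul
        (continuousAt_qPoch (continuousAt_id.mul continuousAt_const) _ _)
    · exact continuousAt_const.mul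
        (continuousAt_qPoch (continuousAt_id.mul continuousAt_const) _ _)
    · exact mul_ne_zero (Real.rpow_pos_of_pos hq _).ne' h1
  · simp only [qRacah_eq_racahSum hp hx, racahSum]
    refine tendsto_finsetSum _ fun j _ => ?_
    by_cases hj : j ≤ min x y
    · refine ContinuousAt.mul ?_ ?_
      · unfold racahTerm
        have e1 : -v⁻¹ * q ^ (ρ + lam - N - 1) * q ^ 2 = -v⁻¹ * q ^ (ρ + lam - N + 1) := by
          rw [mul_assoc, ← Real.rpow_natCast q 2, ← Real.rpow_add hq]
          congr 2; push_cast; ring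
        have e2 : v * q ^ (ρ - lam - N - 1) * -q ^ (2 * lam) * q ^ 2
            = -v * q ^ (ρ + lam - N + 1) := by
          rw [mul_neg, mul_assoc v, ← Real.rpow_add hq, neg_mul, mul_assoc,
            ← Real.rpow_natCast q 2, ← Real.rpow_add hq, neg_mul]
          congr 3; push_cast; ring
        have e3 : q ^ (-2 * (N : ℝ) - 2) * q ^ 2 = ((q ^ 2) ^ N)⁻¹ := by
          rw [← Real.rpow_natCast q 2, ← Real.rpow_add hq, ← Real.rpow_mul_natCast hq.le,
            ← Real.rpow_neg hq.le]
          congr 1; push_cast; ring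
        refine ContinuousAt.div ?_ ?_ ?_
        · exact continuousAt_const.mul (continuousAt_qPoch ((((hinv.mul continuousAt_const).mul
            (continuousAt_id.mul continuousAt_const)).mul continuousAt_const).mul
            continuousAt_const) _ _)
        · exact (((continuousAt_qPoch ((hinv.mul continuousAt_const).mul continuousAt_const) _ _).mul
            (continuousAt_qPoch (((continuousAt_id.mul continuousAt_const).mul
              continuousAt_const).mul continuousAt_const) _ _)).mul continuousAt_const).mul
            continuousAt_const
        · rw [e1, e2, e3]
          exact mul_ne_zero (mul_ne_zero (mul_ne_zero (qPoch_ne_zero_of_le hj h2)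
            (qPoch_ne_zero_of_le hj h3))
            (qPoch_inv_pow_ne_zero hp (sq_ne_one hq hq1) (by omega)))
            (qPoch_self_ne_zero hp (sq_ne_one hq hq1) j)
      · unfold racahBasis
        exact continuousAt_const
    · have zero : ∀ w : ℝ, racahTerm (-w⁻¹ * q ^ (ρ + lam - N - 1)) (w * q ^ (ρ - lam - N - 1))
          (q ^ (-2 * (N : ℝ) - 2)) (-q ^ (2 * lam)) (q ^ 2) ((q ^ 2) ^ x) j
          * ((q ^ 2) ^ j * racahBasis y (q ^ (-2 * (N : ℝ) - 2)) (-q ^ (2 * lam)) (q ^ 2) j)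
          = 0 := by
        intro w
        rcases lt_or_ge x j with hxj | hxj
        · rw [racahTerm, qPoch_inv_pow_eq_zero hp hxj]; simp
        · rw [racahBasis, qPoch_inv_pow_eq_zero hp (by omega : y < j)]; simp
      simp only [zero]
      exact tendsto_const_nhds

/-! ### The product formula -/

variable {m : ℕ} {N : Fin (m + 1) → ℕ}

/-- The powers q^(-u/2), q^(-u/2) and q^u cancel, and the heights depend on ζ and ξ but not on η.
The summand is then a product over sites, and the sum over the product space factors. -/
lemma Rv_eq_prod_siteSum {q : ℝ} (hq : 0 < q) (lam ρ v : ℝ) (ζ ξ : Config N) :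
    Rv q lam ρ v ζ ξ = ∏ i, siteSum (ζ i) (ξ i) (hMinus lam ζ (i : ℕ)) (hPlus ρ ξ ((i : ℕ) + 2)) v
      (N i) q := by
  simp only [siteSum, Finset.sum_range, Finset.prod_univ_sum, Fintype.piFinset_univ]
  rw [Rv]
  refine Finset.sum_congr rfl fun η _ => ?_
  have hu : q ^ (-(1 / 2) * uExp η) * q ^ (-(1 / 2) * uExp η) * q ^ uExp η = 1 := by
    rw [← Real.rpow_add hq, ← Real.rpow_add hq]
    convert Real.rpow_zero q using 2
    ring
  rw [KL, KR, wConfig, total, ← Finset.prod_pow_eq_pow_sum]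
  simp only [Finset.prod_mul_distrib]
  linear_combination (∏ i, kSite (η i) (ζ i) (hMinus lam ζ (i : ℕ)) (N i) q⁻¹)
    * (∏ i, kSite (η i) (ξ i) (hPlus ρ ξ ((i : ℕ) + 2)) (N i) q)
    * (∏ i, wSite (η i) (N i) q) * (∏ i, (-v) ^ (η i : ℕ)) * hu

lemma continuous_Rv {q : ℝ} (lam ρ : ℝ) (ζ ξ : Config N) :
    Continuous fun v => Rv q lam ρ v ζ ξ := by
  unfold Rv
  fun_prop

lemma eventually_regular (q lam ρ v : ℝ) (ζ ξ : Config N) :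
    ∀ᶠ w in 𝓝[≠] v, Regular q lam ρ w ζ ξ :=
  Filter.eventually_all.2 fun _ => eventually_regularSite _ _ _ _ _ _ _

/-- R^v is polynomial in v, hence continuous, and agrees with the product at all nearby parameters
other than v. -/
lemma tendsto_racahProduct {q : ℝ} (hq : 0 < q) (hq1 : q ≠ 1) (lam ρ v : ℝ) (ζ ξ : Config N) :
    Tendsto (fun w => racahProduct q lam ρ w ζ ξ) (𝓝[≠] v) (𝓝 (Rv q lam ρ v ζ ξ)) := by
  refine Tendsto.congr' ?_ ((continuous_Rv lam ρ ζ ξ).continuousAt.tendsto.mono_left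
    nhdsWithin_le_nhds)
  have h : ∀ᶠ w in 𝓝[≠] v, ∀ i, siteSum (ζ i) (ξ i) (hMinus lam ζ (i : ℕ))
      (hPlus ρ ξ ((i : ℕ) + 2)) w (N i) q
      = rSite (ζ i) (ξ i) (hMinus lam ζ (i : ℕ)) (hPlus ρ ξ ((i : ℕ) + 2)) w (N i) q :=
    Filter.eventually_all.2 fun i =>
      eventually_siteSum_eq_rSite hq hq1 (config_le ξ i) (config_le ζ i) _ _ v
  filter_upwards [h] with w hw
  rw [Rv_eq_prod_siteSum hq, racahProduct]
  exact Finset.prod_congr rfl fun i _ => hw i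

/-- By continuity of each factor the product tends to its value at a regular v, and it also tends to
R^v. This covers regular v at which the recurrence argument itself breaks down. -/
lemma Rv_eq_racahProduct {q : ℝ} (hq : 0 < q) (hq1 : q ≠ 1) {lam ρ v : ℝ} (hv : v ≠ 0)
    {ζ ξ : Config N} (h : Regular q lam ρ v ζ ξ) :
    Rv q lam ρ v ζ ξ = racahProduct q lam ρ v ζ ξ := by
  refine tendsto_nhds_unique (tendsto_racahProduct hq hq1 lam ρ v ζ ξ) ?_
  unfold racahProduct
  exact (tendsto_finsetProd _ fun i _ => (continuousAt_rSite hq hq1 (config_le ξ i) hv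
    (h i)).tendsto).mono_left nhdsWithin_le_nhds

end DynASEP

end

theorem theorem3p19 {m : ℕ} (N : Fin (m + 1) → ℕ) (hN : ∀ i, 0 < N i)
    (q : ℝ) (hq : 0 < q) (hq1 : q ≠ 1) (lam ρ v : ℝ) (hv : v ≠ 0) :
    IsDualityFunction (genL q N lam) (genR q N ρ) (Rv q lam ρ v) ∧
    ∀ ζ ξ : Config N,
      (Regular q lam ρ v ζ ξ → Rv q lam ρ v ζ ξ = racahProduct q lam ρ v ζ ξ) ∧
      (∀ᶠ v' in 𝓝[≠] v, Regular q lam ρ v' ζ ξ) ∧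
      Tendsto (fun v' => racahProduct q lam ρ v' ζ ξ) (𝓝[≠] v) (𝓝 (Rv q lam ρ v ζ ξ)) := by
  refine ⟨isDualityFunction_Rv hq hq1 lam ρ v, fun ζ ξ => ⟨Rv_eq_racahProduct hq hq1 hv,
    eventually_regular q lam ρ v ζ ξ, tendsto_racahProduct hq hq1 lam ρ v ζ ξ⟩⟩
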